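/- Let \[ N=\begin{pmatrix}0&1&0\\0&0&1\\0&0&0\end{pmatrix},\qquad J=I+N,\qquad \hat e_3=(0,0,1)^T,\qquad \xi=(x,y,z)^T . \] All families below are formal power series over $\mathbb R$ in $(\xi,\lambda)$, $\lambda=(\lambda_1,\dots,\lambda_k)$, $k\ge 0$. A \emph{flow unfolding} is a family of vector fields $v(\xi;\lambda)$ with $v(0;0)=0$, $D_\xi v(0;0)=N$ and $\nabla_\xi\cdot v=0$. A \emph{map unfolding} is a family of maps $f(\xi;\lambda)$ with $f(0;0)=0$, $D_\xi f(0;0)=J$ and $\det D_\xi f=1$. A \emph{coordinate change} is a family $\psi(\xi;\lambda)$ with $\psi(\xi;0)=\xi+O(2)$ and $\det D_\xi\psi=1$. It transforms $v$ into $w$ if $D_\xi\psi(\xi;\lambda)\,v(\xi;\lambda)=w(\psi(\xi;\lambda);\lambda)$, and $f$ into $g$ if $\psi(f(\xi;\lambda);\lambda)=g(\psi(\xi;\lambda);\lambda)$. The normal forms of the unperturbed systems (those without parameters) are $N\xi+\hat e_3\,p_0(x,y)$ for vector fields and $J(\xi+\hat e_3\,p_0(x,y))$ for maps, where $p_0$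 has no terms of degree less than two. The unfoldings of these normal forms are obtained by replacing $p_0(x,y)$ by \[ \epsilon+\mu_1x+\mu_2y+p(x,y;\epsilon,\mu_1,\mu_2), \] where all terms of $p$ have degree at least two in $(x,y)$. Precisely: 1. Let $v$ be a flow unfolding with any number $k$ of parameters. Then $v(\cdot\,;0)$ can be transformed into its normal form by a coordinate change. Moreover, for any coordinate change $\psi_0(\xi)$ that transforms $v(\cdot\,;0)$ into a normal form $N\xi+\hat e_3p_0(x,y)$, there are a coordinate change $\psi(\xi;\lambda)$ with $\psi(\cdot\,;0)=\psi_0$, power series $\epsilon(\lambda),\mu_1(\lambda),\mu_2(\lambda)$ that vanish at $\lambda=0$, and a power series $p(x,y;\lambda)$ with all terms of degree at least two in $(x,y)$ and $p(x,y;0)=p_0(x,y)$, such that $\psi$ transforms $v$ into \[ N\xi+\hat e_3\bigl(\epsilon(\lambda)+\mu_1(\lambda)x+\mu_2(\lambda)y+p(x,y;\lambda)\bigr). \] 2. Let moreover $k=3$ and let the unfolding be full, i.e. let the map $(\xi,\lambda)\mapsto\bigl(v,\sigma(D_\xi v),\det D_\xi v\bigr)\in\mathbb R^3\times\mathbb R\times\mathbb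 R$ be a submersion at the origin, where $\sigma(M)=\frac12\bigl((\operatorname{tr}M)^2-\operatorname{tr}M^2\bigr)$. Then $\epsilon,\mu_1,\mu_2$ can be taken as the parameters: for every $\psi_0,p_0$ as in 1 there are a formally invertible change of parameters $\lambda=\varphi(\epsilon,\mu_1,\mu_2)$ with $\varphi(0)=0$, a coordinate change $\psi(\xi;\epsilon,\mu_1,\mu_2)$ with $\psi(\cdot\,;0)=\psi_0$, and a power series $p(x,y;\epsilon,\mu_1,\mu_2)$ with all terms of degree at least two in $(x,y)$ and $p(x,y;0)=p_0(x,y)$, such that $\psi$ transforms $v(\xi;\varphi(\epsilon,\mu_1,\mu_2))$ into \[ N\xi+\hat e_3\bigl(\epsilon+\mu_1x+\mu_2y+p(x,y;\epsilon,\mu_1,\mu_2)\bigr). \] 3. Conversely, for every $p(x,y;\epsilon,\mu_1,\mu_2)$ with all terms of degree at least two in $(x,y)$, the last family is a full flow unfolding, and at $\epsilon=\mu_1=\mu_2=0$ it is the normal form $N\xi+\hat e_3\,p(x,y;0)$. 4. Statements 1, 2 and 3 hold for map unfoldings $f$, with the families $N\xi+\hat e_3(\cdots)$ replaced by $J\bigl(\xi+\hat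 e_3(\cdots)\bigr)$; here an unfolding is full if $k=3$ and $(\xi,\lambda)\mapsto\bigl(f-\xi,\operatorname{tr}D_\xi f,\sigma(D_\xi f)\bigr)$ is a submersion at the origin. -/

import Mathlib

noncomputable section

namespace TripleEigenvalue

open MvPowerSeries Matrix

/-- Formal real power series in the phase variables `ξ = (x, y, z)`, with indices `Sum.inl i`,
and in `k` parameters `lam`, with indices `Sum.inr j`. For `k = 0` there are no parameters. -/
abbrev Series (k : ℕ) : Type := MvPowerSeries (Fin 3 ⊕ Fin k) ℝ

/-- Triples of such series: formal `k`-parameter families of vector fields on `ℝ³`, of maps of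
`ℝ³`, or of coordinate changes of `ℝ³`. -/
abbrev VecSeries (k : ℕ) : Type := Fin 3 → Series k

/-- The phase variable `x`, `y` or `z`. -/
def coord {k : ℕ} (i : Fin 3) : Series k := X (Sum.inl i)

/-- The nilpotent Jordan block. -/
def N : Matrix (Fin 3) (Fin 3) ℝ := !![0, 1, 0; 0, 0, 1; 0, 0, 0]

/-- The unipotent Jordan block `I + N`. -/
def J : Matrix (Fin 3) (Fin 3) ℝ := 1 + N

/-- The Jacobian matrix with respect to the phase variables. -/
def jac {k : ℕ} (f : VecSeries k) : Matrix (Fin 3) (Fin 3) (Series k) :=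
  Matrix.of fun i j => pderiv ℝ (Sum.inl j) (f i)

/-- The composition `(ξ, lam) ↦ f (ψ (ξ, lam), lam)`, for `ψ` without constant term. -/
def comp {k : ℕ} (f ψ : VecSeries k) : VecSeries k := fun i =>
  subst (Sum.elim ψ fun j => X (Sum.inr j) : Fin 3 ⊕ Fin k → Series k) (f i)

/-- The family vanishes at `ξ = 0`, `lam = 0`, where its derivative in `ξ` is the matrix `A`.
The terms of positive degree in the parameters are not restricted. -/
def HasLinearPart {k : ℕ} (A : Matrix (Fin 3) (Fin 3) ℝ) (f : VecSeries k) : Prop :=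
  (∀ i, constantCoeff (f i) = 0) ∧
    ∀ i j, coeff (Finsupp.single (Sum.inl j) 1) (f i) = A i j

/-- A formal family of divergence-free vector fields `v (ξ, lam)` with `v (0, 0) = 0` and
`D_ξ v (0, 0) = N`. -/
def IsFlowUnfolding {k : ℕ} (v : VecSeries k) : Prop :=
  HasLinearPart N v ∧ (jac v).trace = 0

/-- A formal family of volume-preserving maps `f (ξ, lam)` with `f (0, 0) = 0` and
`D_ξ f (0, 0) = I + N`. -/
def IsMapUnfolding {k : ℕ} (f : VecSeries k) : Prop :=
  HasLinearPart J f ∧ (jac f).det = 1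

/-- A formal family of volume-preserving coordinate changes `ψ (ξ, lam)` that is near the
identity: `ψ (ξ, 0) = ξ + O(2)`. -/
def IsCoordinateChange {k : ℕ} (ψ : VecSeries k) : Prop :=
  HasLinearPart 1 ψ ∧ (jac ψ).det = 1

/-- The family of vector fields `N ξ + q e₃`. -/
def flowFamily {k : ℕ} (q : Series k) : VecSeries k := fun i =>
  ∑ j, N i j • (coord j : Series k) + (Pi.single 2 q : VecSeries k) i

/-- The family of maps `J (ξ + q e₃)`. -/
def mapFamily {k : ℕ} (q : Series k) : VecSeries k := fun i =>
  ∑ j, J i j • (coord j + (Pi.single 2 q : VecSeries k) j)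

/-- The coordinate change `ψ` transforms the vector fields `v` into `N η + q (η, lam) e₃`, that is
`D_ξ ψ (ξ, lam) v (ξ, lam) = w (ψ (ξ, lam), lam)` with `w = flowFamily q`. -/
def FlowNormalizes {k : ℕ} (v ψ : VecSeries k) (q : Series k) : Prop :=
  IsCoordinateChange ψ ∧ jac ψ *ᵥ v = comp (flowFamily q) ψ

/-- The coordinate change `ψ` conjugates the maps `f` to `J (η + q (η, lam) e₃)`, that is
`ψ (f (ξ, lam), lam) = g (ψ (ξ, lam), lam)` with `g = mapFamily q`. -/
def MapNormalizes {k : ℕ} (f ψ : VecSeries k) (q : Series k) : Prop :=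
  IsCoordinateChange ψ ∧ comp ψ f = comp (mapFamily q) ψ

/-- A series in the parameters alone, regarded as a series in all the variables. -/
def ofParams {n k : ℕ} (ε : MvPowerSeries (Fin k) ℝ) : MvPowerSeries (Fin n ⊕ Fin k) ℝ :=
  subst (fun j => (X (Sum.inr j) : MvPowerSeries (Fin n ⊕ Fin k) ℝ)) ε

/-- A series `p (x, y; lam)`, regarded as a series in all the variables. -/
def ofPlane {k : ℕ} (p : MvPowerSeries (Fin 2 ⊕ Fin k) ℝ) : Series k :=
  subst (Sum.elim ![coord 0, coord 1] fun j => X (Sum.inr j) : Fin 2 ⊕ Fin k → Series k) p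

/-- All terms of `p (x, y; lam)` have degree at least two in `(x, y)`. -/
def IsQuadratic {k : ℕ} (p : MvPowerSeries (Fin 2 ⊕ Fin k) ℝ) : Prop :=
  ∀ m : Fin 2 ⊕ Fin k →₀ ℕ, m (Sum.inl 0) + m (Sum.inl 1) < 2 → coeff m p = 0

/-- `ε + μ₁ x + μ₂ y + p (x, y; lam)`, where `ε`, `μ₁`, `μ₂` are series in the parameters. -/
def unfoldingTerm {k : ℕ} (ε μ₁ μ₂ : MvPowerSeries (Fin k) ℝ)
    (p : MvPowerSeries (Fin 2 ⊕ Fin k) ℝ) : Series k :=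
  ofParams ε + ofParams μ₁ * coord 0 + ofParams μ₂ * coord 1 + ofPlane p

/-- The central member (`lam = 0`) of a family of scalar series. -/
def central {n k : ℕ} (f : MvPowerSeries (Fin n ⊕ Fin k) ℝ) : MvPowerSeries (Fin n ⊕ Fin 0) ℝ :=
  subst (Sum.elim (fun i => X (Sum.inl i)) fun _ => 0 :
    Fin n ⊕ Fin k → MvPowerSeries (Fin n ⊕ Fin 0) ℝ) f

/-- The central member (`lam = 0`) of a family of triples of series. -/
def centralVec {k : ℕ} (f : VecSeries k) : VecSeries 0 := fun i => central (f i)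

/-- A formal change of three parameters, `lam = φ (ε, μ₁, μ₂)`: it preserves the origin and is
formally invertible. -/
def IsParamChange (φ : Fin 3 → MvPowerSeries (Fin 3) ℝ) : Prop :=
  (∀ j, constantCoeff (φ j) = 0) ∧
    (Matrix.of fun i j => coeff (Finsupp.single j 1) (φ i)).det ≠ 0

/-- The family `f (ξ, φ (ε, μ₁, μ₂))`. -/
def reparam (φ : Fin 3 → MvPowerSeries (Fin 3) ℝ) (f : VecSeries 3) : VecSeries 3 := fun i =>
  subst (Sum.elim coord fun j => ofParams (φ j) : Fin 3 ⊕ Fin 3 → Series 3) (f i)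

/-- The second trace `((tr M)² - tr (M²)) / 2` of a matrix. -/
def secondTrace {k : ℕ} (M : Matrix (Fin 3) (Fin 3) (Series k)) : Series k :=
  (2⁻¹ : ℝ) • (M.trace ^ 2 - (M * M).trace)

/-- The coefficients of the terms of degree one, in the phase variables and the parameters. -/
def linearCoeffs {k : ℕ} (f : Series k) : Fin 3 ⊕ Fin k → ℝ := fun s =>
  coeff (Finsupp.single s 1) f

/-- The vector field and the spectrum of its linearization are unfolded completely: the map
`(ξ, lam) ↦ (v, σ (D_ξ v), det (D_ξ v))` to `ℝ³ × ℝ × ℝ` is a submersion at the origin. (The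
characteristic polynomial of the trace-free matrix `M = D_ξ v` is `t³ + σ (M) t - det M`.) -/
def IsFullFlowUnfolding {k : ℕ} (v : VecSeries k) : Prop :=
  LinearIndependent ℝ fun a : Fin 3 ⊕ Fin 2 =>
    linearCoeffs (Sum.elim v ![secondTrace (jac v), (jac v).det] a)

/-- The displacement and the spectrum of the linearization are unfolded completely: the map
`(ξ, lam) ↦ (f - ξ, tr (D_ξ f), σ (D_ξ f))` to `ℝ³ × ℝ × ℝ` is a submersion at the origin. (The
characteristic polynomial of the matrix `M = D_ξ f` with determinant one is
`t³ - tr (M) t² + σ (M) t - 1`.) -/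
def IsFullMapUnfolding {k : ℕ} (f : VecSeries k) : Prop :=
  LinearIndependent ℝ fun a : Fin 3 ⊕ Fin 2 =>
    linearCoeffs (Sum.elim (f - coord) ![(jac f).trace, secondTrace (jac f)] a)

end TripleEigenvalue

end

open TripleEigenvalue

/-! Let `T` be the derivative along `v` for flows, or `g ↦ g ∘ f - g` for maps. Read componentwise,
the conjugacy equation says that `ψ` is the frame `(W, T W, T² W)` for flows, `J (W, T W, T² W)` for
maps, and that `T³ W = q ∘ ψ` (`flowNormalizes_iff`, `mapNormalizes_iff`). A normalization is
therefore one scalar function `W`. Conversely, any `W` whose frame is a coordinate change gives a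
normalization, because `T³ W` is some function `q` of the frame (`exists_frame_relation`). Volume
preservation then forces `∂q/∂z = 0`: the transformed field has divergence `∂q/∂z`, and the
transformed map has Jacobian determinant `1 + ∂q/∂z`.

What remains is one scalar equation for `W`: the Jacobian determinant of its frame is one. It is
solved by successive corrections in a weighted degree where phase variables count one and parameters
two, so that `T` differs by terms of higher degree from the operator `T₀` of the linear system. The
linearized equation `div C (g, T₀ g, T₀² g) = u`, with `C = 1` or `C = J`, is solvable. On `T₀ ^ m
h` its left side is `c T₀ ^ m ∂h/∂x` modulo the range of `T₀ ^ (m + 1)`, where `c = 1 + (m + 1) + (m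
+ 2).choose 2` is not zero; `∂/∂x` is onto; and a high power of `T₀` raises the degree
(`isTriangular_flow`, `isTriangular_map`, `exists_homological`). If `W` solves the equation at `lam
= 0`, all errors and corrections vanish there, so a given normalization of the central member
extends to the family (`IsNormalizable.exists_extension`).

For full unfoldings, the normal form has `det = ∂q/∂x` and `σ = -∂q/∂y` for flows, `tr = 3 + ∂q/∂y`
and `σ = 3 + ∂q/∂y - ∂q/∂x` for maps. Fullness thus makes the differentials of `q`, `∂q/∂x`, `∂q/∂y`
at the origin independent modulo `dy` (`IsTransversal`). These differentials may still involve `dx`,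
so `ε, μ₁, μ₂` need not be coordinates of the parameter space. A translation of `x` by a linear
combination of parameters makes them so (`exists_det_shift_ne_zero`, `FrameNormalizes.translate`),
and formal inversion turns them into the parameters. The converse is a computation of linear parts.
-/

namespace TripleEigenvalue

open MvPowerSeries

/-! ### Weighted filtrations of power series and successive approximation. -/

section Filtration

variable {σ τ : Type*}

/-- The ideal of the series all of whose terms have `w`-weight at least `d`. -/
def fil (w : σ → ℕ) (d : ℕ) : Ideal (MvPowerSeries σ ℝ) where
  carrier := {f | ∀ m, Finsupp.weight w m < d → coeff m f = 0}
  add_mem' hf hg m hm := by rw [map_add, hf m hm, hg m hm, add_zero]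
  zero_mem' m _ := map_zero _
  smul_mem' c f hf m hm := by
    classical
    rw [smul_eq_mul, coeff_mul]
    refine Finset.sum_eq_zero fun x hx => ?_
    rw [hf x.2, mul_zero]
    rw [← Finset.HasAntidiagonal.mem_antidiagonal.1 hx, map_add] at hm
    omega

theorem fil_antitone {w : σ → ℕ} {d e : ℕ} (h : d ≤ e) : fil w e ≤ fil w d :=
  fun _ hf m hm => hf m (hm.trans_le h)

@[simp] theorem fil_zero (w : σ → ℕ) : fil w 0 = ⊤ :=
  eq_top_iff.2 fun _ _ _ hm => absurd hm (Nat.not_lt_zero _)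

theorem smul_mem_fil {w : σ → ℕ} {d : ℕ} {f : MvPowerSeries σ ℝ} (c : ℝ) (hf : f ∈ fil w d) :
    c • f ∈ fil w d := by
  rw [smul_eq_C_mul]
  exact Ideal.mul_mem_left _ _ hf

theorem mul_mem_fil {w : σ → ℕ} {d e : ℕ} {f g : MvPowerSeries σ ℝ} (hf : f ∈ fil w d)
    (hg : g ∈ fil w e) : f * g ∈ fil w (d + e) := by
  classical
  intro m hm
  rw [coeff_mul]
  refine Finset.sum_eq_zero fun x hx => ?_
  rw [← Finset.HasAntidiagonal.mem_antidiagonal.1 hx, map_add] at hm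
  by_cases h : Finsupp.weight w x.1 < d
  · rw [hf _ h, zero_mul]
  · rw [hg _ (by omega), mul_zero]

theorem monomial_mem_fil {w : σ → ℕ} {d : ℕ} {m : σ →₀ ℕ} (h : d ≤ Finsupp.weight w m) (c : ℝ) :
    monomial m c ∈ fil w d := by
  classical
  intro n hn
  rw [coeff_monomial, if_neg]
  rintro rfl
  omega

theorem X_mem_fil (w : σ → ℕ) (i : σ) : (X i : MvPowerSeries σ ℝ) ∈ fil w (w i) :=
  monomial_mem_fil (by simp [Finsupp.weight_single]) 1

theorem mem_fil_one_of_constantCoeff {w : σ → ℕ} (hw : ∀ i, w i ≠ 0) {f : MvPowerSeries σ ℝ}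
    (hf : constantCoeff f = 0) : f ∈ fil w 1 := by
  intro m hm
  have hm0 : m = 0 := by
    by_contra h
    obtain ⟨i, hi⟩ := Finsupp.ne_iff.1 h
    have := Finsupp.le_weight_of_ne_zero' w (s := i) (f := m) hi
    have := hw i
    omega
  rw [hm0, coeff_zero_eq_constantCoeff_apply, hf]

theorem constantCoeff_of_mem_fil {w : σ → ℕ} {d : ℕ} (hd : d ≠ 0) {f : MvPowerSeries σ ℝ}
    (hf : f ∈ fil w d) : constantCoeff f = 0 := by
  rw [← coeff_zero_eq_constantCoeff_apply]
  exact hf 0 (by simpa using Nat.pos_of_ne_zero hd)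

theorem eq_zero_of_forall_mem_fil {w : σ → ℕ} {f : MvPowerSeries σ ℝ} (h : ∀ d, f ∈ fil w d) :
    f = 0 := by
  ext m
  exact h (Finsupp.weight w m + 1) m (Nat.lt_succ_self _)

theorem pderiv_mem_fil {w : σ → ℕ} {d : ℕ} {f : MvPowerSeries σ ℝ} {i : σ}
    (hf : f ∈ fil w (d + w i)) : pderiv ℝ i f ∈ fil w d := by
  intro m hm
  rw [coeff_pderiv, hf, zero_mul]
  rw [map_add, Finsupp.weight_single]
  simp only [smul_eq_mul, one_mul]
  omega

/-- A sequence that converges in a filtration has a limit, which inherits the coefficientwise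
conditions that all members satisfy. -/
theorem exists_limit {w : σ → ℕ} (r : ℕ) (s : ℕ → MvPowerSeries σ ℝ)
    (hs : ∀ n, s (n + 1) - s n ∈ fil w (n + r)) :
    ∃ x : MvPowerSeries σ ℝ, (∀ n, x - s n ∈ fil w (n + r)) ∧
      ∀ (w' : σ → ℕ) (j : ℕ), (∀ n, s n - s 0 ∈ fil w' j) → x - s 0 ∈ fil w' j := by
  have hle : ∀ n m, s (n + m) - s n ∈ fil w (n + r) := by
    intro n m
    induction m with
    | zero => simp
    | succ m ih =>
      rw [← sub_add_sub_cancel _ (s (n + m))]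
      exact add_mem (fil_antitone (by omega) (hs (n + m))) ih
  -- From this index on, the coefficient at `m` no longer changes, whatever `r` is.
  let x : MvPowerSeries σ ℝ := fun m => coeff m (s (Finsupp.weight w m + 1))
  have hx : ∀ m, coeff m x = coeff m (s (Finsupp.weight w m + 1)) := fun _ => rfl
  refine ⟨x, fun n m hm => ?_, fun w' j h m hm => ?_⟩
  · rw [map_sub, hx]
    rcases le_total n (Finsupp.weight w m + 1) with h | h
    · obtain ⟨q, hq⟩ := Nat.exists_eq_add_of_le h
      rw [hq, ← map_sub]
      exact hle n q m hm
    · obtain ⟨q, hq⟩ := Nat.exists_eq_add_of_le h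
      have := hle (Finsupp.weight w m + 1) q m (by omega)
      rw [← hq, map_sub] at this
      linarith
  · rw [map_sub, hx, ← map_sub]
    exact h _ m hm

/-- Solution of an equation `Φ x = 0` by successive corrections, within `x₀ + fil w' j`. -/
theorem exists_zero_of_corrections {w w' : σ → ℕ} (Φ : MvPowerSeries σ ℝ → MvPowerSeries σ ℝ)
    (d₀ r j : ℕ) (x₀ : MvPowerSeries σ ℝ) (h₀ : Φ x₀ ∈ fil w d₀)
    (step : ∀ d x, d₀ ≤ d → x - x₀ ∈ fil w (d₀ + r) ⊓ fil w' j → Φ x ∈ fil w d →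
      ∃ g ∈ fil w (d + r) ⊓ fil w' j, Φ (x + g) ∈ fil w (d + 1))
    (cont : ∀ d x g, g ∈ fil w (d + r) → Φ (x + g) - Φ x ∈ fil w d) :
    ∃ x, x - x₀ ∈ fil w (d₀ + r) ⊓ fil w' j ∧ Φ x = 0 := by
  -- The iterates carry their invariants. The shift `r` is the loss of `Φ`: a change of weight `d +
  -- r` affects `Φ` only from weight `d` on, so `r = 1` suits a first-order differential operator.
  -- The second weight `w'` only records that all corrections stay in `fil w' j`.
  let A (n : ℕ) : Type _ :=
    {x : MvPowerSeries σ ℝ // x - x₀ ∈ fil w (d₀ + r) ⊓ fil w' j ∧ Φ x ∈ fil w (n + d₀)}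
  have next : ∀ n (x : A n), ∃ y : A (n + 1), y.1 - x.1 ∈ fil w (n + (d₀ + r)) := by
    rintro n ⟨x, hx, hΦ⟩
    obtain ⟨g, hg, h⟩ := step (n + d₀) x (by omega) hx hΦ
    refine ⟨⟨x + g, ?_, fil_antitone (by omega) h⟩, ?_⟩
    · rw [add_sub_right_comm]
      exact add_mem hx ⟨fil_antitone (by omega) hg.1, hg.2⟩
    · rw [add_sub_cancel_left, ← add_assoc]
      exact hg.1
  choose F hF using next
  let s : (n : ℕ) → A n := fun n =>
    Nat.rec ⟨x₀, by rw [sub_self]; exact zero_mem _, fil_antitone (by simp) h₀⟩ (fun n x => F n x) n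
  obtain ⟨x, hx, hcl⟩ := exists_limit (w := w) (d₀ + r) (fun n => (s n).1) (fun n => hF n (s n))
  have h0 : (s 0).1 = x₀ := rfl
  refine ⟨x, ⟨?_, ?_⟩, ?_⟩
  · simpa [h0] using hx 0
  · simpa [h0] using hcl w' j fun n => by rw [h0]; exact (s n).2.1.2
  · refine eq_zero_of_forall_mem_fil (w := w) fun d => ?_
    have h1 := cont d (s d).1 (x - (s d).1) (fil_antitone (by omega) (hx d))
    rw [add_sub_cancel] at h1
    have h2 := add_mem h1 (fil_antitone (show d ≤ d + d₀ by omega) (s d).2.2)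
    rwa [sub_add_cancel] at h2

end Filtration

/-! ### Substitution: uniqueness, the chain rule, and inversion near the identity. -/

section Substitution

variable {σ τ υ : Type*}

theorem coeff_mul_X_eq (i : σ) (f : MvPowerSeries σ ℝ) (m : σ →₀ ℕ) :
    coeff m (X i * f) = if m i = 0 then 0 else coeff (m - Finsupp.single i 1) f := by
  classical
  rw [X, coeff_monomial_mul, one_mul]
  by_cases h : m i = 0
  · rw [if_pos h, if_neg]
    intro hle
    have := hle i
    simp [h] at this
  · rw [if_neg h, if_pos]
    simpa [Finsupp.single_le_iff] using Nat.one_le_iff_ne_zero.2 h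

/-- Every series is its constant term plus a combination of the variables. -/
theorem exists_eq_C_add_sum_X_mul [Fintype σ] (f : MvPowerSeries σ ℝ) :
    ∃ g : σ → MvPowerSeries σ ℝ, f = C (constantCoeff f) + ∑ i, X i * g i := by
  classical
  -- This is `∫₀¹ ∂ᵢf (t x) dt`, coefficient by coefficient; the decomposition is then Euler's
  -- identity.
  let g : σ → MvPowerSeries σ ℝ := fun i m => coeff m (pderiv ℝ i f) / (m.degree + 1)
  have hg : ∀ i m, coeff m (g i) = coeff m (pderiv ℝ i f) / (m.degree + 1) := fun _ _ => rfl
  refine ⟨g, ?_⟩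
  ext m
  rw [map_add, map_sum, coeff_C]
  by_cases hm : m = 0
  · subst hm
    simp only [coeff_mul_X_eq]
    simp
  · rw [if_neg hm, zero_add]
    have hdeg : (m.degree : ℝ) ≠ 0 := by
      rwa [Nat.cast_ne_zero, Ne, Finsupp.degree_eq_zero_iff]
    have key : ∀ i, coeff m (X i * g i) = coeff m f / m.degree * m i := by
      intro i
      rw [coeff_mul_X_eq]
      by_cases h : m i = 0
      · simp [h]
      · rw [if_neg h]
        have hle : Finsupp.single i 1 ≤ m := by
          simpa [Finsupp.single_le_iff] using Nat.one_le_iff_ne_zero.2 h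
        obtain ⟨n, rfl⟩ := exists_add_of_le hle
        rw [add_tsub_cancel_left, hg, coeff_pderiv, add_comm n]
        simp only [map_add, Finsupp.degree_single, Finsupp.add_apply, Finsupp.single_eq_same]
        push_cast
        ring
    simp only [key]
    rw [← Finset.mul_sum, ← Nat.cast_sum, ← Finsupp.degree_eq_sum]
    field_simp

/-- An additive map into series is zero if it kills constants and is linear along
substitution of topologically nilpotent series for the variables. -/
theorem eq_zero_of_map_X_mul [Finite σ] (Δ : MvPowerSeries σ ℝ → MvPowerSeries τ ℝ)
    (a : σ → MvPowerSeries τ ℝ) (ha : ∀ i, constantCoeff (a i) = 0)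
    (hadd : ∀ f g, Δ (f + g) = Δ f + Δ g) (hC : ∀ c, Δ (C c) = 0)
    (hX : ∀ i f, Δ (X i * f) = a i * Δ f) (f : MvPowerSeries σ ℝ) : Δ f = 0 := by
  have := Fintype.ofFinite σ
  refine eq_zero_of_forall_mem_fil (w := fun _ => 1) fun d => ?_
  induction d generalizing f with
  | zero => simp
  | succ d ih =>
    obtain ⟨g, hg⟩ := exists_eq_C_add_sum_X_mul f
    have hsum : Δ (∑ i, X i * g i) = ∑ i, a i * Δ (g i) := by
      have : Δ (∑ i, X i * g i) = ∑ i, Δ (X i * g i) :=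
        map_sum (AddMonoidHom.mk' Δ hadd) (fun i => X i * g i) Finset.univ
      rw [this]
      exact Finset.sum_congr rfl fun i _ => hX i _
    rw [hg, hadd, hC, zero_add, hsum]
    refine sum_mem fun i _ => ?_
    rw [add_comm]
    exact mul_mem_fil (mem_fil_one_of_constantCoeff (fun _ => one_ne_zero) (ha i)) (ih _)

/-- No continuity is assumed. The difference of the two maps satisfies `Δ (X i * f) = φ (X i) * Δ
f`, so repeated splitting off of variables puts its values in every power of the maximal ideal. -/
theorem algHom_ext_of_X [Finite σ] {φ φ' : MvPowerSeries σ ℝ →ₐ[ℝ] MvPowerSeries τ ℝ}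
    (h0 : ∀ i, constantCoeff (φ (X i)) = 0) (h : ∀ i, φ (X i) = φ' (X i)) : φ = φ' := by
  ext1 f
  rw [← sub_eq_zero]
  have hc : ∀ (ρ : MvPowerSeries σ ℝ →ₐ[ℝ] MvPowerSeries τ ℝ) (c : ℝ), ρ (C c) = C c :=
    fun ρ c => ρ.commutes c
  refine eq_zero_of_map_X_mul (fun f => φ f - φ' f) (fun i => φ (X i)) h0 ?_ ?_ ?_ f
  · intro f g
    simp only [map_add]
    ring
  · intro c
    simp only [hc, sub_self]
  · intro i f
    simp only [map_mul, ← h]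
    ring

theorem hasSubst_of_zero [Finite σ] {a : σ → MvPowerSeries τ ℝ}
    (ha : ∀ i, constantCoeff (a i) = 0) : HasSubst a := hasSubst_of_constantCoeff_zero ha

theorem constantCoeff_subst' [Finite σ] {a : σ → MvPowerSeries τ ℝ}
    (ha : ∀ i, constantCoeff (a i) = 0) (f : MvPowerSeries σ ℝ) :
    constantCoeff (subst a f) = constantCoeff f := by
  have hs := hasSubst_of_zero ha
  have h := constantCoeff_subst_eq_zero hs ha (f := f - C (constantCoeff f)) (by simp)
  rw [subst_sub hs, map_sub, sub_eq_zero] at h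
  rw [h]
  have := subst_C (S := ℝ) (a := a) (constantCoeff f)
  rw [this, constantCoeff_C]

theorem algHom_eq_subst [Finite σ] (φ : MvPowerSeries σ ℝ →ₐ[ℝ] MvPowerSeries τ ℝ)
    (h0 : ∀ i, constantCoeff (φ (X i)) = 0) (f : MvPowerSeries σ ℝ) :
    φ f = subst (fun i => φ (X i)) f := by
  have hs := hasSubst_of_zero h0
  rw [← coe_substAlgHom hs]
  refine congrArg (fun ρ : MvPowerSeries σ ℝ →ₐ[ℝ] MvPowerSeries τ ℝ => ρ f)
    (algHom_ext_of_X h0 fun i => ?_)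
  rw [substAlgHom_X]

/-- The chain rule. -/
theorem pderiv_subst [Fintype σ] {a : σ → MvPowerSeries τ ℝ}
    (ha : ∀ i, constantCoeff (a i) = 0) (j : τ) (f : MvPowerSeries σ ℝ) :
    pderiv ℝ j (subst a f) = ∑ i, subst a (pderiv ℝ i f) * pderiv ℝ j (a i) := by
  classical
  have hs := hasSubst_of_zero ha
  rw [← sub_eq_zero]
  -- The defect of the chain rule is multiplied by `a i` when `f` is multiplied by `X i`, as the
  -- Leibniz terms containing `∂ⱼ aᵢ` cancel.
  refine eq_zero_of_map_X_mul (fun f => pderiv ℝ j (subst a f) -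
    ∑ i, subst a (pderiv ℝ i f) * pderiv ℝ j (a i)) a ha ?_ ?_ ?_ f
  · intro f g
    simp only [map_add, subst_add hs, add_mul, Finset.sum_add_distrib]
    ring
  · intro c
    have h0 : subst a (0 : MvPowerSeries σ ℝ) = 0 := by
      rw [← coe_substAlgHom hs, map_zero]
    have := subst_C (S := ℝ) (a := a) c
    rw [this]
    simp [h0]
  · intro i f
    have : ∀ k, subst a (pderiv ℝ k (X i * f)) =
        a i * subst a (pderiv ℝ k f) + subst a f * (if i = k then 1 else 0) := by
      intro k
      rw [Derivation.leibniz, smul_eq_mul, smul_eq_mul, subst_add hs, subst_mul hs, subst_mul hs,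
        subst_X hs]
      congr 2
      split_ifs with h
      · subst h
        rw [pderiv_X_self, ← coe_substAlgHom hs, map_one]
      · rw [pderiv_X_of_ne h, ← coe_substAlgHom hs, map_zero]
    simp only [this]
    rw [subst_mul hs, subst_X hs, Derivation.leibniz, smul_eq_mul, smul_eq_mul]
    simp only [add_mul, Finset.sum_add_distrib, mul_ite, mul_one, mul_zero, ite_mul, zero_mul,
      Finset.sum_ite_eq, Finset.mem_univ, if_true, mul_sub, Finset.mul_sum, mul_assoc]
    ring

/-- Telescoping `x y - z t = x (y - t) + (x - z) t`. The first two conclusions are carried along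
because the induction for the third needs them. -/
theorem prod_pow_sub_prod_pow_mem {w : σ → ℕ} {w' : τ → ℕ} {a b : σ → MvPowerSeries τ ℝ} {r : ℕ}
    (ha : ∀ i, a i ∈ fil w' (w i)) (hb : ∀ i, b i ∈ fil w' (w i))
    (hab : ∀ i, a i - b i ∈ fil w' (w i + r)) (m : σ →₀ ℕ) :
    (m.prod fun i e => a i ^ e) ∈ fil w' (Finsupp.weight w m) ∧
    (m.prod fun i e => b i ^ e) ∈ fil w' (Finsupp.weight w m) ∧
    (m.prod fun i e => a i ^ e) - (m.prod fun i e => b i ^ e) ∈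
      fil w' (Finsupp.weight w m + r) := by
  classical
  induction m using Finsupp.induction_linear with
  | zero => simp
  | add m n hm hn =>
    rw [Finsupp.prod_add_index' (by simp) (by simp [pow_add]),
      Finsupp.prod_add_index' (by simp) (by simp [pow_add]), map_add]
    refine ⟨mul_mem_fil hm.1 hn.1, mul_mem_fil hm.2.1 hn.2.1, ?_⟩
    rw [show ∀ x y z t : MvPowerSeries τ ℝ, x * y - z * t = x * (y - t) + (x - z) * t by
      intros; ring]
    refine add_mem ?_ ?_
    · rw [add_assoc]
      exact mul_mem_fil hm.1 hn.2.2
    · rw [add_right_comm]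
      exact mul_mem_fil hm.2.2 hn.2.1
  | single i e =>
    induction e with
    | zero => simp
    | succ e ih =>
      simp only [Finsupp.prod_single_index, pow_zero, Finsupp.weight_single, smul_eq_mul] at ih ⊢
      rw [pow_succ, pow_succ, add_mul, one_mul]
      refine ⟨mul_mem_fil ih.1 (ha i), mul_mem_fil ih.2.1 (hb i), ?_⟩
      rw [show ∀ x y z t : MvPowerSeries τ ℝ, x * y - z * t = x * (y - t) + (x - z) * t by
        intros; ring]
      refine add_mem ?_ ?_
      · rw [add_assoc]
        exact mul_mem_fil ih.1 (hab i)
      · rw [add_right_comm]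
        exact mul_mem_fil ih.2.2 (hb i)

theorem subst_sub_subst_mem_fil [Finite σ] {w : σ → ℕ} {w' : τ → ℕ} {a b : σ → MvPowerSeries τ ℝ}
    {r d : ℕ} (ha0 : ∀ i, constantCoeff (a i) = 0) (hb0 : ∀ i, constantCoeff (b i) = 0)
    (ha : ∀ i, a i ∈ fil w' (w i)) (hb : ∀ i, b i ∈ fil w' (w i))
    (hab : ∀ i, a i - b i ∈ fil w' (w i + r)) {f : MvPowerSeries σ ℝ} (hf : f ∈ fil w d) :
    subst a f - subst b f ∈ fil w' (d + r) := by
  intro m hm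
  have hsa := hasSubst_of_zero ha0
  have hsb := hasSubst_of_zero hb0
  rw [map_sub, coeff_subst hsa, coeff_subst hsb, ← finsum_sub_distrib (coeff_subst_finite hsa f m)
    (coeff_subst_finite hsb f m), finsum_eq_zero_of_forall_eq_zero]
  intro n
  rw [← smul_sub, ← map_sub]
  by_cases hn : Finsupp.weight w n < d
  · rw [hf n hn, zero_smul]
  · rw [(prod_pow_sub_prod_pow_mem ha hb hab n).2.2 m (by omega), smul_zero]

theorem subst_mem_fil [Finite σ] {w : σ → ℕ} {w' : τ → ℕ} {a : σ → MvPowerSeries τ ℝ}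
    {d : ℕ} (ha0 : ∀ i, constantCoeff (a i) = 0)
    (ha : ∀ i, a i ∈ fil w' (w i)) {f : MvPowerSeries σ ℝ} (hf : f ∈ fil w d) :
    subst a f ∈ fil w' d := by
  intro m hm
  have hsa := hasSubst_of_zero ha0
  rw [coeff_subst hsa, finsum_eq_zero_of_forall_eq_zero]
  intro n
  by_cases hn : Finsupp.weight w n < d
  · rw [hf n hn, zero_smul]
  · rw [(prod_pow_sub_prod_pow_mem (r := 0) ha ha (by simp) n).1 m (by omega), smul_zero]

section NearIdentity

variable [Finite σ] {w : σ → ℕ} {a : σ → MvPowerSeries σ ℝ}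
  (ha0 : ∀ i, constantCoeff (a i) = 0) (ha : ∀ i, a i - X i ∈ fil w (w i + 1))

include ha0 ha

theorem subst_sub_self_mem_fil {d : ℕ} {f : MvPowerSeries σ ℝ} (hf : f ∈ fil w d) :
    subst a f - f ∈ fil w (d + 1) := by
  have h := subst_sub_subst_mem_fil (b := X) ha0 (by simp) (fun i => ?_) (X_mem_fil w) ha hf
  · rwa [subst_self, id] at h
  · rw [← sub_add_cancel (a i) (X i)]
    exact add_mem (fil_antitone (Nat.le_succ _) (ha i)) (X_mem_fil w i)

/-- A substitution near the identity preserves the terms of lowest weight, so it cannot raise the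
order of a series. -/
theorem mem_fil_of_subst_mem_fil {d : ℕ} {f : MvPowerSeries σ ℝ} (hf : subst a f ∈ fil w d) :
    f ∈ fil w d := by
  have key : ∀ e, e ≤ d → f ∈ fil w e := by
    intro e
    induction e with
    | zero => simp
    | succ e ih =>
      intro he
      have h := subst_sub_self_mem_fil ha0 ha (ih (by omega))
      have h2 := sub_mem (fil_antitone he hf) h
      rwa [sub_sub_cancel] at h2
  exact key d le_rfl

theorem subst_injective : Function.Injective (subst a : MvPowerSeries σ ℝ → MvPowerSeries σ ℝ) := by
  intro f g h
  rw [← sub_eq_zero]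
  refine eq_zero_of_forall_mem_fil (w := w) fun d => mem_fil_of_subst_mem_fil ha0 ha ?_
  rw [subst_sub (hasSubst_of_zero ha0), h, sub_self]
  exact zero_mem _

theorem subst_surjective :
    Function.Surjective (subst a : MvPowerSeries σ ℝ → MvPowerSeries σ ℝ) := by
  intro h
  have hs := hasSubst_of_zero ha0
  have cont : ∀ (d : ℕ) (x g : MvPowerSeries σ ℝ), g ∈ fil w (d + 0) →
      (h - subst a (x + g)) - (h - subst a x) ∈ fil w d := by
    intro d x g hg
    have h1 := add_mem (fil_antitone (Nat.le_succ _) (subst_sub_self_mem_fil ha0 ha hg)) hg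
    rw [sub_add_cancel] at h1
    rw [subst_add hs, sub_sub_sub_cancel_left, sub_add_cancel_left]
    exact neg_mem h1
  have step : ∀ (d : ℕ) (x : MvPowerSeries σ ℝ), 0 ≤ d →
      x - 0 ∈ fil w (0 + 0) ⊓ fil w 0 → h - subst a x ∈ fil w d →
      ∃ g ∈ fil w (d + 0) ⊓ fil w 0, h - subst a (x + g) ∈ fil w (d + 1) := by
    intro d x _ _ hx
    -- To leading order `subst a` is the identity, so the residual itself serves as the correction.
    refine ⟨h - subst a x, ⟨hx, by simp⟩, ?_⟩
    have h1 := subst_sub_self_mem_fil ha0 ha hx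
    rw [subst_add hs]
    convert neg_mem h1 using 1
    ring
  obtain ⟨x, -, hx⟩ := exists_zero_of_corrections (fun x => h - subst a x) 0 0 0 0 (by simp) step
    cont
  exact ⟨x, (sub_eq_zero.1 hx).symm⟩

end NearIdentity

end Substitution

end TripleEigenvalue

noncomputable section

namespace TripleEigenvalue

open MvPowerSeries

/-! ### First-order expansion of determinants. -/

section Determinant

variable {R : Type*} [CommRing R] {n : Type*} [Fintype n] [DecidableEq n]

theorem det_sub_det_mem {I : Ideal R} {A B : Matrix n n R} (h : ∀ i j, A i j - B i j ∈ I) :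
    A.det - B.det ∈ I := by
  rw [← Ideal.Quotient.eq_zero_iff_mem, map_sub, RingHom.map_det, RingHom.map_det, sub_eq_zero]
  congr 1
  ext i j
  simpa [sub_eq_zero] using Ideal.Quotient.eq_zero_iff_mem.2 (h i j)

/-- First order expansion of the determinant of a `3 × 3` matrix near the identity. -/
theorem det_add_sub_det_sub_trace_mem {M I Q : Ideal R} (hMI : ∀ a ∈ M, ∀ b ∈ I, a * b ∈ Q)
    {A B : Matrix (Fin 3) (Fin 3) R} (hA : ∀ i j, (A - 1) i j ∈ M) (hBM : ∀ i j, B i j ∈ M)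
    (hB : ∀ i j, B i j ∈ I) : (A + B).det - A.det - B.trace ∈ Q := by
  set E := A - 1 with hE
  set P := E + B with hP
  have hPM : ∀ i j, P i j ∈ M := fun i j => add_mem (hA i j) (hBM i j)
  have hPE : ∀ i j, P i j - E i j ∈ I := fun i j => by simpa [hP] using hB i j
  have two : ∀ i j k l, P i j * P k l - E i j * E k l ∈ Q := by
    intro i j k l
    rw [show P i j * P k l - E i j * E k l =
      P i j * (P k l - E k l) + E k l * (P i j - E i j) by ring]
    exact add_mem (hMI _ (hPM i j) _ (hPE k l)) (hMI _ (hA k l) _ (hPE i j))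
  have three : ∀ i j k l p q, P i j * P k l * P p q - E i j * E k l * E p q ∈ Q := by
    intro i j k l p q
    rw [show P i j * P k l * P p q - E i j * E k l * E p q =
      P p q * (P i j * P k l - E i j * E k l) + E i j * (E k l * (P p q - E p q)) by ring]
    exact add_mem (Q.mul_mem_left _ (two i j k l)) (Q.mul_mem_left _ (hMI _ (hA k l) _ (hPE p q)))
  have hAe : A = 1 + E := by rw [hE]; abel
  have hBe : B = P - E := by rw [hP]; abel
  have hABe : A + B = 1 + P := by rw [hAe, hBe]; abel
  -- The linear terms cancel against the trace. What remains are differences of equal quadratic and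
  -- cubic monomials in `P` and in `E`, each of which contains a factor from `M` and a factor from
  -- `I`.
  have key : (A + B).det - A.det - B.trace =
      (P 0 0 * P 1 1 - E 0 0 * E 1 1) + (P 0 0 * P 2 2 - E 0 0 * E 2 2) +
      (P 1 1 * P 2 2 - E 1 1 * E 2 2) - (P 0 1 * P 1 0 - E 0 1 * E 1 0) -
      (P 0 2 * P 2 0 - E 0 2 * E 2 0) - (P 1 2 * P 2 1 - E 1 2 * E 2 1) +
      (P 0 0 * P 1 1 * P 2 2 - E 0 0 * E 1 1 * E 2 2) -
      (P 0 0 * P 1 2 * P 2 1 - E 0 0 * E 1 2 * E 2 1) -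
      (P 0 1 * P 1 0 * P 2 2 - E 0 1 * E 1 0 * E 2 2) +
      (P 0 1 * P 1 2 * P 2 0 - E 0 1 * E 1 2 * E 2 0) +
      (P 0 2 * P 1 0 * P 2 1 - E 0 2 * E 1 0 * E 2 1) -
      (P 0 2 * P 1 1 * P 2 0 - E 0 2 * E 1 1 * E 2 0) := by
    rw [hABe, hAe, hBe, Matrix.det_fin_three, Matrix.det_fin_three, Matrix.trace_fin_three]
    simp
    ring
  rw [key]
  repeat' first | apply two | apply three | apply add_mem | apply sub_mem

end Determinant

/-! ### Frames generated by one function, and the volume equation for them. -/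

variable {k : ℕ}

/-- The weights for which `N ξ` is the leading part of an unfolding. -/
def grade (k : ℕ) : Fin 3 ⊕ Fin k → ℕ := Sum.elim (fun _ => 1) fun _ => 2

/-- Weights that are raised by the linear vector field `N ξ`. -/
def slope (k : ℕ) : Fin 3 ⊕ Fin k → ℕ := Sum.elim ![0, 1, 2] fun _ => 0

/-- The degree in the parameters. -/
def pdeg (k : ℕ) : Fin 3 ⊕ Fin k → ℕ := Sum.elim (fun _ => 0) fun _ => 1

@[simp] theorem grade_inl (i : Fin 3) : grade k (Sum.inl i) = 1 := rfl
@[simp] theorem grade_inr (i : Fin k) : grade k (Sum.inr i) = 2 := rfl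
@[simp] theorem slope_inr (i : Fin k) : slope k (Sum.inr i) = 0 := rfl
@[simp] theorem pdeg_inl (i : Fin 3) : pdeg k (Sum.inl i) = 0 := rfl
@[simp] theorem pdeg_inr (i : Fin k) : pdeg k (Sum.inr i) = 1 := rfl

theorem grade_ne_zero (s : Fin 3 ⊕ Fin k) : grade k s ≠ 0 := by
  rcases s with i | i <;> simp

theorem slope_le (s : Fin 3 ⊕ Fin k) : slope k s ≤ 2 * grade k s := by
  rcases s with i | i
  · fin_cases i <;> simp [slope]
  · simp

theorem weight_slope_le (m : Fin 3 ⊕ Fin k →₀ ℕ) :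
    Finsupp.weight (slope k) m ≤ 2 * Finsupp.weight (grade k) m := by
  rw [Finsupp.weight_eq_sum, Finsupp.weight_eq_sum, Finset.mul_sum]
  refine Finset.sum_le_sum fun s _ => ?_
  simp only [smul_eq_mul]
  calc m s * slope k s ≤ m s * (2 * grade k s) := Nat.mul_le_mul_left _ (slope_le s)
    _ = _ := by ring

/-- Terms of grade `d` have slope at most `2 d`, attained by `z ^ d`. Since `T₀` raises the slope,
this makes `T₀ ^ (2 d + 1)` kill all terms of grade `d`. -/
theorem mem_fil_grade_of_slope {d : ℕ} {f : Series k} (hf : f ∈ fil (grade k) d)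
    (hs : f ∈ fil (slope k) (2 * d + 1)) : f ∈ fil (grade k) (d + 1) := by
  intro m hm
  by_cases h : Finsupp.weight (grade k) m < d
  · exact hf m h
  · refine hs m ?_
    have := weight_slope_le m
    omega

/-- The series whose terms have grade at least `d` and degree at least `j` in the parameters. -/
def bifil (k d j : ℕ) : Ideal (Series k) := fil (grade k) d ⊓ fil (pdeg k) j

theorem smul_mem_bifil {d j : ℕ} {f : Series k} (c : ℝ) (hf : f ∈ bifil k d j) :
    c • f ∈ bifil k d j := ⟨smul_mem_fil c hf.1, smul_mem_fil c hf.2⟩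

theorem pderiv_mem_bifil {d j : ℕ} {f : Series k} (hf : f ∈ bifil k (d + 1) j) (i : Fin 3) :
    pderiv ℝ (Sum.inl i) f ∈ bifil k d j :=
  ⟨pderiv_mem_fil hf.1, pderiv_mem_fil (w := pdeg k) hf.2⟩

theorem jac_add (f g : VecSeries k) : jac (f + g) = jac f + jac g := by
  ext1 i j
  simp [jac]

theorem jac_sub (f g : VecSeries k) : jac (f - g) = jac f - jac g := by
  ext1 i j
  simp [jac]

theorem jac_coord : jac (coord : VecSeries k) = 1 := by
  ext1 i j
  simp only [jac, coord, Matrix.of_apply, Matrix.one_apply]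
  split_ifs with h
  · rw [h, pderiv_X_self]
  · exact pderiv_X_of_ne (by simpa using h)

/-- The frame of functions `C (W, T W, T² W)`. -/
def iterFrame (C : Matrix (Fin 3) (Fin 3) ℝ) (T : Module.End ℝ (Series k)) (W : Series k) :
    VecSeries k := fun i => ∑ j : Fin 3, C i j • (T ^ (j : ℕ)) W

theorem iterFrame_add (C : Matrix (Fin 3) (Fin 3) ℝ) (T : Module.End ℝ (Series k))
    (W W' : Series k) : iterFrame C T (W + W') = iterFrame C T W + iterFrame C T W' := by
  ext1 i
  simp [iterFrame, Finset.sum_add_distrib]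

/-- `T` is a perturbation of `T₀` that raises the grade, and `T₀` raises the slope. -/
structure IsPerturbation (T₀ T : Module.End ℝ (Series k)) : Prop where
  grade₀ : ∀ {d f}, f ∈ fil (grade k) d → T₀ f ∈ fil (grade k) d
  slope₀ : ∀ {d f}, f ∈ fil (slope k) d → T₀ f ∈ fil (slope k) (d + 1)
  pdeg₀ : ∀ {d f}, f ∈ fil (pdeg k) d → T₀ f ∈ fil (pdeg k) d
  pdeg : ∀ {d f}, f ∈ fil (pdeg k) d → T f ∈ fil (pdeg k) d
  sub : ∀ {d f}, f ∈ fil (grade k) d → T f - T₀ f ∈ fil (grade k) (d + 1)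

/-- The operator `g ↦ div (C (g, T₀ g, T₀² g))` acts on the range of `T₀ ^ m` as a nonzero multiple
of `∂/∂x`, up to the range of `T₀ ^ (m + 1)`. -/
def IsTriangular (C : Matrix (Fin 3) (Fin 3) ℝ) (T₀ : Module.End ℝ (Series k)) : Prop :=
  ∀ m : ℕ, ∃ c : ℝ, c ≠ 0 ∧ ∃ R : Series k → Series k,
    (∀ d j h, h ∈ bifil k (d + 1) j → R h ∈ bifil k d j) ∧
    ∀ h, (jac (iterFrame C T₀ ((T₀ ^ m) h))).trace =
      c • (T₀ ^ m) (pderiv ℝ (Sum.inl 0) h) + (T₀ ^ (m + 1)) (R h)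

namespace IsPerturbation

variable {T₀ T : Module.End ℝ (Series k)} (H : IsPerturbation T₀ T)

include H

theorem grade {d : ℕ} {f : Series k} (hf : f ∈ fil (grade k) d) : T f ∈ fil (grade k) d := by
  have := add_mem (fil_antitone (Nat.le_succ d) (H.sub hf)) (H.grade₀ hf)
  rwa [sub_add_cancel] at this

theorem pow_bifil₀ {d j : ℕ} {f : Series k} (hf : f ∈ bifil k d j) (n : ℕ) :
    (T₀ ^ n) f ∈ bifil k d j := by
  induction n with
  | zero => simpa
  | succ n ih =>
    rw [pow_succ', Module.End.mul_apply]
    exact ⟨H.grade₀ ih.1, H.pdeg₀ ih.2⟩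

theorem pow_bifil {d j : ℕ} {f : Series k} (hf : f ∈ bifil k d j) (n : ℕ) :
    (T ^ n) f ∈ bifil k d j := by
  induction n with
  | zero => simpa
  | succ n ih =>
    rw [pow_succ', Module.End.mul_apply]
    exact ⟨H.grade ih.1, H.pdeg ih.2⟩

theorem pow_sub {d j : ℕ} {f : Series k} (hf : f ∈ bifil k d j) (n : ℕ) :
    (T ^ n) f - (T₀ ^ n) f ∈ bifil k (d + 1) j := by
  refine ⟨?_, sub_mem (H.pow_bifil hf n).2 (H.pow_bifil₀ hf n).2⟩
  induction n with
  | zero => simp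
  | succ n ih =>
    rw [pow_succ', pow_succ', Module.End.mul_apply, Module.End.mul_apply,
      ← sub_add_sub_cancel _ (T ((T₀ ^ n) f)), ← map_sub]
    exact add_mem (H.grade ih) (H.sub (H.pow_bifil₀ hf n).1)

theorem pow_slope₀ (f : Series k) (n : ℕ) : (T₀ ^ n) f ∈ fil (slope k) n := by
  induction n with
  | zero => simp
  | succ n ih =>
    rw [pow_succ', Module.End.mul_apply]
    exact H.slope₀ ih

end IsPerturbation

/-- A primitive with respect to `x`. -/
theorem exists_primitive {d j : ℕ} {u : Series k} (hu : u ∈ bifil k d j) :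
    ∃ h ∈ bifil k (d + 1) j, pderiv ℝ (Sum.inl 0) h = u := by
  let p : Fin 3 ⊕ Fin k := Sum.inl 0
  let h : Series k := fun m =>
    if m p = 0 then 0 else coeff (m - Finsupp.single p 1) u / m p
  have hh : ∀ m, coeff m h = if m p = 0 then 0 else coeff (m - Finsupp.single p 1) u / m p :=
    fun _ => rfl
  have aux : ∀ (w : Fin 3 ⊕ Fin k → ℕ) (e : ℕ), u ∈ fil w e → h ∈ fil w (e + w p) := by
    intro w e hw m hm
    rw [hh]
    split_ifs with h0
    · rfl
    · rw [hw, zero_div]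
      have := Finsupp.weight_sub_single_add (w := w) h0
      omega
  refine ⟨h, ⟨aux _ _ hu.1, aux (pdeg k) _ hu.2⟩, ?_⟩
  ext m
  change coeff m (pderiv ℝ p h) = _
  rw [coeff_pderiv, hh]
  have hne : (m + Finsupp.single p 1 : Fin 3 ⊕ Fin k →₀ ℕ) p ≠ 0 := by simp
  rw [if_neg hne, add_tsub_cancel_right, Finsupp.add_apply, Finsupp.single_eq_same]
  push_cast
  exact div_mul_cancel₀ _ (by positivity)

theorem jac_trace_mem {d j : ℕ} {f : VecSeries k} (hf : ∀ i, f i ∈ bifil k (d + 1) j) :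
    (jac f).trace ∈ bifil k d j :=
  sum_mem fun i _ => pderiv_mem_bifil (hf i) i

theorem iterFrame_mem {C : Matrix (Fin 3) (Fin 3) ℝ} {T₀ T : Module.End ℝ (Series k)}
    (H : IsPerturbation T₀ T) {d j : ℕ} {g : Series k} (hg : g ∈ bifil k d j) (i : Fin 3) :
    iterFrame C T g i ∈ bifil k d j :=
  sum_mem fun n _ => smul_mem_bifil _ (H.pow_bifil hg n)

theorem iterFrame_sub_mem {C : Matrix (Fin 3) (Fin 3) ℝ} {T₀ T : Module.End ℝ (Series k)}
    (H : IsPerturbation T₀ T) {d j : ℕ} {g : Series k} (hg : g ∈ bifil k d j) (i : Fin 3) :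
    (iterFrame C T g - iterFrame C T₀ g) i ∈ bifil k (d + 1) j := by
  rw [Pi.sub_apply, iterFrame, iterFrame, ← Finset.sum_sub_distrib]
  refine sum_mem fun n _ => ?_
  rw [← smul_sub]
  exact smul_mem_bifil _ (H.pow_sub hg n)

/-- The linearized equation for the volume density of a frame. -/
theorem exists_homological {C : Matrix (Fin 3) (Fin 3) ℝ} {T₀ T : Module.End ℝ (Series k)}
    (H : IsPerturbation T₀ T) (hC : IsTriangular C T₀) {d j : ℕ} {u : Series k}
    (hu : u ∈ bifil k d j) :
    ∃ g ∈ bifil k (d + 1) j, (jac (iterFrame C T₀ g)).trace - u ∈ bifil k (d + 1) j := by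
  -- Descending induction on `m`, with `n` as the distance to `2 d + 1`: for `m = 2 d + 1` the right
  -- side already has grade `d + 1`, and `m = 0` is the claim.
  have key : ∀ n m : ℕ, 2 * d + 1 = m + n → ∀ u ∈ bifil k d j, ∃ g ∈ bifil k (d + 1) j,
      (jac (iterFrame C T₀ g)).trace - (T₀ ^ m) u ∈ bifil k (d + 1) j := by
    intro n
    induction n with
    | zero =>
      intro m hm u hu
      refine ⟨0, zero_mem _, ?_⟩
      have h0 : (jac (iterFrame C T₀ (0 : Series k))).trace = 0 := by
        simp [iterFrame, jac, Matrix.trace]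
      rw [h0, zero_sub]
      refine neg_mem ⟨mem_fil_grade_of_slope (H.pow_bifil₀ hu m).1 ?_, (H.pow_bifil₀ hu m).2⟩
      rw [hm]
      exact H.pow_slope₀ u m
    | succ n ih =>
      intro m hm u hu
      obtain ⟨c, hc, R, hR, hT⟩ := hC m
      obtain ⟨p, hp, hpu⟩ := exists_primitive (smul_mem_bifil c⁻¹ hu)
      obtain ⟨g, hg, hgR⟩ := ih (m + 1) (by omega) (R p) (hR _ _ _ hp)
      -- With `c ∂p/∂x = u`, the function `T₀ ^ m p` produces `T₀ ^ m u` plus an error `T₀ ^ (m + 1)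
      -- (R p)`, which `g` removes.
      refine ⟨(T₀ ^ m) p - g, sub_mem (H.pow_bifil₀ hp m) hg, ?_⟩
      have hsub : iterFrame C T₀ ((T₀ ^ m) p - g) =
          iterFrame C T₀ ((T₀ ^ m) p) - iterFrame C T₀ g := by
        rw [eq_sub_iff_add_eq, ← iterFrame_add, sub_add_cancel]
      rw [hsub, jac_sub, Matrix.trace_sub, hT, hpu, map_smul, smul_smul, mul_inv_cancel₀ hc,
        one_smul]
      convert neg_mem hgR using 1
      ring
  obtain ⟨g, hg, h⟩ := key (2 * d + 1) 0 (by omega) u hu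
  exact ⟨g, hg, by simpa using h⟩

/-- A frame that is near the identity can be made volume-preserving by changing its first function
by terms that are of the same order in the parameters as the error. -/
theorem exists_iterFrame_det_eq_one {C : Matrix (Fin 3) (Fin 3) ℝ}
    {T₀ T : Module.End ℝ (Series k)} (H : IsPerturbation T₀ T) (hC : IsTriangular C T₀)
    {W₀ : Series k} (hW₀ : ∀ i, (iterFrame C T W₀ - (coord : VecSeries k)) i ∈ fil (grade k) 2) {j : ℕ}
    (hdet : (jac (iterFrame C T W₀)).det - 1 ∈ fil (pdeg k) j) :
    ∃ W, W - W₀ ∈ bifil k 2 j ∧ (jac (iterFrame C T W)).det = 1 := by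
  have hjac : ∀ W, W - W₀ ∈ bifil k 2 j →
      ∀ i l, (jac (iterFrame C T W) - 1) i l ∈ fil (grade k) 1 := by
    intro W hW i l
    have h1 : iterFrame C T W - coord = iterFrame C T (W - W₀) + (iterFrame C T W₀ - coord) := by
      rw [eq_comm, add_sub_assoc', ← iterFrame_add, sub_add_cancel]
    rw [← jac_coord, ← jac_sub, h1]
    exact pderiv_mem_fil (w := grade k) (add_mem (iterFrame_mem H hW i).1 (hW₀ i))
  have hpar : ∀ W, W - W₀ ∈ bifil k 2 j →
      (jac (iterFrame C T W)).det - 1 ∈ fil (pdeg k) j := by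
    intro W hW
    rw [← sub_add_sub_cancel _ (jac (iterFrame C T W₀)).det]
    refine add_mem (det_sub_det_mem fun i l => ?_) hdet
    have h1 : iterFrame C T W - iterFrame C T W₀ = iterFrame C T (W - W₀) := by
      rw [sub_eq_iff_eq_add, ← iterFrame_add, sub_add_cancel]
    rw [← Matrix.sub_apply, ← jac_sub, h1]
    exact (pderiv_mem_bifil (d := 1) (iterFrame_mem H hW i) l).2
  have base : (jac (iterFrame C T W₀)).det - 1 ∈ fil (grade k) 1 := by
    rw [← Matrix.det_one (n := Fin 3) (R := Series k)]
    exact det_sub_det_mem (hjac W₀ (by rw [sub_self]; exact zero_mem _))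
  have cont : ∀ (d : ℕ) (x g : Series k), g ∈ fil (grade k) (d + 1) →
      ((jac (iterFrame C T (x + g))).det - 1) - ((jac (iterFrame C T x)).det - 1) ∈
        fil (grade k) d := by
    intro d x g hg
    rw [sub_sub_sub_cancel_right]
    refine det_sub_det_mem fun i l => ?_
    rw [← Matrix.sub_apply, iterFrame_add, jac_add, add_sub_cancel_left]
    exact pderiv_mem_fil (w := grade k) (iterFrame_mem (j := 0) H ⟨hg, by simp⟩ i).1
  have step : ∀ (d : ℕ) (x : Series k), 1 ≤ d → x - W₀ ∈ fil (grade k) (1 + 1) ⊓ fil (pdeg k) j →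
      (jac (iterFrame C T x)).det - 1 ∈ fil (grade k) d →
      ∃ g ∈ fil (grade k) (d + 1) ⊓ fil (pdeg k) j,
        (jac (iterFrame C T (x + g))).det - 1 ∈ fil (grade k) (d + 1) := by
    intro d x hd hx hΦ
    have hu : 1 - (jac (iterFrame C T x)).det ∈ bifil k d j := by
      rw [← neg_sub]
      exact neg_mem ⟨hΦ, hpar x hx⟩
    -- Three errors are to be of grade `d + 1`: the residual of the homological equation, the
    -- nonlinear part of the determinant (`h1`), and the replacement of `T` by `T₀` in the trace
    -- (`h2`).
    obtain ⟨g, hg, h⟩ := exists_homological H hC hu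
    refine ⟨g, hg, ?_⟩
    have hB : ∀ i l, jac (iterFrame C T g) i l ∈ fil (grade k) d := fun i l =>
      (pderiv_mem_bifil (iterFrame_mem H hg i) l).1
    have h1 := det_add_sub_det_sub_trace_mem (M := fil (grade k) 1) (I := fil (grade k) d)
      (Q := fil (grade k) (d + 1))
      (fun a ha b hb => by rw [add_comm]; exact mul_mem_fil ha hb) (hjac x hx)
      (fun i l => fil_antitone hd (hB i l)) hB
    have h2 : (jac (iterFrame C T g)).trace - (jac (iterFrame C T₀ g)).trace ∈
        bifil k (d + 1) j := by
      rw [← Matrix.trace_sub, ← jac_sub]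
      exact jac_trace_mem (iterFrame_sub_mem H hg)
    rw [iterFrame_add, jac_add]
    convert add_mem h1 (add_mem h2.1 h.1) using 1
    ring
  obtain ⟨x, hx, h⟩ := exists_zero_of_corrections
    (fun x => (jac (iterFrame C T x)).det - 1) 1 1 j W₀ base step cont
  exact ⟨x, hx, sub_eq_zero.1 h⟩

end TripleEigenvalue

end

noncomputable section

namespace TripleEigenvalue

open MvPowerSeries

/-! ### Linear parts of families in the weighted grading. -/

variable {k : ℕ}

/-- The linear vector field or map with matrix `A`. -/
def linearVec (k : ℕ) (A : Matrix (Fin 3) (Fin 3) ℝ) : VecSeries k := fun i =>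
  ∑ j, A i j • (coord j : Series k)

/-- Parameters have grade two, so their linear terms are unrestricted. This is why condition
`HasLinearPart` is exactly closeness to the linear system modulo grade two. -/
theorem mem_fil_grade_two {f : Series k} :
    f ∈ fil (grade k) 2 ↔
      constantCoeff f = 0 ∧ ∀ j : Fin 3, coeff (Finsupp.single (Sum.inl j) 1) f = 0 := by
  constructor
  · intro h
    exact ⟨constantCoeff_of_mem_fil two_ne_zero h, fun j => h _ (by simp [Finsupp.weight_single])⟩
  · rintro ⟨h0, h1⟩ m hm
    by_cases hm0 : m = 0
    · rw [hm0, coeff_zero_eq_constantCoeff_apply, h0]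
    · obtain ⟨s, hs⟩ := Finsupp.ne_iff.1 hm0
      have hadd := Finsupp.weight_sub_single_add (w := grade k) hs
      have hrest : m - Finsupp.single s 1 = 0 := by
        by_contra hne
        obtain ⟨t, ht⟩ := Finsupp.ne_iff.1 hne
        have h2 := Finsupp.le_weight_of_ne_zero' (grade k) (s := t) ht
        have h3 := grade_ne_zero s
        have h4 := grade_ne_zero t
        omega
      have hle : Finsupp.single s 1 ≤ m := by
        simpa [Finsupp.single_le_iff] using Nat.one_le_iff_ne_zero.2 hs
      have hm1 : m = Finsupp.single s 1 := by
        rw [← tsub_add_cancel_of_le hle, hrest, zero_add]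
      rcases s with j | j
      · rw [hm1, h1]
      · rw [hm1, Finsupp.weight_single] at hm
        simp at hm

theorem coeff_single_coord (i j : Fin 3) :
    coeff (Finsupp.single (Sum.inl j) 1) (coord i : Series k) = if i = j then 1 else 0 := by
  classical
  rw [coord, coeff_X]
  simp only [Finsupp.single_left_inj one_ne_zero, Sum.inl.injEq, eq_comm]

theorem constantCoeff_coord (i : Fin 3) : constantCoeff (coord i : Series k) = 0 :=
  constantCoeff_X _

theorem constantCoeff_linearVec (A : Matrix (Fin 3) (Fin 3) ℝ) (i : Fin 3) :
    constantCoeff (linearVec k A i) = 0 := by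
  simp [linearVec, constantCoeff_coord]

theorem hasLinearPart_iff {A : Matrix (Fin 3) (Fin 3) ℝ} {f : VecSeries k} :
    HasLinearPart A f ↔ ∀ i, f i - linearVec k A i ∈ fil (grade k) 2 := by
  simp only [HasLinearPart, mem_fil_grade_two, map_sub, constantCoeff_linearVec, sub_zero,
    forall_and, sub_eq_zero]
  refine and_congr Iff.rfl (forall_congr' fun i => forall_congr' fun j => ?_)
  simp [linearVec, coeff_single_coord]

theorem linearVec_one : linearVec k 1 = coord := by
  ext1 i
  simp [linearVec, Matrix.one_apply]

theorem linearVec_mem_fil (A : Matrix (Fin 3) (Fin 3) ℝ) (i : Fin 3) :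
    linearVec k A i ∈ fil (grade k) 1 :=
  mem_fil_one_of_constantCoeff grade_ne_zero (constantCoeff_linearVec A i)

theorem linearVec_N_zero : linearVec k N 0 = coord 1 := by
  simp [linearVec, N, Fin.sum_univ_three]

theorem linearVec_N_one : linearVec k N 1 = coord 2 := by
  simp [linearVec, N, Fin.sum_univ_three]

theorem linearVec_N_two : linearVec k N 2 = 0 := by
  simp [linearVec, N, Fin.sum_univ_three]

theorem linearVec_J (i : Fin 3) : linearVec k J i = coord i + linearVec k N i := by
  simp [linearVec, J, Matrix.one_apply, add_smul, Finset.sum_add_distrib]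

theorem linearVec_J_zero : linearVec k J 0 = coord 0 + coord 1 := by
  rw [linearVec_J, linearVec_N_zero]

theorem linearVec_J_one : linearVec k J 1 = coord 1 + coord 2 := by
  rw [linearVec_J, linearVec_N_one]

theorem linearVec_J_two : linearVec k J 2 = coord 2 := by
  rw [linearVec_J, linearVec_N_two, add_zero]

/-! ### Commutation of partial derivatives with powers of the operator, in an abstract ring. -/

section Commutation

variable {E : Type*} [Ring E] {T S a b c : E} (hS : Commute S T) (ha : a * T = T * a)
  (hb : b * T = T * b + S * a) (hc : c * T = T * c + S * b)

include ha in
theorem mul_pow_comm (n : ℕ) : a * T ^ n = T ^ n * a :=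
  (show Commute a T from ha).pow_right n

-- Here `a, b, c` stand for `∂/∂x, ∂/∂y, ∂/∂z`. The factor `S` is `1` for the derivation along `N ξ`
-- and `1 + T`, the pullback by `J`, for the difference operator.
include hS ha hb in
theorem mul_pow_succ_comm (n : ℕ) :
    b * T ^ (n + 1) = T ^ (n + 1) * b + (n + 1 : ℕ) • (T ^ n * (S * a)) := by
  induction n with
  | zero => simpa using hb
  | succ n ih =>
    have h1 : T ^ n * (S * a) * T = T ^ (n + 1) * (S * a) := by
      rw [mul_assoc, mul_assoc, ha, ← mul_assoc S, hS.eq, pow_succ]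
      simp only [mul_assoc]
    rw [pow_succ, ← mul_assoc, ih, add_mul, mul_assoc _ b, hb, smul_mul_assoc, h1, mul_add,
      succ_nsmul _ (n + 1), pow_succ T n]
    simp only [mul_assoc]
    abel

-- The binomial coefficient counts the pairs of factors `T` past which `c` turns first into `b` and
-- then into `a`.
include hS ha hb hc in
theorem mul_pow_succ_succ_comm (n : ℕ) :
    c * T ^ (n + 2) = T ^ (n + 2) * c + (n + 2 : ℕ) • (T ^ (n + 1) * (S * b)) +
      ((n + 2).choose 2) • (T ^ n * (S * (S * a))) := by
  induction n with
  | zero =>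
    rw [zero_add, pow_two, ← mul_assoc, hc, add_mul, mul_assoc, hc, mul_assoc, hb, ← pow_two,
      mul_add, mul_add, ← mul_assoc S, hS.eq]
    simp only [Nat.choose_self, one_smul, pow_zero, one_mul, pow_one, two_smul, pow_two, zero_add,
      mul_assoc]
    abel
  | succ n ih =>
    have h1 : T ^ n * (S * (S * a)) * T = T ^ (n + 1) * (S * (S * a)) := by
      have : S * (S * a) * T = T * (S * (S * a)) := by
        rw [mul_assoc, mul_assoc, ha, ← mul_assoc S T, hS.eq, ← mul_assoc S, ← mul_assoc S, hS.eq]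
        simp only [mul_assoc]
      rw [mul_assoc, this, ← mul_assoc, pow_succ]
    have h2 : T ^ (n + 1) * (S * b) * T = T ^ (n + 2) * (S * b) + T ^ (n + 1) * (S * (S * a)) := by
      rw [mul_assoc, mul_assoc, hb, mul_add, mul_add, ← mul_assoc S T, hS.eq, pow_succ T (n + 1)]
      simp only [mul_assoc]
    have h3 : T ^ (n + 2) * c * T = T ^ (n + 3) * c + T ^ (n + 2) * (S * b) := by
      rw [mul_assoc, hc, mul_add, pow_succ T (n + 2)]
      simp only [mul_assoc]
    have hch : (n + 1 + 2).choose 2 = (n + 2) + (n + 2).choose 2 := by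
      rw [show n + 1 + 2 = (n + 2) + 1 by ring, Nat.choose_succ_succ' (n + 2) 1, Nat.choose_one_right]
    rw [show n + 1 + 2 = (n + 2) + 1 by ring, pow_succ T (n + 2), ← mul_assoc, ih, add_mul, add_mul,
      smul_mul_assoc, smul_mul_assoc, h1, h2, h3,
      show (n + 2 + 1).choose 2 = (n + 2) + (n + 2).choose 2 from hch, add_smul, add_smul,
      one_smul, smul_add, ← pow_succ]
    simp only [← Nat.cast_smul_eq_nsmul ℤ]
    push_cast
    module

end Commutation

/-! ### The Lie derivative and the difference operator; their triangularity. -/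

/-- Differentiation with respect to a phase variable, as an operator. -/
def phaseDeriv (k : ℕ) (i : Fin 3) : Module.End ℝ (Series k) := (pderiv ℝ (Sum.inl i)).toLinearMap

@[simp] theorem phaseDeriv_apply (i : Fin 3) (f : Series k) :
    phaseDeriv k i f = pderiv ℝ (Sum.inl i) f := rfl

/-- The derivative along a vector field. -/
def lieDeriv (v : VecSeries k) : Derivation ℝ (Series k) (Series k) :=
  ∑ i, v i • pderiv ℝ (Sum.inl i)

theorem lieDeriv_apply (v : VecSeries k) (f : Series k) :
    lieDeriv v f = ∑ i, v i * pderiv ℝ (Sum.inl i) f := by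
  simp [lieDeriv, Fin.sum_univ_three]

theorem pderiv_coord (i j : Fin 3) :
    pderiv ℝ (Sum.inl i) (coord j : Series k) = if i = j then 1 else 0 := by
  have := congrFun (congrFun (jac_coord (k := k)) j) i
  simp only [jac, Matrix.of_apply, Matrix.one_apply] at this
  rw [this]
  simp [eq_comm]

theorem pderiv_pderiv_comm {σ : Type*} (i j : σ) (f : MvPowerSeries σ ℝ) :
    pderiv ℝ i (pderiv ℝ j f) = pderiv ℝ j (pderiv ℝ i f) := by
  ext m
  simp only [coeff_pderiv, add_right_comm]
  by_cases h : i = j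
  · rw [h]
  · simp [h, Ne.symm h]
    ring

theorem lieDeriv_linearVec_N (f : Series k) :
    lieDeriv (linearVec k N) f =
      coord 1 * pderiv ℝ (Sum.inl 0) f + coord 2 * pderiv ℝ (Sum.inl 1) f := by
  rw [lieDeriv_apply, Fin.sum_univ_three, linearVec_N_zero, linearVec_N_one, linearVec_N_two]
  ring

theorem coord_mem_slope (i : Fin 3) : (coord i : Series k) ∈ fil (slope k) (![0, 1, 2] i) :=
  X_mem_fil (slope k) (Sum.inl i)

theorem lieDeriv_mem_pdeg (v : VecSeries k) {d : ℕ} {f : Series k} (hf : f ∈ fil (pdeg k) d) :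
    lieDeriv v f ∈ fil (pdeg k) d := by
  rw [lieDeriv_apply]
  exact sum_mem fun i _ => Ideal.mul_mem_left _ _ (pderiv_mem_fil (w := pdeg k) hf)

theorem lieDeriv_mem_grade {v : VecSeries k} {e : ℕ} (hv : ∀ i, v i ∈ fil (grade k) (e + 1))
    {d : ℕ} {f : Series k} (hf : f ∈ fil (grade k) d) : lieDeriv v f ∈ fil (grade k) (d + e) := by
  rw [lieDeriv_apply]
  refine sum_mem fun i _ => ?_
  cases d with
  | zero => exact fil_antitone (by omega) (Ideal.mul_mem_right _ _ (hv i))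
  | succ d =>
    rw [show d + 1 + e = (e + 1) + d by ring]
    exact mul_mem_fil (hv i) (pderiv_mem_fil (w := grade k) hf)

/-- The leading operator `y ∂/∂x + z ∂/∂y` replaces an `x` by a `y` or a `y` by a `z`, hence raises
the slope. The remainder `v - N ξ` has grade two, and a derivative lowers the grade by only one. -/
theorem isPerturbation_lieDeriv {v : VecSeries k} (hv : HasLinearPart N v) :
    IsPerturbation (lieDeriv (linearVec k N) : Series k →ₗ[ℝ] Series k)
      (lieDeriv v : Series k →ₗ[ℝ] Series k) where
  grade₀ hf := lieDeriv_mem_grade (e := 0) (linearVec_mem_fil N) hf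
  slope₀ {d f} hf := by
    rw [Derivation.coeFn_coe, lieDeriv_linearVec_N]
    refine add_mem ?_ ?_
    · rw [add_comm]
      exact mul_mem_fil (coord_mem_slope 1) (pderiv_mem_fil (w := slope k) hf)
    · cases d with
      | zero => exact fil_antitone (by simp) (Ideal.mul_mem_right _ _ (coord_mem_slope 2))
      | succ d =>
        rw [show d + 1 + 1 = 2 + d by ring]
        exact mul_mem_fil (coord_mem_slope 2) (pderiv_mem_fil (w := slope k) hf)
  pdeg₀ hf := lieDeriv_mem_pdeg _ hf
  pdeg hf := lieDeriv_mem_pdeg _ hf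
  sub {d f} hf := by
    have h := lieDeriv_mem_grade (v := v - linearVec k N) (hasLinearPart_iff.1 hv) hf
    convert h using 1
    simp [lieDeriv_apply, sub_mul]

/-- The three summands are the contributions of `∂/∂x`, `∂/∂y`, `∂/∂z` to the divergence of the
frame of `T₀ ^ m h`. -/
theorem add_choose_ne_zero (m : ℕ) : (1 : ℝ) + (m + 1 : ℕ) + ((m + 2).choose 2 : ℕ) ≠ 0 := by
  positivity

/-- From `[∂/∂y, T] = ∂/∂x` and `[∂/∂z, T] = ∂/∂y`, moving the derivatives past `T ^ m`, `T ^ (m +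
1)`, `T ^ (m + 2)` leaves multiples of `T ^ m ∂h/∂x` and terms with at least `m + 1` factors `T`. -/
theorem isTriangular_flow :
    IsTriangular 1 (lieDeriv (linearVec k N) : Series k →ₗ[ℝ] Series k) := by
  set T : Module.End ℝ (Series k) := (lieDeriv (linearVec k N) : Series k →ₗ[ℝ] Series k) with hT
  have hTf : ∀ f, T f = coord 1 * pderiv ℝ (Sum.inl 0) f + coord 2 * pderiv ℝ (Sum.inl 1) f :=
    lieDeriv_linearVec_N
  have ha : phaseDeriv k 0 * T = T * phaseDeriv k 0 := by
    ext1 f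
    simp only [Module.End.mul_apply, phaseDeriv_apply, hTf, map_add, Derivation.leibniz,
      pderiv_coord, smul_eq_mul, pderiv_pderiv_comm (Sum.inl 0 : Fin 3 ⊕ Fin k) (Sum.inl 1)]
    simp
  have hb : phaseDeriv k 1 * T = T * phaseDeriv k 1 + 1 * phaseDeriv k 0 := by
    ext1 f
    simp only [Module.End.mul_apply, phaseDeriv_apply, hTf, map_add, Derivation.leibniz,
      pderiv_coord, smul_eq_mul, one_mul, LinearMap.add_apply,
      pderiv_pderiv_comm (Sum.inl 1 : Fin 3 ⊕ Fin k) (Sum.inl 0)]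
    simp
    ring
  have hc : phaseDeriv k 2 * T = T * phaseDeriv k 2 + 1 * phaseDeriv k 1 := by
    ext1 f
    simp only [Module.End.mul_apply, phaseDeriv_apply, hTf, map_add, Derivation.leibniz,
      pderiv_coord, smul_eq_mul, one_mul, LinearMap.add_apply,
      pderiv_pderiv_comm (Sum.inl 2 : Fin 3 ⊕ Fin k)]
    simp
    ring
  have H : IsPerturbation T T :=
    isPerturbation_lieDeriv (hasLinearPart_iff.2 fun i => by rw [sub_self]; exact zero_mem _)
  intro m
  refine ⟨_, add_choose_ne_zero m, fun h => ((1 : ℝ) + (m + 2 : ℕ)) • pderiv ℝ (Sum.inl 1) h +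
    T (pderiv ℝ (Sum.inl 2) h), fun d j h hh => ?_, fun h => ?_⟩
  · exact add_mem (smul_mem_bifil _ (pderiv_mem_bifil hh 1))
      (by simpa using H.pow_bifil (pderiv_mem_bifil hh 2) 1)
  · have h0 := congrArg (· h) (mul_pow_comm ha m)
    have h1 := congrArg (· h) (mul_pow_succ_comm (Commute.one_left T) ha hb m)
    have h2 := congrArg (· h) (mul_pow_succ_succ_comm (Commute.one_left T) ha hb hc m)
    simp only [Module.End.mul_apply, LinearMap.add_apply, LinearMap.smul_apply, one_mul,
      phaseDeriv_apply] at h0 h1 h2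
    have e : ∀ i, iterFrame 1 T ((T ^ m) h) i = (T ^ (m + (i : ℕ))) h := by
      intro i
      simp [iterFrame, Matrix.one_apply, ← Module.End.mul_apply, ← pow_add, add_comm]
    rw [Matrix.trace_fin_three]
    simp only [jac, Matrix.of_apply, e]
    simp only [Fin.val_zero, Fin.val_one, Fin.val_two, add_zero, h0, h1, h2]
    have hTT : ∀ (l : ℕ) (u : Series k), (T ^ l) (T u) = (T ^ (l + 1)) u := fun l u => by
      rw [pow_succ, Module.End.mul_apply]
    simp only [map_add, map_smul, hTT, add_assoc, Nat.reduceAdd, ← Nat.cast_smul_eq_nsmul ℝ]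
    push_cast
    module

/-- The substitution of a family of maps for the phase variables. -/
def pull (f : VecSeries k) (hf : ∀ i, constantCoeff (f i) = 0) : Series k →ₐ[ℝ] Series k :=
  substAlgHom (a := (Sum.elim f fun j => X (Sum.inr j) : Fin 3 ⊕ Fin k → Series k))
    (hasSubst_of_zero (by rintro (i | i) <;> simp [hf]))

section Pull

variable {f : VecSeries k} (hf : ∀ i, constantCoeff (f i) = 0)

theorem pull_eq_subst (g : Series k) :
    pull f hf g = subst (Sum.elim f fun j => X (Sum.inr j) : Fin 3 ⊕ Fin k → Series k) g := by
  rw [pull, coe_substAlgHom]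

theorem comp_eq_pull (ψ : VecSeries k) : comp ψ f = fun i => pull f hf (ψ i) := by
  ext1 i
  rw [pull_eq_subst, comp]

@[simp] theorem pull_coord (i : Fin 3) : pull f hf (coord i) = f i := by
  rw [pull, coord, substAlgHom_X]
  rfl

@[simp] theorem pull_param (j : Fin k) : pull f hf (X (Sum.inr j)) = X (Sum.inr j) := by
  rw [pull, substAlgHom_X]
  rfl

include hf in
theorem constantCoeff_elim (s : Fin 3 ⊕ Fin k) :
    constantCoeff ((Sum.elim f fun j => X (Sum.inr j) : Fin 3 ⊕ Fin k → Series k) s) = 0 := by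
  rcases s with i | i <;> simp [hf]

theorem constantCoeff_pull (g : Series k) : constantCoeff (pull f hf g) = constantCoeff g := by
  rw [pull_eq_subst, constantCoeff_subst' (constantCoeff_elim hf)]

theorem pderiv_pull (j : Fin 3) (g : Series k) :
    pderiv ℝ (Sum.inl j) (pull f hf g) =
      ∑ i, pull f hf (pderiv ℝ (Sum.inl i) g) * pderiv ℝ (Sum.inl j) (f i) := by
  simp only [pull_eq_subst]
  rw [pderiv_subst (constantCoeff_elim hf), Fintype.sum_sum_type]
  simp [pderiv_X_of_ne]

theorem pull_mem_fil {w : Fin 3 ⊕ Fin k → ℕ} (h : ∀ i, f i ∈ fil w (w (Sum.inl i))) {d : ℕ}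
    {g : Series k} (hg : g ∈ fil w d) : pull f hf g ∈ fil w d := by
  rw [pull_eq_subst]
  refine subst_mem_fil (constantCoeff_elim hf) ?_ hg
  rintro (i | i)
  · exact h i
  · exact X_mem_fil w _

theorem pull_sub_pull_mem_fil {f' : VecSeries k} (hf' : ∀ i, constantCoeff (f' i) = 0)
    {w : Fin 3 ⊕ Fin k → ℕ} (h : ∀ i, f i ∈ fil w (w (Sum.inl i)))
    (h' : ∀ i, f' i ∈ fil w (w (Sum.inl i))) {r : ℕ}
    (hs : ∀ i, f i - f' i ∈ fil w (w (Sum.inl i) + r)) {d : ℕ}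
    {g : Series k} (hg : g ∈ fil w d) : pull f hf g - pull f' hf' g ∈ fil w (d + r) := by
  rw [pull_eq_subst, pull_eq_subst]
  refine subst_sub_subst_mem_fil (constantCoeff_elim hf) (constantCoeff_elim hf') ?_ ?_ ?_ hg
  all_goals rintro (i | i)
  · exact h i
  · exact X_mem_fil w _
  · exact h' i
  · exact X_mem_fil w _
  · exact hs i
  · simp

theorem pull_id (g : Series k) : pull coord constantCoeff_coord g = g := by
  refine DFunLike.congr_fun (algHom_ext_of_X (φ' := AlgHom.id ℝ (Series k)) ?_ ?_) g
  all_goals rintro (i | i)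
  · exact (congrArg _ (pull_coord constantCoeff_coord i)).trans (constantCoeff_coord i)
  · rw [pull_param, constantCoeff_X]
  · exact pull_coord constantCoeff_coord i
  · exact pull_param constantCoeff_coord i

end Pull

/-- The difference operator `g ↦ g ∘ f - g` of a map. -/
def diffOp (f : VecSeries k) (hf : ∀ i, constantCoeff (f i) = 0) : Module.End ℝ (Series k) :=
  (pull f hf).toLinearMap - 1

theorem diffOp_apply {f : VecSeries k} (hf : ∀ i, constantCoeff (f i) = 0) (g : Series k) :
    diffOp f hf g = pull f hf g - g := rfl

theorem isPerturbation_diffOp {f : VecSeries k} (hf : HasLinearPart J f) :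
    IsPerturbation (diffOp (linearVec k J) (constantCoeff_linearVec J)) (diffOp f hf.1) where
  grade₀ hg := by
    rw [diffOp_apply]
    exact sub_mem (pull_mem_fil _ (linearVec_mem_fil J) hg) hg
  slope₀ {d g} hg := by
    -- `T₀ g` is viewed as the difference of two substitutions, of `J ξ` and of `ξ`; their arguments
    -- differ by `N ξ`, whose components have one more unit of slope.
    rw [diffOp_apply, ← pull_id g]
    nth_rw 1 [pull_id g]
    have hc : ∀ i : Fin 3, (coord i : Series k) ∈ fil (slope k) (slope k (Sum.inl i)) :=
      coord_mem_slope
    have hN : ∀ i, linearVec k N i ∈ fil (slope k) (slope k (Sum.inl i) + 1) := by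
      intro i
      match i with
      | 0 =>
        rw [linearVec_N_zero]
        exact hc 1
      | 1 =>
        rw [linearVec_N_one]
        exact hc 2
      | 2 =>
        rw [linearVec_N_two]
        exact zero_mem _
    refine pull_sub_pull_mem_fil _ _ (fun i => ?_) hc (fun i => ?_) hg
    · rw [linearVec_J]
      exact add_mem (hc i) (fil_antitone (Nat.le_succ _) (hN i))
    · rw [linearVec_J, add_sub_cancel_left]
      exact hN i
  pdeg₀ hg := by
    rw [diffOp_apply]
    exact sub_mem (pull_mem_fil (w := pdeg k) _ (fun i => by simp) hg) hg
  pdeg hg := by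
    rw [diffOp_apply]
    exact sub_mem (pull_mem_fil (w := pdeg k) _ (fun i => by simp) hg) hg
  sub hg := by
    rw [diffOp_apply, diffOp_apply, sub_sub_sub_cancel_right]
    refine pull_sub_pull_mem_fil _ _ (fun i => ?_) (linearVec_mem_fil J)
      (hasLinearPart_iff.1 hf) hg
    exact mem_fil_one_of_constantCoeff grade_ne_zero (hf.1 i)

/-- Now the commutators carry the factor `S = 1 + T`. Its `T` part, like the off-diagonal entries of
`J`, contributes only to the range of `T ^ (m + 1)`, so the constant `c` is that of flows and only
`R` changes. -/
theorem isTriangular_map :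
    IsTriangular J (diffOp (linearVec k J) (constantCoeff_linearVec J)) := by
  set T : Module.End ℝ (Series k) := diffOp (linearVec k J) (constantCoeff_linearVec J) with hT
  have hTf : ∀ f, T f = pull (linearVec k J) (constantCoeff_linearVec J) f - f := fun _ => rfl
  have hchain : ∀ j f, pderiv ℝ (Sum.inl j) (T f) =
      ∑ i, pull (linearVec k J) (constantCoeff_linearVec J) (pderiv ℝ (Sum.inl i) f) *
        pderiv ℝ (Sum.inl j) (linearVec k J i) - pderiv ℝ (Sum.inl j) f := by
    intro j f
    rw [hTf, map_sub, pderiv_pull]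
  have ha : phaseDeriv k 0 * T = T * phaseDeriv k 0 := by
    ext1 f
    simp only [Module.End.mul_apply, phaseDeriv_apply, hchain, Fin.sum_univ_three,
      linearVec_J_zero, linearVec_J_one, linearVec_J_two, map_add, pderiv_coord]
    simp [hTf]
  have hb : phaseDeriv k 1 * T = T * phaseDeriv k 1 + (1 + T) * phaseDeriv k 0 := by
    ext1 f
    simp only [Module.End.mul_apply, phaseDeriv_apply, hchain, Fin.sum_univ_three,
      linearVec_J_zero, linearVec_J_one, linearVec_J_two, map_add, pderiv_coord,
      LinearMap.add_apply, Module.End.one_apply]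
    simp [hTf]
    ring
  have hc : phaseDeriv k 2 * T = T * phaseDeriv k 2 + (1 + T) * phaseDeriv k 1 := by
    ext1 f
    simp only [Module.End.mul_apply, phaseDeriv_apply, hchain, Fin.sum_univ_three,
      linearVec_J_zero, linearVec_J_one, linearVec_J_two, map_add, pderiv_coord,
      LinearMap.add_apply, Module.End.one_apply]
    simp [hTf]
    ring
  have hS : Commute (1 + T) T := (Commute.one_left T).add_left (Commute.refl T)
  have hlin : HasLinearPart J (linearVec k J) :=
    hasLinearPart_iff.2 fun i => by rw [sub_self]; exact zero_mem _
  have H : IsPerturbation T T := isPerturbation_diffOp hlin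
  have hTmem : ∀ d j h, h ∈ bifil k d j → T h ∈ bifil k d j := fun d j h hh => by
    simpa using H.pow_bifil hh 1
  intro m
  refine ⟨_, add_choose_ne_zero m, fun h =>
    ((m + 2 : ℕ) + (m + 2 : ℕ) + 2 * ((m + 2).choose 2 : ℕ) : ℝ) • pderiv ℝ (Sum.inl 0) h +
    (((m + 2 : ℕ) : ℝ) + ((m + 2).choose 2 : ℕ)) • T (pderiv ℝ (Sum.inl 0) h) +
    ((m + 3 : ℕ) : ℝ) • (pderiv ℝ (Sum.inl 1) h + T (pderiv ℝ (Sum.inl 1) h)) +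
    T (pderiv ℝ (Sum.inl 2) h), fun d j h hh => ?_, fun h => ?_⟩
  · have h0 := pderiv_mem_bifil hh 0
    have h1 := pderiv_mem_bifil hh 1
    have h2 := pderiv_mem_bifil hh 2
    exact add_mem (add_mem (add_mem (smul_mem_bifil _ h0) (smul_mem_bifil _ (hTmem _ _ _ h0)))
      (smul_mem_bifil _ (add_mem h1 (hTmem _ _ _ h1)))) (hTmem _ _ _ h2)
  · have h0 := congrArg (· h) (mul_pow_comm ha m)
    have h0' := congrArg (· h) (mul_pow_comm ha (m + 1))
    have h1 := congrArg (· h) (mul_pow_succ_comm hS ha hb m)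
    have h1' := congrArg (· h) (mul_pow_succ_comm hS ha hb (m + 1))
    have h2 := congrArg (· h) (mul_pow_succ_succ_comm hS ha hb hc m)
    simp only [Module.End.mul_apply, LinearMap.add_apply, LinearMap.smul_apply,
      Module.End.one_apply, phaseDeriv_apply, map_add] at h0 h0' h1 h1' h2
    have e : ∀ i, iterFrame J T ((T ^ m) h) i = ∑ j : Fin 3, J i j • (T ^ (m + (j : ℕ))) h := by
      intro i
      simp only [iterFrame, ← Module.End.mul_apply, ← pow_add, add_comm]
    have hTT : ∀ (l : ℕ) (u : Series k), (T ^ l) (T u) = (T ^ (l + 1)) u := fun l u => by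
      rw [pow_succ, Module.End.mul_apply]
    rw [Matrix.trace_fin_three]
    simp only [jac, Matrix.of_apply, e, Fin.sum_univ_three]
    simp only [J, N]
    simp only [Fin.val_zero, Fin.val_one, Fin.val_two, add_zero, Matrix.add_apply,
      Matrix.one_apply_eq, Matrix.of_apply, Matrix.cons_val', Matrix.cons_val_zero,
      Matrix.cons_val_one, Matrix.cons_val, Matrix.one_apply_ne, Ne, Fin.reduceEq,
      not_false_eq_true, map_add, one_smul, zero_smul, zero_add, map_smul]
    simp only [h0, h0', h1, h1', h2]
    simp only [add_smul, one_smul, Nat.cast_smul_eq_nsmul, hTT, add_assoc,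
      Nat.reduceAdd]
    simp only [← Nat.cast_smul_eq_nsmul ℝ]
    push_cast
    module

end TripleEigenvalue

end

noncomputable section

namespace TripleEigenvalue

open MvPowerSeries Matrix

variable {k : ℕ}

/-! ### Normalizations as frames of a single function. -/

section Families

variable (q : Series k)

theorem flowFamily_zero : flowFamily q 0 = coord 1 := by
  simp [flowFamily, N, Fin.sum_univ_three]

theorem flowFamily_one : flowFamily q 1 = coord 2 := by
  simp [flowFamily, N, Fin.sum_univ_three]

theorem flowFamily_two : flowFamily q 2 = q := by
  simp [flowFamily, N, Fin.sum_univ_three]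

theorem mapFamily_zero : mapFamily q 0 = coord 0 + coord 1 := by
  simp [mapFamily, J, N, Fin.sum_univ_three, Matrix.one_apply]

theorem mapFamily_one : mapFamily q 1 = coord 1 + coord 2 + q := by
  simp [mapFamily, J, N, Fin.sum_univ_three, Matrix.one_apply, add_assoc]

theorem mapFamily_two : mapFamily q 2 = coord 2 + q := by
  simp [mapFamily, J, N, Fin.sum_univ_three, Matrix.one_apply]

end Families

/-- A common form of the two normalization conditions: the coordinate change is the frame
`C (W, T W, T² W)` of a function `W` such that `T³ W` is the given function of the frame. -/
def FrameNormalizes (C : Matrix (Fin 3) (Fin 3) ℝ) (T : Module.End ℝ (Series k))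
    (ψ : VecSeries k) (q : Series k) : Prop :=
  ∃ h : IsCoordinateChange ψ, ∃ W, ψ = iterFrame C T W ∧ T (T (T W)) = pull ψ h.1.1 q

theorem iterFrame_one_apply (T : Module.End ℝ (Series k)) (W : Series k) (i : Fin 3) :
    iterFrame 1 T W i = (T ^ (i : ℕ)) W := by
  simp [iterFrame, Matrix.one_apply]

theorem iterFrame_J_zero (T : Module.End ℝ (Series k)) (W : Series k) :
    iterFrame J T W 0 = W + T W := by
  simp [iterFrame, J, N, Matrix.one_apply, Fin.sum_univ_three]

theorem iterFrame_J_one (T : Module.End ℝ (Series k)) (W : Series k) :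
    iterFrame J T W 1 = T W + T (T W) := by
  simp [iterFrame, J, N, Matrix.one_apply, Fin.sum_univ_three, pow_succ]

theorem iterFrame_J_two (T : Module.End ℝ (Series k)) (W : Series k) :
    iterFrame J T W 2 = T (T W) := by
  simp [iterFrame, J, N, Matrix.one_apply, Fin.sum_univ_three, pow_succ]

theorem funext_fin_three {α : Type*} {f g : Fin 3 → α} (h0 : f 0 = g 0) (h1 : f 1 = g 1)
    (h2 : f 2 = g 2) : f = g := by
  ext1 i
  match i with
  | 0 => exact h0
  | 1 => exact h1
  | 2 => exact h2

theorem jac_mulVec (ψ v : VecSeries k) (i : Fin 3) : (jac ψ *ᵥ v) i = lieDeriv v (ψ i) := by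
  rw [lieDeriv_apply]
  simp only [Matrix.mulVec, dotProduct, jac, Matrix.of_apply, mul_comm]

/-- The rows of `jac ψ *ᵥ v` are the derivatives of the `ψ i` along `v`, so the first two equations
say that `ψ` is an iterated frame and the third defines `q`. -/
theorem flowNormalizes_iff {v ψ : VecSeries k} {q : Series k} :
    FlowNormalizes v ψ q ↔
      FrameNormalizes 1 (lieDeriv v : Series k →ₗ[ℝ] Series k) ψ q := by
  constructor
  · rintro ⟨h, heq⟩
    rw [comp_eq_pull h.1.1] at heq
    have h0 := congrFun heq 0
    have h1 := congrFun heq 1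
    have h2 := congrFun heq 2
    simp only [jac_mulVec, flowFamily_zero, flowFamily_one, flowFamily_two, pull_coord] at h0 h1 h2
    refine ⟨h, ψ 0, funext_fin_three ?_ ?_ ?_, ?_⟩
    · simp [iterFrame_one_apply]
    · simp [iterFrame_one_apply, h0]
    · simp [iterFrame_one_apply, pow_succ, h0, h1]
    · simp [h0, h1, h2]
  · rintro ⟨h, W, hψ, hW⟩
    refine ⟨h, ?_⟩
    have e0 : ψ 0 = W := by rw [hψ]; simp [iterFrame_one_apply]
    have e1 : ψ 1 = lieDeriv v W := by rw [hψ]; simp [iterFrame_one_apply]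
    have e2 : ψ 2 = lieDeriv v (lieDeriv v W) := by rw [hψ]; simp [iterFrame_one_apply, pow_succ]
    rw [comp_eq_pull h.1.1]
    refine funext_fin_three ?_ ?_ ?_
    · rw [jac_mulVec, flowFamily_zero, pull_coord, e0, e1]
    · rw [jac_mulVec, flowFamily_one, pull_coord, e1, e2]
    · rw [jac_mulVec, flowFamily_two, ← hW, e2]
      rfl

theorem mapNormalizes_iff {f ψ : VecSeries k} (hf : ∀ i, constantCoeff (f i) = 0) {q : Series k} :
    MapNormalizes f ψ q ↔ FrameNormalizes J (diffOp f hf) ψ q := by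
  constructor
  · rintro ⟨h, heq⟩
    rw [comp_eq_pull h.1.1, comp_eq_pull hf] at heq
    have h0 := congrFun heq 0
    have h1 := congrFun heq 1
    have h2 := congrFun heq 2
    simp only [mapFamily_zero, mapFamily_one, mapFamily_two, map_add, pull_coord] at h0 h1 h2
    have t0 : diffOp f hf (ψ 0) = ψ 1 := by rw [diffOp_apply, h0]; ring
    have t1 : diffOp f hf (ψ 1) = ψ 2 + pull ψ h.1.1 q := by rw [diffOp_apply, h1]; ring
    have t2 : diffOp f hf (ψ 2) = pull ψ h.1.1 q := by rw [diffOp_apply, h2]; ring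
    -- The generating function is the first component of `J⁻¹ ψ`, with `J⁻¹ = 1 - N + N²`.
    have w1 : diffOp f hf (ψ 0 - ψ 1 + ψ 2) = ψ 1 - ψ 2 := by
      rw [map_add, map_sub, t0, t1, t2]; ring
    have w2 : diffOp f hf (ψ 1 - ψ 2) = ψ 2 := by
      rw [map_sub, t1, t2]; ring
    refine ⟨h, ψ 0 - ψ 1 + ψ 2, funext_fin_three ?_ ?_ ?_, ?_⟩
    · rw [iterFrame_J_zero, w1]; ring
    · rw [iterFrame_J_one, w1, w2]; ring
    · rw [iterFrame_J_two, w1, w2]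
    · rw [w1, w2, t2]
  · rintro ⟨h, W, hψ, hW⟩
    refine ⟨h, ?_⟩
    have e0 : ψ 0 = W + diffOp f hf W := by rw [hψ, iterFrame_J_zero]
    have e1 : ψ 1 = diffOp f hf W + diffOp f hf (diffOp f hf W) := by rw [hψ, iterFrame_J_one]
    have e2 : ψ 2 = diffOp f hf (diffOp f hf W) := by rw [hψ, iterFrame_J_two]
    have hp : ∀ g, pull f hf g = g + diffOp f hf g := fun g => by rw [diffOp_apply]; ring
    rw [comp_eq_pull h.1.1, comp_eq_pull hf]
    refine funext_fin_three ?_ ?_ ?_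
    · rw [mapFamily_zero, map_add, pull_coord, pull_coord, hp, e0, e1, map_add]
    · rw [mapFamily_one, map_add, map_add, pull_coord, pull_coord, hp, e1, e2, map_add, hW]
      ring
    · rw [mapFamily_two, map_add, pull_coord, hp, e2, hW]

/-! ### Volume preservation makes the normal form independent of `z`. -/

section Planar

theorem derivation_det_fin_three {R : Type*} [CommRing R] [Algebra ℝ R] (D : Derivation ℝ R R)
    (A : Matrix (Fin 3) (Fin 3) R) : D A.det = (A.adjugate * A.map D).trace := by
  rw [Matrix.det_fin_three, Matrix.adjugate_fin_three, Matrix.trace_fin_three]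
  simp only [map_sub, map_add, Derivation.leibniz, smul_eq_mul, Matrix.mul_apply,
    Fin.sum_univ_three, Matrix.map_apply, Matrix.of_apply, Matrix.cons_val', Matrix.cons_val_zero,
    Matrix.cons_val_one, Matrix.cons_val]
  ring

theorem jac_jac_mulVec (ψ v : VecSeries k) :
    jac (jac ψ *ᵥ v) = (jac ψ).map (lieDeriv v) + jac ψ * jac v := by
  ext1 i j
  simp only [jac, Matrix.of_apply, Matrix.mulVec, dotProduct, map_sum, Derivation.leibniz,
    smul_eq_mul, Matrix.add_apply, Matrix.map_apply, Matrix.mul_apply, lieDeriv_apply,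
    Finset.sum_add_distrib, pderiv_pderiv_comm (Sum.inl j)]
  exact add_comm _ _

theorem jac_pull (ψ f : VecSeries k) (hf : ∀ i, constantCoeff (f i) = 0) :
    jac (fun i => pull f hf (ψ i)) = (jac ψ).map (pull f hf) * jac f := by
  ext1 i j
  simp only [jac, Matrix.of_apply, Matrix.map_apply, Matrix.mul_apply, pderiv_pull]

theorem jac_flowFamily (q : Series k) :
    jac (flowFamily q) = !![0, 1, 0; 0, 0, 1; pderiv ℝ (Sum.inl 0) q, pderiv ℝ (Sum.inl 1) q,
      pderiv ℝ (Sum.inl 2) q] := by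
  ext1 i j
  fin_cases i <;> fin_cases j <;>
    simp [jac, flowFamily_zero, flowFamily_one, flowFamily_two, pderiv_coord]

theorem jac_mapFamily (q : Series k) :
    jac (mapFamily q) = !![1, 1, 0;
      pderiv ℝ (Sum.inl 0) q, 1 + pderiv ℝ (Sum.inl 1) q, 1 + pderiv ℝ (Sum.inl 2) q;
      pderiv ℝ (Sum.inl 0) q, pderiv ℝ (Sum.inl 1) q, 1 + pderiv ℝ (Sum.inl 2) q] := by
  ext1 i j
  fin_cases i <;> fin_cases j <;>
    simp [jac, mapFamily_zero, mapFamily_one, mapFamily_two, pderiv_coord]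

theorem trace_jac_flowFamily (q : Series k) :
    (jac (flowFamily q)).trace = pderiv ℝ (Sum.inl 2) q := by
  rw [jac_flowFamily, Matrix.trace_fin_three]
  simp

theorem det_jac_mapFamily (q : Series k) :
    (jac (mapFamily q)).det = 1 + pderiv ℝ (Sum.inl 2) q := by
  rw [jac_mapFamily, Matrix.det_fin_three]
  simp
  ring

theorem coordinateChange_sub_mem {ψ : VecSeries k} (h : IsCoordinateChange ψ) (i : Fin 3) :
    ψ i - coord i ∈ fil (grade k) 2 := by
  have := hasLinearPart_iff.1 h.1 i
  rwa [linearVec_one] at this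

section CoordinateChange

variable {ψ : VecSeries k} (h : IsCoordinateChange ψ)

include h in
theorem elim_sub_X_mem (s : Fin 3 ⊕ Fin k) :
    (Sum.elim ψ fun j => X (Sum.inr j) : Fin 3 ⊕ Fin k → Series k) s - X s ∈
      fil (grade k) (grade k s + 1) := by
  rcases s with i | i
  · exact coordinateChange_sub_mem h i
  · simp

theorem pull_injective : Function.Injective (pull ψ h.1.1) := by
  intro f g hfg
  rw [pull_eq_subst, pull_eq_subst] at hfg
  exact subst_injective (constantCoeff_elim h.1.1) (elim_sub_X_mem h) hfg

theorem pull_surjective : Function.Surjective (pull ψ h.1.1) := by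
  intro g
  obtain ⟨f, hf⟩ := subst_surjective (constantCoeff_elim h.1.1) (elim_sub_X_mem h) g
  exact ⟨f, by rw [pull_eq_subst, hf]⟩

theorem mem_fil_of_pull_mem_fil {d : ℕ} {f : Series k} (hf : pull ψ h.1.1 f ∈ fil (grade k) d) :
    f ∈ fil (grade k) d := by
  rw [pull_eq_subst] at hf
  exact mem_fil_of_subst_mem_fil (constantCoeff_elim h.1.1) (elim_sub_X_mem h) hf

end CoordinateChange

/-- With `w = flowFamily q`, the Jacobian of the conjugacy is `L_v (Dψ) + Dψ Dv = (Dw ∘ ψ) Dψ`. The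
trace against `adj (Dψ) = (Dψ)⁻¹` gives `L_v (det Dψ) + div v = (div w) ∘ ψ`; the left side
vanishes, and `div w = ∂q/∂z`. -/
theorem pderiv_eq_zero_of_flowNormalizes {v ψ : VecSeries k} {q : Series k}
    (hv : IsFlowUnfolding v) (hq : FlowNormalizes v ψ q) : pderiv ℝ (Sum.inl 2) q = 0 := by
  obtain ⟨h, heq⟩ := hq
  have hc : ∀ i, constantCoeff (ψ i) = 0 := h.1.1
  refine pull_injective h ?_
  change pull ψ hc _ = pull ψ hc _
  rw [map_zero]
  have h1 := jac_jac_mulVec ψ v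
  rw [heq, comp_eq_pull hc, jac_pull] at h1
  have h2 := congrArg (fun M => ((jac ψ).adjugate * M).trace) h1
  simp only [mul_add, Matrix.trace_add] at h2
  rw [← derivation_det_fin_three, h.2, Derivation.map_one_eq_zero, ← Matrix.mul_assoc _ (jac ψ),
    Matrix.adjugate_mul, h.2, one_smul, Matrix.one_mul, hv.2, Matrix.trace_mul_comm,
    Matrix.mul_assoc, Matrix.mul_adjugate, h.2, one_smul, Matrix.mul_one, add_zero] at h2
  rw [← trace_jac_flowFamily, ← h2, Matrix.trace_fin_three, Matrix.trace_fin_three, map_add,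
    map_add]
  rfl

/-- The determinant of the chain rule on both sides of the conjugacy gives `1 = (1 + ∂q/∂z) ∘ ψ`. -/
theorem pderiv_eq_zero_of_mapNormalizes {f ψ : VecSeries k} {q : Series k}
    (hf : IsMapUnfolding f) (hq : MapNormalizes f ψ q) : pderiv ℝ (Sum.inl 2) q = 0 := by
  obtain ⟨h, heq⟩ := hq
  have hc : ∀ i, constantCoeff (ψ i) = 0 := h.1.1
  rw [comp_eq_pull hc, comp_eq_pull hf.1.1] at heq
  have h1 := congrArg (fun g => (jac g).det) heq
  simp only [jac_pull, Matrix.det_mul, h.2, hf.2, mul_one] at h1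
  have hdet : ∀ (φ : Series k →ₐ[ℝ] Series k) (M : Matrix (Fin 3) (Fin 3) (Series k)),
      (M.map φ).det = φ M.det := fun φ M => (AlgHom.map_det φ M).symm
  rw [hdet, hdet, h.2, det_jac_mapFamily, map_add, map_one, map_one, left_eq_add] at h1
  exact pull_injective h (by rw [h1, map_zero])

end Planar

/-! ### The central member: setting the parameters to zero. -/

section Central

/-- The inclusion of the phase variables among all variables. -/
def phaseEmb (n k : ℕ) : Fin n ⊕ Fin 0 ↪ Fin n ⊕ Fin k where
  toFun := Sum.map id Fin.elim0
  inj' := Sum.map_injective.2 ⟨Function.injective_id, fun i => i.elim0⟩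

@[simp] theorem phaseEmb_inl (n k : ℕ) (i : Fin n) : phaseEmb n k (Sum.inl i) = Sum.inl i := rfl

/-- The central member of a family, as a homomorphism. -/
def centralHom (n k : ℕ) :
    MvPowerSeries (Fin n ⊕ Fin k) ℝ →ₐ[ℝ] MvPowerSeries (Fin n ⊕ Fin 0) ℝ :=
  killCompl (phaseEmb n k)

theorem centralHom_X_inl {n : ℕ} (i : Fin n) : centralHom n k (X (Sum.inl i)) = X (Sum.inl i) :=
  killCompl_X (e := phaseEmb n k) (Sum.inl i)

theorem centralHom_X_inr {n : ℕ} (j : Fin k) : centralHom n k (X (Sum.inr j)) = 0 := by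
  refine killCompl_X_eq_zero ?_
  rintro ⟨i | i, hi⟩
  · simp at hi
  · exact i.elim0

theorem central_eq {n : ℕ} (f : MvPowerSeries (Fin n ⊕ Fin k) ℝ) :
    central f = centralHom n k f := by
  rw [algHom_eq_subst (centralHom n k), central]
  · congr 1
    ext1 (i | i)
    · rw [centralHom_X_inl]; rfl
    · rw [centralHom_X_inr]; rfl
  · rintro (i | i)
    · rw [centralHom_X_inl, constantCoeff_X]
    · rw [centralHom_X_inr, map_zero]

theorem centralVec_eq (f : VecSeries k) : centralVec f = fun i => centralHom 3 k (f i) := by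
  ext1 i
  exact central_eq _

/-- A series in the phase variables, regarded as a constant family. -/
def liftHom (n k : ℕ) :
    MvPowerSeries (Fin n ⊕ Fin 0) ℝ →ₐ[ℝ] MvPowerSeries (Fin n ⊕ Fin k) ℝ :=
  haveI := (phaseEmb n k).injective
  rename (phaseEmb n k)

theorem central_lift {n : ℕ} (f : MvPowerSeries (Fin n ⊕ Fin 0) ℝ) :
    centralHom n k (liftHom n k f) = f :=
  killCompl_rename_app f

theorem pderiv_killCompl {σ τ : Type*} (e : σ ↪ τ) (i : σ) (f : MvPowerSeries τ ℝ) :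
    pderiv ℝ i (killCompl e f) = killCompl e (pderiv ℝ (e i) f) := by
  ext m
  rw [coeff_pderiv, coeff_killCompl, coeff_killCompl, coeff_pderiv, Finsupp.embDomain_add,
    Finsupp.embDomain_single, Finsupp.embDomain_apply_self]

theorem pderiv_central {n : ℕ} (i : Fin n) (f : MvPowerSeries (Fin n ⊕ Fin k) ℝ) :
    pderiv ℝ (Sum.inl i) (centralHom n k f) = centralHom n k (pderiv ℝ (Sum.inl i) f) :=
  pderiv_killCompl (phaseEmb n k) (Sum.inl i) f

theorem jac_central (f : VecSeries k) :
    jac (centralVec f) = (jac f).map (centralHom 3 k) := by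
  rw [centralVec_eq]
  ext1 i j
  exact pderiv_central j (f i)

theorem constantCoeff_central {n : ℕ} (f : MvPowerSeries (Fin n ⊕ Fin k) ℝ) :
    constantCoeff (centralHom n k f) = constantCoeff f := by
  rw [← coeff_zero_eq_constantCoeff_apply, ← coeff_zero_eq_constantCoeff_apply, centralHom,
    coeff_killCompl, Finsupp.embDomain_zero]

theorem coeff_single_central {n : ℕ} (f : MvPowerSeries (Fin n ⊕ Fin k) ℝ) (i : Fin n) :
    coeff (Finsupp.single (Sum.inl i) 1) (centralHom n k f) =
      coeff (Finsupp.single (Sum.inl i) 1) f := by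
  rw [centralHom, coeff_killCompl, Finsupp.embDomain_single, phaseEmb_inl]

theorem central_mem_fil_grade_two {f : Series k} :
    centralHom 3 k f ∈ fil (grade 0) 2 ↔ f ∈ fil (grade k) 2 := by
  simp only [mem_fil_grade_two, constantCoeff_central, coeff_single_central]

theorem mem_fil_pdeg_one {f : Series k} : f ∈ fil (pdeg k) 1 ↔ centralHom 3 k f = 0 := by
  constructor
  · intro h
    ext m
    rw [centralHom, coeff_killCompl, map_zero]
    refine h _ ?_
    rw [Nat.lt_one_iff, Finsupp.weight_eq_sum, Fintype.sum_sum_type]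
    have : ∀ j : Fin k, Finsupp.embDomain (phaseEmb 3 k) m (Sum.inr j) = 0 := by
      intro j
      refine Finsupp.embDomain_of_notMem_range _ _ _ ?_
      rintro ⟨i | i, hi⟩
      · simp at hi
      · exact i.elim0
    simp [this]
  · intro h m hm
    have : m ∈ Set.range (Finsupp.embDomain (phaseEmb 3 k)) := by
      rw [Finsupp.mem_range_embDomain_iff]
      rintro (i | j) hs
      · exact ⟨Sum.inl i, rfl⟩
      · have := Finsupp.le_weight (pdeg k) (s := Sum.inr j) (by simp) m
        have h0 : m (Sum.inr j) ≠ 0 := by simpa using hs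
        omega
    obtain ⟨m', rfl⟩ := this
    rw [← coeff_killCompl]
    change coeff m' (centralHom 3 k f) = 0
    rw [h, map_zero]

theorem centralHom_pull {ψ : VecSeries k} (hψ : ∀ i, constantCoeff (ψ i) = 0)
    (hψ' : ∀ i, constantCoeff (centralVec ψ i) = 0) (g : Series k) :
    centralHom 3 k (pull ψ hψ g) = pull (centralVec ψ) hψ' (centralHom 3 k g) := by
  have : (centralHom 3 k).comp (pull ψ hψ) =
      (pull (centralVec ψ) hψ').comp (centralHom 3 k) := by
    refine algHom_ext_of_X ?_ ?_
    · intro s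
      rw [AlgHom.comp_apply, constantCoeff_central, constantCoeff_pull, constantCoeff_X]
    · rintro (i | j)
      · have h1 := pull_coord hψ i
        have h2 := pull_coord hψ' i
        rw [coord] at h1 h2
        rw [AlgHom.comp_apply, AlgHom.comp_apply, h1, centralHom_X_inl, h2, centralVec_eq]
      · rw [AlgHom.comp_apply, AlgHom.comp_apply, pull_param, centralHom_X_inr, map_zero]
  exact DFunLike.congr_fun this g

theorem constantCoeff_centralVec {ψ : VecSeries k} (hψ : ∀ i, constantCoeff (ψ i) = 0) (i : Fin 3) :
    constantCoeff (centralVec ψ i) = 0 := by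
  rw [centralVec_eq, constantCoeff_central, hψ]

theorem hasLinearPart_central {A : Matrix (Fin 3) (Fin 3) ℝ} {f : VecSeries k}
    (hf : HasLinearPart A f) : HasLinearPart A (centralVec f) := by
  refine ⟨constantCoeff_centralVec hf.1, fun i j => ?_⟩
  rw [centralVec_eq, coeff_single_central, hf.2]

theorem isFlowUnfolding_central {v : VecSeries k} (hv : IsFlowUnfolding v) :
    IsFlowUnfolding (centralVec v) := by
  refine ⟨hasLinearPart_central hv.1, ?_⟩
  have := congrArg (centralHom 3 k) hv.2
  rw [Matrix.trace_fin_three, map_zero, map_add, map_add] at this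
  rw [jac_central, Matrix.trace_fin_three]
  exact this

theorem det_jac_central (f : VecSeries k) :
    (jac (centralVec f)).det = centralHom 3 k (jac f).det := by
  rw [jac_central]
  exact (AlgHom.map_det (centralHom 3 k) (jac f)).symm

theorem isMapUnfolding_central {f : VecSeries k} (hf : IsMapUnfolding f) :
    IsMapUnfolding (centralVec f) := by
  refine ⟨hasLinearPart_central hf.1, ?_⟩
  rw [det_jac_central, hf.2, map_one]

theorem centralHom_lieDeriv (v : VecSeries k) (g : Series k) :
    centralHom 3 k (lieDeriv v g) = lieDeriv (centralVec v) (centralHom 3 k g) := by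
  simp only [lieDeriv_apply, map_sum, map_mul, pderiv_central, centralVec_eq]

theorem centralHom_diffOp {f : VecSeries k} (hf : ∀ i, constantCoeff (f i) = 0) (g : Series k) :
    centralHom 3 k (diffOp f hf g) =
      diffOp (centralVec f) (constantCoeff_centralVec hf) (centralHom 3 k g) := by
  rw [diffOp_apply, diffOp_apply, map_sub, centralHom_pull]

end Central

end TripleEigenvalue

end

noncomputable section

namespace TripleEigenvalue

open MvPowerSeries Matrix

variable {k : ℕ}

/-! ### Series in `x`, `y` and the parameters, and the coefficients `ε`, `μ₁`, `μ₂`. -/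

section Plane

theorem pderiv_rename {σ τ : Type*} [Fintype σ] [Finite τ] (e : σ ↪ τ) (i : σ)
    (f : MvPowerSeries σ ℝ) : pderiv ℝ (e i) (rename e f) = rename e (pderiv ℝ i f) := by
  classical
  have h0 : ∀ s, constantCoeff ((X ∘ e : σ → MvPowerSeries τ ℝ) s) = 0 := fun s => by simp
  rw [rename_eq_subst, rename_eq_subst, pderiv_subst h0, Finset.sum_eq_single i]
  · simp
  · intro j _ hj
    rw [Function.comp_apply, pderiv_X_of_ne (e.injective.ne hj), mul_zero]
  · simp

theorem pderiv_rename_of_notMem {σ τ : Type*} [Fintype σ] [Finite τ] (e : σ ↪ τ) {j : τ}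
    (hj : ∀ i, e i ≠ j) (f : MvPowerSeries σ ℝ) : pderiv ℝ j (rename e f) = 0 := by
  have h0 : ∀ s, constantCoeff ((X ∘ e : σ → MvPowerSeries τ ℝ) s) = 0 := fun s => by simp
  rw [rename_eq_subst, pderiv_subst h0]
  refine Finset.sum_eq_zero fun i _ => ?_
  rw [Function.comp_apply, pderiv_X_of_ne (hj i), mul_zero]

theorem rename_killCompl {σ τ : Type*} [Finite σ] (e : σ ↪ τ) (f : MvPowerSeries τ ℝ)
    (h : ∀ m ∉ Set.range (Finsupp.embDomain e), coeff m f = 0) :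
    rename e (killCompl e f) = f := by
  ext m
  by_cases hm : m ∈ Set.range (Finsupp.embDomain e)
  · obtain ⟨m, rfl⟩ := hm
    rw [coeff_embDomain_rename, coeff_killCompl]
  · rw [h m hm, coeff_rename_eq_zero]
    rintro ⟨x, rfl⟩
    exact hm ⟨x, Finsupp.embDomain_eq_mapDomain e x⟩

/-- The inclusion of `x`, `y` and the parameters among all variables. -/
def planeEmb (k : ℕ) : Fin 2 ⊕ Fin k ↪ Fin 3 ⊕ Fin k where
  toFun := Sum.map Fin.castSucc id
  inj' := Sum.map_injective.2 ⟨Fin.castSucc_injective 2, Function.injective_id⟩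

@[simp] theorem planeEmb_zero : planeEmb k (Sum.inl 0) = Sum.inl 0 := rfl
@[simp] theorem planeEmb_one : planeEmb k (Sum.inl 1) = Sum.inl 1 := rfl
@[simp] theorem planeEmb_inr (j : Fin k) : planeEmb k (Sum.inr j) = Sum.inr j := rfl

/-- The inclusion of the parameters among all variables. -/
def paramEmb (n k : ℕ) : Fin k ↪ Fin n ⊕ Fin k := ⟨Sum.inr, Sum.inr_injective⟩

@[simp] theorem paramEmb_apply (n : ℕ) (j : Fin k) : paramEmb n k j = Sum.inr j := rfl

theorem ofPlane_eq (p : MvPowerSeries (Fin 2 ⊕ Fin k) ℝ) : ofPlane p = rename (planeEmb k) p := by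
  rw [rename_eq_subst, ofPlane]
  congr 1
  ext1 (i | j)
  · fin_cases i <;> rfl
  · rfl

theorem ofParams_eq {n : ℕ} (ε : MvPowerSeries (Fin k) ℝ) :
    (ofParams ε : MvPowerSeries (Fin n ⊕ Fin k) ℝ) = rename (paramEmb n k) ε := by
  rw [rename_eq_subst, ofParams]
  rfl

theorem ofPlane_injective :
    Function.Injective (ofPlane : MvPowerSeries (Fin 2 ⊕ Fin k) ℝ → Series k) := by
  intro p p' h
  rw [ofPlane_eq, ofPlane_eq] at h
  exact rename_injective (planeEmb k) h

theorem pderiv_two_ofPlane (p : MvPowerSeries (Fin 2 ⊕ Fin k) ℝ) :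
    pderiv ℝ (Sum.inl 2) (ofPlane p) = 0 := by
  rw [ofPlane_eq]
  refine pderiv_rename_of_notMem _ ?_ _
  rintro (i | j)
  · fin_cases i <;> simp
  · simp

theorem exists_ofPlane {q : Series k} (hq : pderiv ℝ (Sum.inl 2) q = 0) :
    ∃ p, q = ofPlane p := by
  refine ⟨killCompl (planeEmb k) q, ?_⟩
  rw [ofPlane_eq, rename_killCompl]
  intro m hm
  have h2 : m (Sum.inl 2) ≠ 0 := by
    intro h
    refine hm ((Finsupp.mem_range_embDomain_iff _ _).2 ?_)
    rintro (i | j) hs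
    · match i with
      | 0 => exact ⟨Sum.inl 0, rfl⟩
      | 1 => exact ⟨Sum.inl 1, rfl⟩
      | 2 => exact absurd h (by simpa using hs)
    · exact ⟨Sum.inr j, rfl⟩
  have hle : Finsupp.single (Sum.inl 2) 1 ≤ m := by
    simpa [Finsupp.single_le_iff] using Nat.one_le_iff_ne_zero.2 h2
  have h := congrArg (coeff (m - Finsupp.single (Sum.inl 2) 1)) hq
  rw [coeff_pderiv, tsub_add_cancel_of_le hle, map_zero] at h
  exact (mul_eq_zero.1 h).resolve_right (by positivity)

/-- Restriction of a series to the parameters. -/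
def atOrigin (n k : ℕ) : MvPowerSeries (Fin n ⊕ Fin k) ℝ →ₐ[ℝ] MvPowerSeries (Fin k) ℝ :=
  killCompl (paramEmb n k)

theorem atOrigin_X_inl {n : ℕ} (i : Fin n) : atOrigin n k (X (Sum.inl i)) = 0 :=
  killCompl_X_eq_zero (by rintro ⟨j, hj⟩; simp at hj)

theorem atOrigin_ofParams {n : ℕ} (ε : MvPowerSeries (Fin k) ℝ) :
    atOrigin n k (ofParams ε) = ε := by
  rw [ofParams_eq]
  exact killCompl_rename_app ε

theorem constantCoeff_atOrigin {n : ℕ} (f : MvPowerSeries (Fin n ⊕ Fin k) ℝ) :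
    constantCoeff (atOrigin n k f) = constantCoeff f := by
  rw [← coeff_zero_eq_constantCoeff_apply, ← coeff_zero_eq_constantCoeff_apply, atOrigin,
    coeff_killCompl, Finsupp.embDomain_zero]

theorem pderiv_ofParams {n : ℕ} (i : Fin n) (ε : MvPowerSeries (Fin k) ℝ) :
    pderiv ℝ (Sum.inl i) (ofParams ε : MvPowerSeries (Fin n ⊕ Fin k) ℝ) = 0 := by
  rw [ofParams_eq]
  exact pderiv_rename_of_notMem _ (by simp) _

theorem coeff_eq_atOrigin {n : ℕ} (f : MvPowerSeries (Fin n ⊕ Fin k) ℝ)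
    (m : Fin n ⊕ Fin k →₀ ℕ) (hm : ∀ i, m (Sum.inl i) = 0) :
    ∃ m', coeff m f = coeff m' (atOrigin n k f) := by
  have : m ∈ Set.range (Finsupp.embDomain (paramEmb n k)) := by
    rw [Finsupp.mem_range_embDomain_iff]
    rintro (i | j) hs
    · exact absurd (hm i) (by simpa using hs)
    · exact ⟨j, rfl⟩
  obtain ⟨m', rfl⟩ := this
  exact ⟨m', (coeff_killCompl f m').symm⟩

/-- In this form, vanishing of the value and of the first derivatives on `x = y = 0`, the condition
passes through homomorphisms such as a change of parameters. -/
theorem isQuadratic_iff {p : MvPowerSeries (Fin 2 ⊕ Fin k) ℝ} :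
    IsQuadratic p ↔ atOrigin 2 k p = 0 ∧ ∀ i, atOrigin 2 k (pderiv ℝ (Sum.inl i) p) = 0 := by
  constructor
  · intro h
    refine ⟨?_, fun i => ?_⟩
    · ext m
      rw [atOrigin, coeff_killCompl, map_zero]
      refine h _ ?_
      rw [Finsupp.embDomain_of_notMem_range _ _ _ (by rintro ⟨j, hj⟩; simp at hj),
        Finsupp.embDomain_of_notMem_range _ _ _ (by rintro ⟨j, hj⟩; simp at hj)]
      norm_num
    · ext m
      rw [atOrigin, coeff_killCompl, map_zero, coeff_pderiv]
      rw [h, zero_mul]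
      have e : ∀ l : Fin 2, Finsupp.embDomain (paramEmb 2 k) m (Sum.inl l) = 0 := fun l =>
        Finsupp.embDomain_of_notMem_range _ _ _ (by rintro ⟨j, hj⟩; simp at hj)
      fin_cases i <;> simp [e]
  · rintro ⟨h0, h1⟩ m hm
    by_cases hall : ∀ i, m (Sum.inl i) = 0
    · obtain ⟨m', hm'⟩ := coeff_eq_atOrigin p m hall
      rw [hm', h0, map_zero]
    · push Not at hall
      obtain ⟨i, hi⟩ := hall
      have hle : Finsupp.single (Sum.inl i) 1 ≤ m := by
        simpa [Finsupp.single_le_iff] using Nat.one_le_iff_ne_zero.2 hi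
      obtain ⟨m, rfl⟩ := exists_add_of_le hle
      have hm0 : ∀ l, m (Sum.inl l) = 0 := by
        intro l
        fin_cases i <;> fin_cases l <;> simp at hm ⊢ <;> omega
      obtain ⟨m', hm'⟩ := coeff_eq_atOrigin (pderiv ℝ (Sum.inl i) p) m hm0
      rw [h1, map_zero, coeff_pderiv, hm0, add_comm] at hm'
      simpa using hm'

theorem unfoldingTerm_eq_ofPlane (ε μ₁ μ₂ : MvPowerSeries (Fin k) ℝ)
    (p : MvPowerSeries (Fin 2 ⊕ Fin k) ℝ) :
    unfoldingTerm ε μ₁ μ₂ p = ofPlane (ofParams ε + ofParams μ₁ * X (Sum.inl 0) +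
      ofParams μ₂ * X (Sum.inl 1) + p) := by
  have h : ∀ ε : MvPowerSeries (Fin k) ℝ,
      rename (planeEmb k) (ofParams ε : MvPowerSeries (Fin 2 ⊕ Fin k) ℝ) = ofParams ε := by
    intro ε
    rw [ofParams_eq, ofParams_eq, rename_rename]
    rfl
  simp only [ofPlane_eq, map_add, map_mul, h, rename_X, unfoldingTerm]
  rfl

theorem pderiv_two_unfoldingTerm (ε μ₁ μ₂ : MvPowerSeries (Fin k) ℝ)
    (p : MvPowerSeries (Fin 2 ⊕ Fin k) ℝ) :
    pderiv ℝ (Sum.inl 2) (unfoldingTerm ε μ₁ μ₂ p) = 0 := by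
  rw [unfoldingTerm_eq_ofPlane, pderiv_two_ofPlane]

/-- Taylor expansion of first order in `(x, y)` with coefficients in the parameters. Grade two is
what makes the three coefficients vanish at `lam = 0`. -/
theorem exists_unfoldingTerm {q : Series k} (hq : pderiv ℝ (Sum.inl 2) q = 0)
    (hq2 : q ∈ fil (grade k) 2) :
    ∃ (ε μ₁ μ₂ : MvPowerSeries (Fin k) ℝ) (p : MvPowerSeries (Fin 2 ⊕ Fin k) ℝ),
      constantCoeff ε = 0 ∧ constantCoeff μ₁ = 0 ∧ constantCoeff μ₂ = 0 ∧ IsQuadratic p ∧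
      q = unfoldingTerm ε μ₁ μ₂ p := by
  obtain ⟨p', rfl⟩ := exists_ofPlane hq
  have hcst : constantCoeff p' = 0 := by
    have := constantCoeff_of_mem_fil two_ne_zero hq2
    rwa [ofPlane_eq, constantCoeff_rename] at this
  have hlin : ∀ i : Fin 2, constantCoeff (pderiv ℝ (Sum.inl i) p') = 0 := by
    intro i
    have h1 : pderiv ℝ (planeEmb k (Sum.inl i)) (ofPlane p') ∈ fil (grade k) 1 :=
      pderiv_mem_fil (i := planeEmb k (Sum.inl i)) hq2
    have := constantCoeff_of_mem_fil one_ne_zero h1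
    rwa [ofPlane_eq, pderiv_rename, constantCoeff_rename] at this
  refine ⟨atOrigin 2 k p', atOrigin 2 k (pderiv ℝ (Sum.inl 0) p'),
    atOrigin 2 k (pderiv ℝ (Sum.inl 1) p'),
    p' - (ofParams (atOrigin 2 k p') + ofParams (atOrigin 2 k (pderiv ℝ (Sum.inl 0) p')) *
      X (Sum.inl 0) + ofParams (atOrigin 2 k (pderiv ℝ (Sum.inl 1) p')) * X (Sum.inl 1)),
    ?_, ?_, ?_, ?_, ?_⟩
  · rw [constantCoeff_atOrigin, hcst]
  · rw [constantCoeff_atOrigin, hlin]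
  · rw [constantCoeff_atOrigin, hlin]
  · rw [isQuadratic_iff]
    constructor
    · simp [atOrigin_ofParams, atOrigin_X_inl]
    · intro i
      fin_cases i <;> simp [pderiv_ofParams, atOrigin_ofParams, pderiv_X_of_ne]
  · rw [unfoldingTerm_eq_ofPlane, add_sub_cancel]

theorem centralHom_ofParams {n : ℕ} (ε : MvPowerSeries (Fin k) ℝ) :
    centralHom n k (ofParams ε) = C (constantCoeff ε) := by
  have : (centralHom n k).comp (rename (paramEmb n k)) =
      (Algebra.ofId ℝ (MvPowerSeries (Fin n ⊕ Fin 0) ℝ)).comp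
        (AlgHom.mk (constantCoeff (σ := Fin k) (R := ℝ)) fun r => constantCoeff_C r) := by
    refine algHom_ext_of_X ?_ ?_
    · intro i
      rw [AlgHom.comp_apply, constantCoeff_central, constantCoeff_rename, constantCoeff_X]
    · intro i
      rw [AlgHom.comp_apply, AlgHom.comp_apply, rename_X, paramEmb_apply, centralHom_X_inr]
      exact (map_zero (Algebra.ofId ℝ _)).symm.trans
        (congrArg _ (constantCoeff_X (R := ℝ) i).symm)
  rw [ofParams_eq]
  exact DFunLike.congr_fun this ε

theorem centralHom_ofPlane (p : MvPowerSeries (Fin 2 ⊕ Fin k) ℝ) :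
    centralHom 3 k (ofPlane p) = ofPlane (central p) := by
  have : (centralHom 3 k).comp (rename (planeEmb k)) =
      (rename (planeEmb 0)).comp (centralHom 2 k) := by
    refine algHom_ext_of_X ?_ ?_
    · intro s
      rw [AlgHom.comp_apply, constantCoeff_central, constantCoeff_rename, constantCoeff_X]
    · rintro (i | j)
      · rw [AlgHom.comp_apply, AlgHom.comp_apply, rename_X, centralHom_X_inl, rename_X]
        exact centralHom_X_inl _
      · rw [AlgHom.comp_apply, AlgHom.comp_apply, rename_X, planeEmb_inr, centralHom_X_inr,
          centralHom_X_inr, map_zero]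
  rw [ofPlane_eq, ofPlane_eq, central_eq]
  exact DFunLike.congr_fun this p

theorem centralHom_unfoldingTerm {ε μ₁ μ₂ : MvPowerSeries (Fin k) ℝ} (hε : constantCoeff ε = 0)
    (hμ₁ : constantCoeff μ₁ = 0) (hμ₂ : constantCoeff μ₂ = 0)
    (p : MvPowerSeries (Fin 2 ⊕ Fin k) ℝ) :
    centralHom 3 k (unfoldingTerm ε μ₁ μ₂ p) = ofPlane (central p) := by
  simp [unfoldingTerm, centralHom_ofParams, hε, hμ₁, hμ₂, centralHom_ofPlane]

theorem eq_C_of_isEmpty {σ : Type*} [IsEmpty σ] (f : MvPowerSeries σ ℝ) :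
    f = C (constantCoeff f) := by
  classical
  ext m
  rw [Subsingleton.elim m 0, coeff_zero_C, coeff_zero_eq_constantCoeff_apply]

end Plane

/-! ### Existence of normal forms and their extension to families. -/

section Normalization

theorem pull_congr {ψ ψ' : VecSeries k} (h : ψ' = ψ) (hψ : ∀ i, constantCoeff (ψ i) = 0)
    (hψ' : ∀ i, constantCoeff (ψ' i) = 0) (g : Series k) : pull ψ' hψ' g = pull ψ hψ g := by
  subst h
  rfl

/-- The operators to which the construction of normal forms applies. -/
structure IsNormalizable (C : Matrix (Fin 3) (Fin 3) ℝ) (T₀ T : Module.End ℝ (Series k)) :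
    Prop where
  perturbation : IsPerturbation T₀ T
  triangular : IsTriangular C T₀
  start : ∃ W₀ ∈ fil (grade k) 1, iterFrame C T₀ W₀ = coord
  last : ∀ W, iterFrame C T W 2 = T (T W)
  last₀ : T₀ (coord 2) = 0
  planar : ∀ ψ q, FrameNormalizes C T ψ q → pderiv ℝ (Sum.inl 2) q = 0

variable {C : Matrix (Fin 3) (Fin 3) ℝ} {T₀ T : Module.End ℝ (Series k)}

/-- `q ∘ ψ = T (T² W)`, where `T² W` is the last component of `ψ`, hence `z` plus grade two. As `T₀
z = 0`, the value of `T` on it has grade two, and the pullback by `ψ` cannot have raised the grade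
of `q`. -/
theorem FrameNormalizes.mem_fil (H : IsNormalizable C T₀ T) {ψ : VecSeries k} {q : Series k}
    (h : FrameNormalizes C T ψ q) : q ∈ fil (grade k) 2 := by
  obtain ⟨hψ, W, rfl, hW⟩ := h
  refine mem_fil_of_pull_mem_fil hψ ?_
  rw [← hW, ← H.last W, ← sub_add_cancel (iterFrame C T W 2) (coord 2), map_add]
  refine add_mem (H.perturbation.grade (coordinateChange_sub_mem hψ 2)) ?_
  have h1 : (coord 2 : Series k) ∈ fil (grade k) 1 :=
    X_mem_fil (grade k) (Sum.inl 2)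
  have h2 := H.perturbation.sub h1
  rwa [H.last₀, sub_zero] at h2

theorem FrameNormalizes.exists_unfoldingTerm (H : IsNormalizable C T₀ T) {ψ : VecSeries k}
    {q : Series k} (h : FrameNormalizes C T ψ q) :
    ∃ (ε μ₁ μ₂ : MvPowerSeries (Fin k) ℝ) (p : MvPowerSeries (Fin 2 ⊕ Fin k) ℝ),
      constantCoeff ε = 0 ∧ constantCoeff μ₁ = 0 ∧ constantCoeff μ₂ = 0 ∧ IsQuadratic p ∧
      q = unfoldingTerm ε μ₁ μ₂ p :=
  TripleEigenvalue.exists_unfoldingTerm (H.planar ψ q h) (h.mem_fil H)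

/-- The relation imposes nothing on `W`: the frame is invertible, so every series, in particular `T³
W`, is a function of it. -/
theorem exists_frame_relation {W : Series k}
    (hW : ∀ i, iterFrame C T W i - coord i ∈ fil (grade k) 2)
    (hdet : (jac (iterFrame C T W)).det = 1) :
    ∃ h : IsCoordinateChange (iterFrame C T W), ∃ q, T (T (T W)) = pull _ h.1.1 q := by
  have h : IsCoordinateChange (iterFrame C T W) :=
    ⟨hasLinearPart_iff.2 fun i => by rw [linearVec_one]; exact hW i, hdet⟩
  obtain ⟨q, hq⟩ := pull_surjective h (T (T (T W)))
  exact ⟨h, q, hq.symm⟩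

theorem iterFrame_near_identity (H : IsNormalizable C T₀ T) {W W₀ : Series k}
    (hW₀ : ∀ i, iterFrame C T W₀ i - coord i ∈ fil (grade k) 2) {j : ℕ}
    (hW : W - W₀ ∈ bifil k 2 j) (i : Fin 3) :
    iterFrame C T W i - coord i ∈ fil (grade k) 2 := by
  have h := add_mem (iterFrame_mem (C := C) H.perturbation hW i).1 (hW₀ i)
  rwa [add_sub_assoc', ← Pi.add_apply, ← iterFrame_add, sub_add_cancel] at h

/-- The iteration starts from the function whose frame under `T₀` is the identity, with no condition
on parameter order (`j = 0`). -/
theorem IsNormalizable.exists_frameNormalizes (H : IsNormalizable C T₀ T) :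
    ∃ ψ q, FrameNormalizes C T ψ q := by
  obtain ⟨W₀, hW₀, hstart⟩ := H.start
  have h0 : ∀ i, iterFrame C T W₀ i - coord i ∈ fil (grade k) 2 := by
    intro i
    rw [← hstart]
    exact (iterFrame_sub_mem (C := C) (j := 0) H.perturbation ⟨hW₀, by simp⟩ i).1
  obtain ⟨W, hW, hdet⟩ := exists_iterFrame_det_eq_one H.perturbation H.triangular h0 (j := 0)
    (by simp)
  obtain ⟨hψ, q, hq⟩ := exists_frame_relation (iterFrame_near_identity H h0 hW) hdet
  exact ⟨_, q, hψ, W, rfl, hq⟩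

theorem centralVec_iterFrame {T' : Module.End ℝ (Series 0)}
    (hT : ∀ g, centralHom 3 k (T g) = T' (centralHom 3 k g)) (W : Series k) :
    centralVec (iterFrame C T W) = iterFrame C T' (centralHom 3 k W) := by
  have hpow : ∀ n : ℕ, centralHom 3 k ((T ^ n) W) = (T' ^ n) (centralHom 3 k W) := by
    intro n
    induction n with
    | zero => rfl
    | succ n ih => rw [pow_succ', pow_succ', Module.End.mul_apply, Module.End.mul_apply, hT, ih]
  rw [centralVec_eq]
  ext1 i
  simp only [iterFrame, map_sum, map_smul, hpow]

/-- Every normalization of the central member extends to the family. -/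
theorem IsNormalizable.exists_extension (H : IsNormalizable C T₀ T) {T' : Module.End ℝ (Series 0)}
    (hT : ∀ g, centralHom 3 k (T g) = T' (centralHom 3 k g)) {ψ₀ : VecSeries 0} {q₀ : Series 0}
    (h₀ : FrameNormalizes C T' ψ₀ q₀) :
    ∃ ψ q, FrameNormalizes C T ψ q ∧ centralVec ψ = ψ₀ ∧ centralHom 3 k q = q₀ := by
  obtain ⟨hψ₀, W', rfl, hW'⟩ := h₀
  -- The generating function of the given normalization, taken constant in the parameters, is the
  -- starting point.
  have hcen := centralVec_iterFrame (C := C) hT (liftHom 3 k W')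
  rw [central_lift] at hcen
  have h0 : ∀ i, iterFrame C T (liftHom 3 k W') i - coord i ∈ fil (grade k) 2 := by
    intro i
    have h1 := coordinateChange_sub_mem hψ₀ i
    rw [← hcen, centralVec_eq] at h1
    rw [← central_mem_fil_grade_two, map_sub, coord, centralHom_X_inl]
    exact h1
  -- The volume error vanishes at `lam = 0`, so with `j = 1` all corrections vanish there too and
  -- the central member is kept.
  have hdet : (jac (iterFrame C T (liftHom 3 k W'))).det - 1 ∈ fil (pdeg k) 1 := by
    rw [mem_fil_pdeg_one, map_sub, ← det_jac_central, hcen, hψ₀.2, map_one, sub_self]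
  obtain ⟨W, hW, hdetW⟩ := exists_iterFrame_det_eq_one H.perturbation H.triangular h0 hdet
  have hWc : centralHom 3 k W = W' := by
    have := mem_fil_pdeg_one.1 hW.2
    rwa [map_sub, central_lift, sub_eq_zero] at this
  obtain ⟨hψ, q, hq⟩ := exists_frame_relation (iterFrame_near_identity H h0 hW) hdetW
  have hψc : centralVec (iterFrame C T W) = iterFrame C T' W' := by
    rw [centralVec_iterFrame hT, hWc]
  refine ⟨_, q, ⟨hψ, W, rfl, hq⟩, hψc, pull_injective hψ₀ ?_⟩
  have key : T' (T' (T' W')) =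
      pull _ (constantCoeff_centralVec hψ.1.1) (centralHom 3 k q) := by
    rw [← hWc, ← hT, ← hT, ← hT, hq, centralHom_pull]
  rw [← hW', key]
  exact pull_congr hψc.symm _ _ _

theorem isNormalizable_flow {v : VecSeries k} (hv : IsFlowUnfolding v) :
    IsNormalizable 1 (lieDeriv (linearVec k N) : Series k →ₗ[ℝ] Series k)
      (lieDeriv v : Series k →ₗ[ℝ] Series k) where
  perturbation := isPerturbation_lieDeriv hv.1
  triangular := isTriangular_flow
  start := by
    refine ⟨coord 0, X_mem_fil (grade k) (Sum.inl 0), funext_fin_three ?_ ?_ ?_⟩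
    · simp [iterFrame_one_apply]
    · simp [iterFrame_one_apply, lieDeriv_linearVec_N, pderiv_coord]
    · simp [iterFrame_one_apply, lieDeriv_linearVec_N, pderiv_coord, pow_succ]
  last W := by simp [iterFrame_one_apply, pow_succ]
  last₀ := by simp [lieDeriv_linearVec_N, pderiv_coord]
  planar ψ q h := pderiv_eq_zero_of_flowNormalizes hv (flowNormalizes_iff.2 h)

theorem isNormalizable_map {f : VecSeries k} (hf : IsMapUnfolding f) :
    IsNormalizable J (diffOp (linearVec k J) (constantCoeff_linearVec J))
      (diffOp f hf.1.1) where
  perturbation := isPerturbation_diffOp hf.1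
  triangular := isTriangular_map
  start := by
    -- The first component of `J⁻¹ ξ`.
    refine ⟨coord 0 - coord 1 + coord 2, ?_, ?_⟩
    · exact add_mem (sub_mem (X_mem_fil (grade k) (Sum.inl 0)) (X_mem_fil (grade k) (Sum.inl 1)))
        (X_mem_fil (grade k) (Sum.inl 2))
    · refine funext_fin_three ?_ ?_ ?_
      · rw [iterFrame_J_zero]
        simp only [diffOp_apply, map_sub, map_add, pull_coord, linearVec_J_zero, linearVec_J_one,
          linearVec_J_two]
        ring
      · rw [iterFrame_J_one]
        simp only [diffOp_apply, map_sub, map_add, pull_coord, linearVec_J_zero, linearVec_J_one,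
          linearVec_J_two]
        ring
      · rw [iterFrame_J_two]
        simp only [diffOp_apply, map_sub, map_add, pull_coord, linearVec_J_zero, linearVec_J_one,
          linearVec_J_two]
        ring
  last W := iterFrame_J_two _ W
  last₀ := by rw [diffOp_apply, pull_coord, linearVec_J_two, sub_self]
  planar ψ q h := pderiv_eq_zero_of_mapNormalizes hf ((mapNormalizes_iff hf.1.1).2 h)

variable {C : Matrix (Fin 3) (Fin 3) ℝ}

theorem IsNormalizable.exists_normal_form {T₀ T : Module.End ℝ (Series 0)}
    (H : IsNormalizable C T₀ T) :
    ∃ (ψ₀ : VecSeries 0) (p₀ : MvPowerSeries (Fin 2 ⊕ Fin 0) ℝ),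
      IsQuadratic p₀ ∧ FrameNormalizes C T ψ₀ (ofPlane p₀) := by
  obtain ⟨ψ, q, h⟩ := H.exists_frameNormalizes
  obtain ⟨ε, μ₁, μ₂, p, hε, hμ₁, hμ₂, hp, rfl⟩ := h.exists_unfoldingTerm H
  refine ⟨ψ, p, hp, ?_⟩
  convert h using 1
  -- Without parameters, `ε`, `μ₁`, `μ₂` are constants, hence zero.
  rw [eq_C_of_isEmpty ε, eq_C_of_isEmpty μ₁, eq_C_of_isEmpty μ₂, hε, hμ₁, hμ₂,
    unfoldingTerm_eq_ofPlane]
  simp [ofParams_eq]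

theorem IsNormalizable.exists_unfolding {T₀ T : Module.End ℝ (Series k)}
    (H : IsNormalizable C T₀ T) {T' : Module.End ℝ (Series 0)}
    (hT : ∀ g, centralHom 3 k (T g) = T' (centralHom 3 k g)) {ψ₀ : VecSeries 0}
    {p₀ : MvPowerSeries (Fin 2 ⊕ Fin 0) ℝ} (h₀ : FrameNormalizes C T' ψ₀ (ofPlane p₀)) :
    ∃ (ψ : VecSeries k) (ε μ₁ μ₂ : MvPowerSeries (Fin k) ℝ)
      (p : MvPowerSeries (Fin 2 ⊕ Fin k) ℝ),
      constantCoeff ε = 0 ∧ constantCoeff μ₁ = 0 ∧ constantCoeff μ₂ = 0 ∧ IsQuadratic p ∧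
      FrameNormalizes C T ψ (unfoldingTerm ε μ₁ μ₂ p) ∧ centralVec ψ = ψ₀ ∧ central p = p₀ := by
  obtain ⟨ψ, q, h, hψ, hq⟩ := H.exists_extension hT h₀
  obtain ⟨ε, μ₁, μ₂, p, hε, hμ₁, hμ₂, hp, rfl⟩ := h.exists_unfoldingTerm H
  rw [centralHom_unfoldingTerm hε hμ₁ hμ₂] at hq
  exact ⟨ψ, ε, μ₁, μ₂, p, hε, hμ₁, hμ₂, hp, h, hψ, ofPlane_injective hq⟩

end Normalization

end TripleEigenvalue

end

noncomputable section

namespace TripleEigenvalue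

open MvPowerSeries Matrix

variable {k : ℕ}

/-! ### Differentials at the origin and the transversality of full unfoldings. -/

section LinearParts

/-- The terms of degree one, as a linear map. -/
def linHom (k : ℕ) : Series k →ₗ[ℝ] (Fin 3 ⊕ Fin k → ℝ) where
  toFun := linearCoeffs
  map_add' f g := by ext s; simp [linearCoeffs]
  map_smul' c f := by ext s; simp [linearCoeffs]

theorem linearCoeffs_eq (f : Series k) : linearCoeffs f = linHom k f := rfl

theorem coeff_single_eq_pderiv {σ : Type*} (s : σ) (f : MvPowerSeries σ ℝ) :
    coeff (Finsupp.single s 1) f = constantCoeff (pderiv ℝ s f) := by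
  rw [← coeff_zero_eq_constantCoeff_apply, coeff_pderiv]
  simp

theorem linHom_apply (f : Series k) (s : Fin 3 ⊕ Fin k) :
    linHom k f s = constantCoeff (pderiv ℝ s f) := coeff_single_eq_pderiv s f

theorem linHom_mul (f g : Series k) :
    linHom k (f * g) = constantCoeff f • linHom k g + constantCoeff g • linHom k f := by
  ext s
  simp [linHom_apply, Derivation.leibniz]

theorem linHom_one : linHom k 1 = 0 := by
  ext s
  simp [linHom_apply]

theorem linHom_pull {ψ : VecSeries k} (hψ : ∀ i, constantCoeff (ψ i) = 0) (g : Series k) :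
    linHom k (pull ψ hψ g) = ∑ i, linHom k g (Sum.inl i) • linHom k (ψ i) +
      ∑ j, linHom k g (Sum.inr j) • linHom k (X (Sum.inr j)) := by
  ext s
  rw [linHom_apply, pull_eq_subst, pderiv_subst (constantCoeff_elim hψ), Fintype.sum_sum_type]
  simp [linHom_apply, constantCoeff_subst' (constantCoeff_elim hψ)]

theorem linHom_pull_eq_zero {ψ : VecSeries k} (hψ : ∀ i, constantCoeff (ψ i) = 0) {g : Series k}
    (hg : linHom k g = 0) : linHom k (pull ψ hψ g) = 0 := by
  simp [linHom_pull, hg]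

/-- Written with the displacement `f - ξ`, which is what fullness of a map unfolding refers to. -/
theorem linHom_pull_sub {f : VecSeries k} (hf : ∀ i, constantCoeff (f i) = 0) (g : Series k) :
    linHom k (pull f hf g) =
      linHom k g + ∑ i, linHom k g (Sum.inl i) • linHom k (f i - coord i) := by
  have h := linHom_pull constantCoeff_coord g
  rw [pull_id] at h
  have h' := eq_sub_of_add_eq' h.symm
  rw [linHom_pull, h']
  simp only [map_sub, smul_sub, Finset.sum_sub_distrib]
  abel

theorem linHom_lieDeriv {v : VecSeries k} (hv : ∀ i, constantCoeff (v i) = 0) (g : Series k) :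
    linHom k (lieDeriv v g) = ∑ i, linHom k g (Sum.inl i) • linHom k (v i) := by
  simp [lieDeriv_apply, linHom_mul, hv, linHom_apply]

theorem linHom_coord (i : Fin 3) : linHom k (coord i) = Pi.single (Sum.inl i) 1 := by
  classical
  ext s
  rw [linHom_apply, coord, pderiv_X, Pi.single_apply, Pi.single_apply]
  simp only [eq_comm]
  split_ifs <;> simp

/-- At `N` the only nonzero cofactor is that of the entry `(2, 0)`. -/
theorem linHom_det_of_N {M : Matrix (Fin 3) (Fin 3) (Series k)}
    (hM : ∀ i j, constantCoeff (M i j) = N i j) : linHom k M.det = linHom k (M 2 0) := by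
  rw [Matrix.det_fin_three]
  simp only [map_sub, map_add, linHom_mul, map_mul, hM, N, Matrix.of_apply, Matrix.cons_val',
    Matrix.cons_val_zero, Matrix.cons_val_one, Matrix.cons_val]
  simp

theorem linHom_secondTrace (M : Matrix (Fin 3) (Fin 3) (Series k)) :
    linHom k (secondTrace M) = constantCoeff M.trace • linHom k M.trace -
      ∑ i, ∑ j, constantCoeff (M i j) • linHom k (M j i) := by
  have h : (M * M).trace = ∑ i, ∑ j, M i j * M j i := rfl
  simp only [secondTrace, map_smul, map_sub, pow_two, linHom_mul, h, map_sum,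
    Finset.sum_add_distrib]
  rw [Finset.sum_comm (f := fun i j => constantCoeff (M j i) • linHom k (M i j))]
  module

theorem linHom_secondTrace_of_N {M : Matrix (Fin 3) (Fin 3) (Series k)}
    (hM : ∀ i j, constantCoeff (M i j) = N i j) :
    linHom k (secondTrace M) = -(linHom k (M 1 0) + linHom k (M 2 1)) := by
  rw [linHom_secondTrace, Matrix.trace_fin_three]
  simp [hM, Fin.sum_univ_three, N]

theorem linHom_secondTrace_of_J {M : Matrix (Fin 3) (Fin 3) (Series k)}
    (hM : ∀ i j, constantCoeff (M i j) = J i j) :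
    linHom k (secondTrace M) =
      2 • linHom k M.trace - (linHom k (M 1 0) + linHom k (M 2 1)) := by
  rw [linHom_secondTrace, Matrix.trace_fin_three]
  have hJ : J = !![1, 1, 0; 0, 1, 1; 0, 0, 1] := by
    ext i j
    fin_cases i <;> fin_cases j <;> simp [J, N]
  simp only [hM, Fin.sum_univ_three, hJ, map_add, Matrix.of_apply, Matrix.cons_val',
    Matrix.cons_val_zero, Matrix.cons_val_one, Matrix.cons_val]
  module

theorem constantCoeff_jac {A : Matrix (Fin 3) (Fin 3) ℝ} {f : VecSeries k}
    (hf : HasLinearPart A f) (i j : Fin 3) : constantCoeff (jac f i j) = A i j := by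
  rw [← hf.2 i j, coeff_single_eq_pderiv]
  rfl

theorem constantCoeff_pderiv_of_mem {q : Series k} (hq : q ∈ fil (grade k) 2) (i : Fin 3) :
    constantCoeff (pderiv ℝ (Sum.inl i) q) = 0 := by
  rw [← coeff_single_eq_pderiv]
  exact (mem_fil_grade_two.1 hq).2 i

/-- The coefficients `ε`, `μ₁`, `μ₂` of `q` unfold the origin and the spectrum completely, up to
translations of `x`. -/
def IsTransversal (q : Series k) : Prop :=
  ∀ c₀ c₁ c₂ s : ℝ, linHom k (c₀ • q + c₁ • pderiv ℝ (Sum.inl 0) q +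
    c₂ • pderiv ℝ (Sum.inl 1) q - s • coord 1) = 0 → c₀ = 0 ∧ c₁ = 0 ∧ c₂ = 0

/-- The Jacobian of the conjugacy is differentiated at the origin. Modulo the `dvᵢ`, whose
coefficients are second derivatives of `ψ`, entry `(2, 0)` gives `d (∂q/∂x ∘ ψ) = d det Dv`, and
entries `(1, 0)` and `(2, 1)` together give `d (∂q/∂y ∘ ψ) = -dσ`. Also `dψ₁ = dv₀` and `d (q ∘ ψ) =
dv₂`, so a relation between the differentials of `q`, `∂q/∂x`, `∂q/∂y` and `y` becomes one that
fullness excludes. -/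
theorem isTransversal_of_full_flow {v ψ : VecSeries k} {q : Series k} (hv : IsFlowUnfolding v)
    (hq2 : q ∈ fil (grade k) 2) (hfull : IsFullFlowUnfolding v) (h : FlowNormalizes v ψ q) :
    IsTransversal q := by
  intro c₀ c₁ c₂ s hlin
  obtain ⟨hψ, heq⟩ := h
  have hψ0 : ∀ i, constantCoeff (ψ i) = 0 := hψ.1.1
  have hψ1 : HasLinearPart 1 ψ := hψ.1
  have hM := constantCoeff_jac hv.1
  have hA := constantCoeff_jac hψ1
  rw [comp_eq_pull hψ0] at heq
  have hmat := jac_jac_mulVec ψ v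
  rw [heq, jac_pull, jac_flowFamily] at hmat
  have hx := constantCoeff_pderiv_of_mem hq2
  have e20 := congrArg (linHom k) (congrFun (congrFun hmat 2) 0)
  have e10 := congrArg (linHom k) (congrFun (congrFun hmat 1) 0)
  have e21 := congrArg (linHom k) (congrFun (congrFun hmat 2) 1)
  simp only [Matrix.add_apply, Matrix.mul_apply, Fin.sum_univ_three, Matrix.map_apply, map_add,
    linHom_mul, hM, hA, linHom_lieDeriv hv.1.1, constantCoeff_pull] at e20 e10 e21
  simp [hx, N, linHom_one] at e20 e10 e21
  have d0 : linHom k (ψ 1) = linHom k (v 0) := by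
    have := congrArg (linHom k) (congrFun heq 0)
    rw [flowFamily_zero, pull_coord] at this
    rw [← this]
    simp [Matrix.mulVec, dotProduct, linHom_mul, hA, hv.1.1, Fin.sum_univ_three]
  have d2 : linHom k (pull ψ hψ0 q) = linHom k (v 2) := by
    have := congrArg (linHom k) (congrFun heq 2)
    rw [flowFamily_two] at this
    rw [← this]
    simp [Matrix.mulVec, dotProduct, linHom_mul, hA, hv.1.1, Fin.sum_univ_three]
  have hpull := linHom_pull_eq_zero hψ0 hlin
  simp only [map_sub, map_add, map_smul, pull_coord] at hpull
  have hdet := linHom_det_of_N hM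
  have hsig := linHom_secondTrace_of_N hM
  set α := linHom k (jac ψ 2 0)
  set β := linHom k (jac ψ 2 1)
  set γ := linHom k (jac ψ 1 0)
  -- The coefficients of `dv₀`, `dv₁`, `dv₂`, then those of `dσ` and `d det`, in the pulled back
  -- relation.
  have hfull' := Fintype.linearIndependent_iff.1 hfull
    (Sum.elim ![c₁ * α (Sum.inl 0) + c₂ * (β (Sum.inl 0) + γ (Sum.inl 0)) - s,
      c₁ * α (Sum.inl 1) + c₂ * (β (Sum.inl 1) + γ (Sum.inl 1)),
      c₀ + c₁ * α (Sum.inl 2) + c₂ * (β (Sum.inl 2) + γ (Sum.inl 2))] ![-c₂, c₁]) ?_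
  · have h2 := hfull' (Sum.inl 2)
    have h3 := hfull' (Sum.inr 0)
    have h4 := hfull' (Sum.inr 1)
    simp at h2 h3 h4
    refine ⟨?_, h4, h3⟩
    simpa [h3, h4] using h2
  · simp only [Fintype.sum_sum_type, Fin.sum_univ_three, Fin.sum_univ_two, Sum.elim_inl,
      Sum.elim_inr, Matrix.cons_val_zero, Matrix.cons_val_one, Matrix.cons_val,
      linearCoeffs_eq, hdet, hsig]
    rw [d0, d2, e20, e21] at hpull
    linear_combination (norm := module) hpull - c₂ • e10

/-- The same with the displacements `uᵢ` of the map. Modulo the `uᵢ`, the diagonal entries of the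
Jacobian identity give `d (∂q/∂y ∘ ψ) = d tr`, and the entries `(1, 0)` and `(2, 1)` then give `d
(∂q/∂x ∘ ψ) = d tr - dσ`. -/
theorem isTransversal_of_full_map {f ψ : VecSeries k} {q : Series k} (hf : IsMapUnfolding f)
    (hq2 : q ∈ fil (grade k) 2) (hqz : pderiv ℝ (Sum.inl 2) q = 0) (hfull : IsFullMapUnfolding f)
    (h : MapNormalizes f ψ q) : IsTransversal q := by
  intro c₀ c₁ c₂ s hlin
  obtain ⟨hψ, heq⟩ := h
  have hψ0 : ∀ i, constantCoeff (ψ i) = 0 := hψ.1.1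
  have hψ1 : HasLinearPart 1 ψ := hψ.1
  have hM := constantCoeff_jac hf.1
  have hA := constantCoeff_jac hψ1
  rw [comp_eq_pull hψ0, comp_eq_pull hf.1.1] at heq
  have hmat := congrArg jac heq
  rw [jac_pull, jac_pull, jac_mapFamily, hqz, add_zero] at hmat
  have hx := constantCoeff_pderiv_of_mem hq2
  have e := fun i j => congrArg (linHom k) (congrFun (congrFun hmat i) j)
  have e00 := e 0 0
  have e11 := e 1 1
  have e22 := e 2 2
  have e10 := e 1 0
  have e21 := e 2 1
  have hJ : J = !![1, 1, 0; 0, 1, 1; 0, 0, 1] := by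
    ext i j
    fin_cases i <;> fin_cases j <;> simp [J, N]
  simp only [Matrix.mul_apply, Fin.sum_univ_three, Matrix.map_apply, map_add, linHom_mul, hM, hA,
    linHom_pull_sub hf.1.1, constantCoeff_pull] at e00 e11 e22 e10 e21
  simp [hx, hJ, linHom_one] at e00 e11 e22 e10 e21
  have hlinψ : ∀ i j, linHom k (ψ i) (Sum.inl j) = if i = j then 1 else 0 := by
    intro i j
    rw [linHom_apply, ← coeff_single_eq_pderiv, hψ1.2, Matrix.one_apply]
  have d0 : linHom k (ψ 1) = linHom k (f 0 - coord 0) := by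
    have := congrArg (linHom k) (congrFun heq 0)
    rw [mapFamily_zero, map_add, pull_coord, pull_coord, linHom_pull_sub hf.1.1, map_add] at this
    simpa [Fin.sum_univ_three, hlinψ] using this.symm
  have d2 : linHom k (pull ψ hψ0 q) = linHom k (f 2 - coord 2) := by
    have := congrArg (linHom k) (congrFun heq 2)
    rw [mapFamily_two, map_add, pull_coord, linHom_pull_sub hf.1.1, map_add] at this
    simpa [Fin.sum_univ_three, hlinψ] using this.symm
  have hpull := linHom_pull_eq_zero hψ0 hlin
  simp only [map_sub, map_add, map_smul, pull_coord] at hpull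
  have hsig := linHom_secondTrace_of_J hM
  rw [map_sub] at d0 d2
  rw [d0, d2] at hpull
  set α := linHom k (jac ψ 2 0)
  set β := linHom k (jac ψ 2 1)
  set γ := linHom k (jac ψ 1 0)
  set δ₀ := linHom k (jac ψ 0 0)
  set δ₁ := linHom k (jac ψ 1 1)
  set δ₂ := linHom k (jac ψ 2 2)
  set u₀ := linHom k (f 0) - linHom k (coord 0) with hu₀
  set u₁ := linHom k (f 1) - linHom k (coord 1) with hu₁
  set u₂ := linHom k (f 2) - linHom k (coord 2) with hu₂
  have ht : linHom k (jac f).trace =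
      linHom k (jac f 0 0) + linHom k (jac f 1 1) + linHom k (jac f 2 2) := by
    rw [Matrix.trace_fin_three, map_add, map_add]
  have hy : linHom k (pull ψ hψ0 (pderiv ℝ (Sum.inl 1) q)) = linHom k (jac f).trace +
      ((δ₀ + δ₁ + δ₂ + γ + β) (Sum.inl 0) • u₀ + (δ₀ + δ₁ + δ₂ + γ + β) (Sum.inl 1) • u₁ +
        (δ₀ + δ₁ + δ₂ + γ + β) (Sum.inl 2) • u₂) := by
    rw [ht]
    simp only [Pi.add_apply]
    linear_combination (norm := module) -e00 - e11 - e22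
  have hxx : linHom k (pull ψ hψ0 (pderiv ℝ (Sum.inl 0) q)) =
      linHom k (jac f).trace - linHom k (secondTrace (jac f)) +
      ((α - (δ₀ + δ₁ + δ₂)) (Sum.inl 0) • u₀ + (α - (δ₀ + δ₁ + δ₂)) (Sum.inl 1) • u₁ +
        (α - (δ₀ + δ₁ + δ₂)) (Sum.inl 2) • u₂) := by
    rw [hy] at e21
    rw [hsig]
    simp only [Pi.add_apply, Pi.sub_apply] at e21 ⊢
    linear_combination (norm := module) -e10 - e21
  rw [hxx, hy] at hpull
  -- The coefficients of the displacements, then `c₁ + c₂` for the trace and `-c₁` for `σ`.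
  have hfull' := Fintype.linearIndependent_iff.1 hfull
    (Sum.elim ![c₁ * (α - (δ₀ + δ₁ + δ₂)) (Sum.inl 0) +
        c₂ * (δ₀ + δ₁ + δ₂ + γ + β) (Sum.inl 0) - s,
      c₁ * (α - (δ₀ + δ₁ + δ₂)) (Sum.inl 1) + c₂ * (δ₀ + δ₁ + δ₂ + γ + β) (Sum.inl 1),
      c₀ + c₁ * (α - (δ₀ + δ₁ + δ₂)) (Sum.inl 2) + c₂ * (δ₀ + δ₁ + δ₂ + γ + β) (Sum.inl 2)]
      ![c₁ + c₂, -c₁]) ?_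
  · have h2 := hfull' (Sum.inl 2)
    have h3 := hfull' (Sum.inr 0)
    have h4 := hfull' (Sum.inr 1)
    simp only [Sum.elim_inl, Sum.elim_inr, Matrix.cons_val_zero, Matrix.cons_val_one,
      Matrix.cons_val, neg_eq_zero] at h2 h3 h4
    rw [h4, zero_add] at h3
    rw [h3, h4] at h2
    exact ⟨by simpa using h2, h4, h3⟩
  · simp only [Fintype.sum_sum_type, Fin.sum_univ_three, Fin.sum_univ_two, Sum.elim_inl,
      Sum.elim_inr, Matrix.cons_val_zero, Matrix.cons_val_one, Matrix.cons_val,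
      linearCoeffs_eq, Pi.sub_apply, map_sub, ← hu₀, ← hu₁, ← hu₂]
    simp only [Pi.sub_apply] at hpull
    linear_combination (norm := module) hpull

end LinearParts

end TripleEigenvalue

end

noncomputable section

namespace TripleEigenvalue

open MvPowerSeries Matrix

/-! ### Translations of `x` that make `ε`, `μ₁`, `μ₂` coordinates of the parameter space. -/

variable {k : ℕ}

/-- The determinant is affine in `a`: it equals `det (e, m₁, m₂) - det (e, r₂ m₁ - r₁ m₂, a)`. If it
vanished identically, `e` would be parallel to `r₂ m₁ - r₁ m₂` and `e, m₁, m₂` would be dependent,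
contrary to the independence of `(0, e)`, `(r₁, m₁)`, `(r₂, m₂)`. -/
theorem exists_det_shift_ne_zero {e m₁ m₂ : Fin 3 → ℝ} {r₁ r₂ : ℝ}
    (h : ∀ c₀ c₁ c₂ : ℝ, c₀ • e + c₁ • m₁ + c₂ • m₂ = 0 → c₁ * r₁ + c₂ * r₂ = 0 →
      c₀ = 0 ∧ c₁ = 0 ∧ c₂ = 0) :
    ∃ a : Fin 3 → ℝ, (Matrix.of ![e, m₁ - r₁ • a, m₂ - r₂ • a]).det ≠ 0 := by
  by_contra! hdet
  have h0 := hdet 0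
  have hw : ∀ i j, e i * (r₂ * m₁ j - r₁ * m₂ j) = e j * (r₂ * m₁ i - r₁ * m₂ i) := by
    have hs := fun i => hdet (Pi.single i 1)
    have s0 := hs 0
    have s1 := hs 1
    have s2 := hs 2
    simp [Matrix.det_fin_three] at h0 s0 s1 s2
    have t01 : e 0 * (r₂ * m₁ 1 - r₁ * m₂ 1) = e 1 * (r₂ * m₁ 0 - r₁ * m₂ 0) := by
      linear_combination h0 - s2
    have t02 : e 0 * (r₂ * m₁ 2 - r₁ * m₂ 2) = e 2 * (r₂ * m₁ 0 - r₁ * m₂ 0) := by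
      linear_combination s1 - h0
    have t12 : e 1 * (r₂ * m₁ 2 - r₁ * m₂ 2) = e 2 * (r₂ * m₁ 1 - r₁ * m₂ 1) := by
      linear_combination h0 - s0
    intro i j
    fin_cases i <;> fin_cases j <;>
      first | rfl | assumption | (symm; assumption)
  obtain ⟨i, hi⟩ : ∃ i, e i ≠ 0 := by
    by_contra! he
    have := h 1 0 0 (by ext i; simp [he]) (by simp)
    simp at this
  -- The relation that expresses parallelism; its last two coefficients satisfy `c₁ r₁ + c₂ r₂ = 0`,
  -- so `h` applies and forces `r₁ = r₂ = 0`.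
  have hr := h (-(r₂ * m₁ i - r₁ * m₂ i)) (e i * r₂) (-(e i * r₁)) (by
    ext j
    simp only [Pi.add_apply, Pi.smul_apply, smul_eq_mul, Pi.zero_apply]
    linear_combination hw i j) (by ring)
  have hr₂ : r₂ = 0 := (mul_eq_zero.1 hr.2.1).resolve_left hi
  have hr₁ : r₁ = 0 := (mul_eq_zero.1 (neg_eq_zero.1 hr.2.2)).resolve_left hi
  obtain ⟨c, hc, hc0⟩ := Matrix.exists_vecMul_eq_zero_iff.2 h0
  have := h (c 0) (c 1) (c 2) (by
    ext j
    have := congrFun hc0 j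
    simpa [Matrix.vecMul, dotProduct, Fin.sum_univ_three] using this) (by simp [hr₁, hr₂])
  exact hc (funext_fin_three this.1 this.2.1 this.2.2)

section Shift

/-- A linear combination of the parameters. -/
def paramSum (b : Fin k → ℝ) : Series k := ∑ j, b j • X (Sum.inr j)

theorem linHom_paramSum (b : Fin k → ℝ) : linHom k (paramSum b) =
      (Sum.elim 0 b : Fin 3 ⊕ Fin k → ℝ) := by
  classical
  ext (i | j) <;> simp [linHom_apply, paramSum, pderiv_X, Pi.single_apply, apply_ite]

theorem constantCoeff_paramSum (b : Fin k → ℝ) : constantCoeff (paramSum b) = 0 := by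
  simp [paramSum]

theorem pderiv_paramSum (b : Fin k → ℝ) (i : Fin 3) :
    pderiv ℝ (Sum.inl i) (paramSum b) = 0 := by
  classical
  simp [paramSum]

theorem pull_paramSum {f : VecSeries k} (hf : ∀ i, constantCoeff (f i) = 0) (b : Fin k → ℝ) :
    pull f hf (paramSum b) = paramSum b := by
  simp only [paramSum, map_sum, map_smul, pull_param]

theorem centralHom_paramSum (b : Fin k → ℝ) : centralHom 3 k (paramSum b) = 0 := by
  simp only [paramSum, map_sum, map_smul, centralHom_X_inr, smul_zero, Finset.sum_const_zero]

/-- The shift of `x` by a linear combination of the parameters. -/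
def paramShift (b : Fin k → ℝ) : VecSeries k := Pi.single 0 (paramSum b)

theorem paramShift_apply (b : Fin k → ℝ) (i : Fin 3) :
    paramShift b i = if i = 0 then paramSum b else 0 := by
  rw [paramShift, Pi.single_apply]

/-- The translation of `x` by a linear combination of the parameters. -/
def translation (b : Fin k → ℝ) : VecSeries k := coord + paramShift b

theorem translation_apply (b : Fin k → ℝ) (i : Fin 3) :
    translation b i = coord i + paramShift b i := rfl

theorem constantCoeff_paramShift (b : Fin k → ℝ) (i : Fin 3) :
    constantCoeff (paramShift b i) = 0 := by
  rw [paramShift_apply]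
  split_ifs
  · exact constantCoeff_paramSum b
  · exact map_zero _

theorem constantCoeff_translation (b : Fin k → ℝ) (i : Fin 3) :
    constantCoeff (translation b i) = 0 := by
  rw [translation_apply, map_add, constantCoeff_coord, constantCoeff_paramShift, add_zero]

theorem pderiv_paramShift (b : Fin k → ℝ) (i j : Fin 3) :
    pderiv ℝ (Sum.inl j) (paramShift b i) = 0 := by
  rw [paramShift_apply]
  split_ifs
  · exact pderiv_paramSum b j
  · exact map_zero _

/-- The series `q (x + b λ, y, z, λ)`. -/
abbrev translate (b : Fin k → ℝ) : Series k →ₐ[ℝ] Series k :=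
  pull (translation b) (constantCoeff_translation b)

theorem pderiv_translate (b : Fin k → ℝ) (j : Fin 3) (q : Series k) :
    pderiv ℝ (Sum.inl j) (translate b q) = translate b (pderiv ℝ (Sum.inl j) q) := by
  rw [pderiv_pull, Finset.sum_eq_single j]
  · rw [translation_apply, map_add, pderiv_paramShift, pderiv_coord, if_pos rfl, add_zero,
      mul_one]
  · intro i _ hi
    rw [translation_apply, map_add, pderiv_paramShift, pderiv_coord, if_neg hi.symm, add_zero,
      mul_zero]
  · simp

theorem linHom_translate (b : Fin k → ℝ) (q : Series k) (j : Fin k) :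
    linHom k (translate b q) (Sum.inr j) =
      linHom k q (Sum.inr j) + linHom k q (Sum.inl 0) * b j := by
  classical
  have hX : ∀ j, linHom k (X (Sum.inr j)) = Pi.single (Sum.inr j) 1 := by
    intro j
    ext s
    rw [linHom_apply, pderiv_X, Pi.single_apply, Pi.single_apply]
    simp only [eq_comm]
    split_ifs <;> simp
  rw [linHom_pull]
  simp [translation_apply, Fin.sum_univ_three, linHom_coord, hX, linHom_paramSum,
    paramShift_apply, Pi.single_apply]
  ring

theorem centralHom_translate (b : Fin k → ℝ) (q : Series k) :
    centralHom 3 k (translate b q) = centralHom 3 k q := by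
  have h : centralVec (translation b) = coord := by
    rw [centralVec_eq]
    ext1 i
    rw [translation_apply, map_add, paramShift_apply]
    split_ifs
    · rw [centralHom_paramSum, add_zero]; exact centralHom_X_inl i
    · rw [map_zero, add_zero]; exact centralHom_X_inl i
  rw [centralHom_pull _ (constantCoeff_centralVec (constantCoeff_translation b)),
    pull_congr h constantCoeff_coord, pull_id]

variable {C : Matrix (Fin 3) (Fin 3) ℝ} {T : Module.End ℝ (Series k)}

theorem iterFrame_paramSum (hC : ∀ i, C i 0 = if i = 0 then 1 else 0)
    (hT : ∀ j, T (X (Sum.inr j)) = 0) (b : Fin k → ℝ) :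
    iterFrame C T (paramSum b) = paramShift b := by
  have h : T (paramSum b) = 0 := by simp [paramSum, hT]
  ext1 i
  rw [iterFrame, Fin.sum_univ_three]
  simp only [Fin.val_zero, Fin.val_one, Fin.val_two, pow_zero, pow_one, pow_two,
    Module.End.one_apply, Module.End.mul_apply, h, map_zero, smul_zero, add_zero, hC, ite_smul,
    one_smul, zero_smul, paramShift_apply]

theorem IsCoordinateChange.add_paramSum {ψ : VecSeries k} (h : IsCoordinateChange ψ)
    (b : Fin k → ℝ) : IsCoordinateChange (ψ + paramShift b) := by
  refine ⟨⟨fun i => ?_, fun i j => ?_⟩, ?_⟩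
  · rw [Pi.add_apply, map_add, constantCoeff_paramShift, h.1.1, add_zero]
  · rw [Pi.add_apply, map_add, h.1.2, coeff_single_eq_pderiv, pderiv_paramShift, map_zero,
      add_zero]
  · rw [← h.2]
    congr 1
    ext1 i j
    simp only [jac, Matrix.of_apply, Pi.add_apply, map_add, pderiv_paramShift, add_zero]

/-- `T` kills functions of the parameters, and the first column of `C` is the first unit vector.
Subtracting such a function from `W` therefore moves only the first component of the frame and
leaves `T³ W` unchanged. -/
theorem FrameNormalizes.translate (hC : ∀ i, C i 0 = if i = 0 then 1 else 0)
    (hT : ∀ j, T (X (Sum.inr j)) = 0) {ψ : VecSeries k} {q : Series k}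
    (h : FrameNormalizes C T ψ q) (b : Fin k → ℝ) :
    FrameNormalizes C T (ψ - paramShift b) (translate b q) := by
  obtain ⟨hψ, W, hW, hq⟩ := h
  have hneg : ψ - paramShift b = ψ + paramShift (-b) := by
    have : paramSum (-b) = -paramSum b := by simp [paramSum]
    rw [paramShift, paramShift, this, Pi.single_neg, sub_eq_add_neg]
  have hψ' : IsCoordinateChange (ψ - paramShift b) := by
    rw [hneg]
    exact hψ.add_paramSum (-b)
  have hψ0 : ∀ i, constantCoeff (ψ i) = 0 := hψ.1.1
  have hψ0' : ∀ i, constantCoeff ((ψ - paramShift b) i) = 0 := hψ'.1.1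
  refine ⟨hψ', W + paramSum (-b), ?_, ?_⟩
  · rw [iterFrame_add, iterFrame_paramSum hC hT, hneg, hW]
  · have h : T (paramSum (-b)) = 0 := by simp [paramSum, hT]
    rw [map_add, h, add_zero, hq]
    change pull ψ hψ0 q = pull _ hψ0' _
    have : (pull _ hψ0').comp (TripleEigenvalue.translate b) = pull ψ hψ0 := by
      refine algHom_ext_of_X ?_ ?_
      · intro s
        rw [AlgHom.comp_apply, constantCoeff_pull, constantCoeff_pull, constantCoeff_X]
      · rintro (i | j)
        · change pull _ hψ0' (TripleEigenvalue.translate b (coord i)) = pull ψ hψ0 (coord i)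
          rw [pull_coord, pull_coord, translation_apply, map_add, pull_coord, Pi.sub_apply,
            paramShift_apply]
          split_ifs
          · rw [pull_paramSum, sub_add_cancel]
          · rw [map_zero, sub_zero, add_zero]
        · rw [AlgHom.comp_apply, pull_param, pull_param, pull_param]
    rw [← this, AlgHom.comp_apply]

end Shift

/-! ### Reading off the first-order dependence of `ε`, `μ₁`, `μ₂` on the parameters. -/

section Jacobian

theorem coeff_single_atOrigin {n : ℕ} (f : MvPowerSeries (Fin n ⊕ Fin k) ℝ) (j : Fin k) :
    coeff (Finsupp.single j 1) (atOrigin n k f) = coeff (Finsupp.single (Sum.inr j) 1) f := by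
  rw [atOrigin, coeff_killCompl, Finsupp.embDomain_single, paramEmb_apply]

theorem atOrigin_X_inr {n : ℕ} (j : Fin k) : atOrigin n k (X (Sum.inr j)) = X j :=
  killCompl_X (e := paramEmb n k) j

theorem atOrigin_ofPlane (p : MvPowerSeries (Fin 2 ⊕ Fin k) ℝ) :
    atOrigin 3 k (ofPlane p) = atOrigin 2 k p := by
  ext m
  rw [ofPlane_eq, atOrigin, atOrigin, coeff_killCompl, coeff_killCompl]
  have : m.embDomain (paramEmb 3 k) = (m.embDomain (paramEmb 2 k)).embDomain (planeEmb k) := by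
    rw [← Finsupp.embDomain_trans_apply]
    congr 1
  rw [this, coeff_embDomain_rename]

theorem pderiv_ofPlane_zero (p : MvPowerSeries (Fin 2 ⊕ Fin k) ℝ) :
    pderiv ℝ (Sum.inl 0) (ofPlane p) = ofPlane (pderiv ℝ (Sum.inl 0) p) := by
  rw [ofPlane_eq, ofPlane_eq, ← pderiv_rename, planeEmb_zero]

theorem pderiv_ofPlane_one (p : MvPowerSeries (Fin 2 ⊕ Fin k) ℝ) :
    pderiv ℝ (Sum.inl 1) (ofPlane p) = ofPlane (pderiv ℝ (Sum.inl 1) p) := by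
  rw [ofPlane_eq, ofPlane_eq, ← pderiv_rename, planeEmb_one]

variable (ε μ₁ μ₂ : MvPowerSeries (Fin k) ℝ) {p : MvPowerSeries (Fin 2 ⊕ Fin k) ℝ}
  (hp : IsQuadratic p)

theorem atOrigin_coord (i : Fin 3) : atOrigin 3 k (coord i) = 0 := atOrigin_X_inl i

include hp

theorem atOrigin_unfoldingTerm : atOrigin 3 k (unfoldingTerm ε μ₁ μ₂ p) = ε := by
  simp [unfoldingTerm, atOrigin_ofParams, atOrigin_coord, atOrigin_ofPlane, (isQuadratic_iff.1 hp).1]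

theorem atOrigin_pderiv_zero_unfoldingTerm :
    atOrigin 3 k (pderiv ℝ (Sum.inl 0) (unfoldingTerm ε μ₁ μ₂ p)) = μ₁ := by
  simp [unfoldingTerm, Derivation.leibniz, pderiv_coord, pderiv_ofParams, pderiv_ofPlane_zero,
    atOrigin_ofPlane, (isQuadratic_iff.1 hp).2, atOrigin_ofParams]

theorem atOrigin_pderiv_one_unfoldingTerm :
    atOrigin 3 k (pderiv ℝ (Sum.inl 1) (unfoldingTerm ε μ₁ μ₂ p)) = μ₂ := by
  simp [unfoldingTerm, Derivation.leibniz, pderiv_coord, pderiv_ofParams, pderiv_ofPlane_one,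
    atOrigin_ofPlane, (isQuadratic_iff.1 hp).2, atOrigin_ofParams]

theorem linHom_unfoldingTerm_inr (j : Fin k) :
    linHom k (unfoldingTerm ε μ₁ μ₂ p) (Sum.inr j) = coeff (Finsupp.single j 1) ε := by
  conv_rhs => rw [← atOrigin_unfoldingTerm ε μ₁ μ₂ hp, coeff_single_atOrigin]
  rfl

theorem linHom_pderiv_zero_unfoldingTerm_inr (j : Fin k) :
    linHom k (pderiv ℝ (Sum.inl 0) (unfoldingTerm ε μ₁ μ₂ p)) (Sum.inr j) =
      coeff (Finsupp.single j 1) μ₁ := by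
  conv_rhs => rw [← atOrigin_pderiv_zero_unfoldingTerm ε μ₁ μ₂ hp, coeff_single_atOrigin]
  rfl

theorem linHom_pderiv_one_unfoldingTerm_inr (j : Fin k) :
    linHom k (pderiv ℝ (Sum.inl 1) (unfoldingTerm ε μ₁ μ₂ p)) (Sum.inr j) =
      coeff (Finsupp.single j 1) μ₂ := by
  conv_rhs => rw [← atOrigin_pderiv_one_unfoldingTerm ε μ₁ μ₂ hp, coeff_single_atOrigin]
  rfl

end Jacobian

theorem IsTransversal.exists_translate {q : Series 3} (h : IsTransversal q)
    (hq2 : q ∈ fil (grade 3) 2) (hqz : pderiv ℝ (Sum.inl 2) q = 0) :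
    ∃ b : Fin 3 → ℝ, (Matrix.of ![fun j => linHom 3 (translate b q) (Sum.inr j),
      fun j => linHom 3 (pderiv ℝ (Sum.inl 0) (translate b q)) (Sum.inr j),
      fun j => linHom 3 (pderiv ℝ (Sum.inl 1) (translate b q)) (Sum.inr j)]).det ≠ 0 := by
  have hx : ∀ i : Fin 3, linHom 3 q (Sum.inl i) = 0 := (mem_fil_grade_two.1 hq2).2
  obtain ⟨a, ha⟩ := exists_det_shift_ne_zero
    (e := fun j => linHom 3 q (Sum.inr j))
    (m₁ := fun j => linHom 3 (pderiv ℝ (Sum.inl 0) q) (Sum.inr j))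
    (m₂ := fun j => linHom 3 (pderiv ℝ (Sum.inl 1) q) (Sum.inr j))
    (r₁ := linHom 3 (pderiv ℝ (Sum.inl 0) q) (Sum.inl 0))
    (r₂ := linHom 3 (pderiv ℝ (Sum.inl 1) q) (Sum.inl 0)) (by
      intro c₀ c₁ c₂ h1 h2
      -- The multiple of `y` that cancels the `y`-part of the relation. Its `z`-part vanishes as `q`
      -- does not depend on `z`, and its `x`-part is `h2`.
      refine h c₀ c₁ c₂ (c₁ * linHom 3 (pderiv ℝ (Sum.inl 0) q) (Sum.inl 1) +
        c₂ * linHom 3 (pderiv ℝ (Sum.inl 1) q) (Sum.inl 1)) ?_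
      have hz : ∀ i : Fin 3, linHom 3 (pderiv ℝ (Sum.inl i) q) (Sum.inl 2) = 0 := by
        intro i
        rw [linHom_apply, pderiv_pderiv_comm, hqz, map_zero, map_zero]
      ext (i | j)
      · match i with
        | 0 => simpa [hx, linHom_coord] using h2
        | 1 => simp [hx, linHom_coord]
        | 2 => simp [hx, hz, linHom_coord]
      · simpa [linHom_coord] using congrFun h1 j)
  -- Translation by `b` adds `r₁ b` and `r₂ b` to the differentials of `μ₁` and `μ₂`, and nothing to
  -- that of `ε` because `q` has no linear term in `x`.
  refine ⟨-a, ?_⟩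
  convert ha using 3
  simp only [pderiv_translate, linHom_translate]
  congr 1
  · ext j; simp [hx]
  · congr 1
    · ext j; simp [sub_eq_add_neg]
    · congr 1
      ext j; simp [sub_eq_add_neg]

theorem FrameNormalizes.exists_unfolding_of_isTransversal {C : Matrix (Fin 3) (Fin 3) ℝ}
    {T₀ T : Module.End ℝ (Series 3)} (H : IsNormalizable C T₀ T)
    (hC : ∀ i, C i 0 = if i = 0 then 1 else 0) (hT : ∀ j, T (X (Sum.inr j)) = 0)
    {ψ : VecSeries 3} {q : Series 3} (h : FrameNormalizes C T ψ q) (hq : IsTransversal q) :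
    ∃ (ψ' : VecSeries 3) (θ : Fin 3 → MvPowerSeries (Fin 3) ℝ)
      (p : MvPowerSeries (Fin 2 ⊕ Fin 3) ℝ),
      IsParamChange θ ∧ IsQuadratic p ∧
      FrameNormalizes C T ψ' (unfoldingTerm (θ 0) (θ 1) (θ 2) p) ∧
      centralVec ψ' = centralVec ψ ∧ ofPlane (central p) = centralHom 3 3 q := by
  obtain ⟨b, hb⟩ := hq.exists_translate (h.mem_fil H) (H.planar ψ q h)
  have h' := h.translate hC hT b
  obtain ⟨ε, μ₁, μ₂, p, hε, hμ₁, hμ₂, hp, heq⟩ := h'.exists_unfoldingTerm H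
  refine ⟨_, ![ε, μ₁, μ₂], p, ⟨fun j => ?_, ?_⟩, hp, heq ▸ h', ?_, ?_⟩
  · match j with
    | 0 => exact hε
    | 1 => exact hμ₁
    | 2 => exact hμ₂
  · rw [heq] at hb
    convert hb using 2
    ext i j
    match i with
    | 0 => exact (linHom_unfoldingTerm_inr ε μ₁ μ₂ hp j).symm
    | 1 => exact (linHom_pderiv_zero_unfoldingTerm_inr ε μ₁ μ₂ hp j).symm
    | 2 => exact (linHom_pderiv_one_unfoldingTerm_inr ε μ₁ μ₂ hp j).symm
  · rw [centralVec_eq, centralVec_eq]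
    ext1 i
    rw [Pi.sub_apply, map_sub, paramShift_apply]
    split_ifs <;> simp [centralHom_paramSum]
  · rw [← centralHom_translate b q, heq, centralHom_unfoldingTerm hε hμ₁ hμ₂]

end TripleEigenvalue

end

noncomputable section

namespace TripleEigenvalue

open MvPowerSeries Matrix

/-! ### The formal inverse function theorem. -/

section Inverse

variable {σ : Type*} [Fintype σ]

theorem mem_fil_one_two {f : MvPowerSeries σ ℝ} (h0 : constantCoeff f = 0)
    (h1 : ∀ i, coeff (Finsupp.single i 1) f = 0) : f ∈ fil (1 : σ → ℕ) 2 := by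
  intro m hm
  by_cases hm0 : m = 0
  · rw [hm0, coeff_zero_eq_constantCoeff_apply, h0]
  · obtain ⟨s, hs⟩ := Finsupp.ne_iff.1 hm0
    have hadd := Finsupp.weight_sub_single_add (w := (1 : σ → ℕ)) hs
    rw [Pi.one_apply] at hadd
    have hrest : m - Finsupp.single s 1 = 0 := by
      by_contra hne
      obtain ⟨t, ht⟩ := Finsupp.ne_iff.1 hne
      have h2 := Finsupp.le_weight_of_ne_zero' (1 : σ → ℕ) (s := t) ht
      rw [Pi.one_apply] at h2
      omega
    have hle : Finsupp.single s 1 ≤ m := by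
      simpa [Finsupp.single_le_iff] using Nat.one_le_iff_ne_zero.2 hs
    rw [← tsub_add_cancel_of_le hle, hrest, zero_add, h1]

/-- Surjectivity of `subst θ` gives a one-sided inverse. Its injectivity, applied to `subst φ (θ i)`
and `X i`, shows that the inverse is two-sided. -/
theorem exists_subst_eq_X_of_near_identity {θ : σ → MvPowerSeries σ ℝ}
    (h0 : ∀ i, constantCoeff (θ i) = 0) (h : ∀ i, θ i - X i ∈ fil (1 : σ → ℕ) 2) :
    ∃ φ : σ → MvPowerSeries σ ℝ, (∀ i, constantCoeff (φ i) = 0) ∧ ∀ i, subst φ (θ i) = X i := by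
  choose φ hφ using fun i => subst_surjective h0 h (X i)
  have hφ0 : ∀ i, constantCoeff (φ i) = 0 := by
    intro i
    rw [← constantCoeff_subst' h0, hφ, constantCoeff_X]
  refine ⟨φ, hφ0, fun i => subst_injective h0 h ?_⟩
  rw [subst_comp_subst_apply (hasSubst_of_zero hφ0) (hasSubst_of_zero h0)]
  simp only [hφ]
  rw [subst_X (hasSubst_of_zero h0)]
  exact congrFun subst_self (θ i)

/-- Reduced to the near-identity case: with `A` the linear part of `θ` and `χ` the inverse of `A⁻¹
θ`, the inverse of `θ` is `χ ∘ A⁻¹`. -/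
theorem IsParamChange.exists_inverse {θ : Fin 3 → MvPowerSeries (Fin 3) ℝ}
    (h : IsParamChange θ) : ∃ φ, IsParamChange φ ∧ ∀ i, subst φ (θ i) = X i := by
  obtain ⟨h0, hdet⟩ := h
  set A : Matrix (Fin 3) (Fin 3) ℝ :=
    Matrix.of fun i j => coeff (Finsupp.single j 1) (θ i) with hA
  have hu : IsUnit A.det := isUnit_iff_ne_zero.2 hdet
  have hl : ∀ i, constantCoeff (∑ j, A⁻¹ i j • θ j) = 0 := by
    intro i
    simp [h0]
  have hL0 : ∀ i, constantCoeff (∑ j, A⁻¹ i j • (X j : MvPowerSeries (Fin 3) ℝ)) = 0 := by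
    intro i
    simp
  obtain ⟨χ, hχ0, hχ⟩ := exists_subst_eq_X_of_near_identity hl fun i => by
    refine mem_fil_one_two (by rw [map_sub, hl, constantCoeff_X, sub_zero]) fun j => ?_
    have := congrFun (congrFun (Matrix.nonsing_inv_mul A hu) i) j
    rw [Matrix.mul_apply, Matrix.one_apply] at this
    rw [map_sub, map_sum]
    simp only [map_smul, smul_eq_mul]
    simp only [coeff_X, Finsupp.single_left_inj one_ne_zero]
    rw [sub_eq_zero]
    simpa [eq_comm, hA] using this
  have hs := hasSubst_of_zero hL0
  have hsχ := hasSubst_of_zero hχ0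
  set φ : Fin 3 → MvPowerSeries (Fin 3) ℝ :=
    fun i => subst (fun i => ∑ j, A⁻¹ i j • (X j : MvPowerSeries (Fin 3) ℝ)) (χ i) with hφ
  have hφ0 : ∀ i, constantCoeff (φ i) = 0 := by
    intro i
    rw [hφ, constantCoeff_subst' hL0, hχ0]
  have hsφ := hasSubst_of_zero hφ0
  have key : ∀ i, ∑ j, A⁻¹ i j • subst φ (θ j) = ∑ j, A⁻¹ i j • X j := by
    intro i
    have := congrArg (subst fun i => ∑ j, A⁻¹ i j • (X j : MvPowerSeries (Fin 3) ℝ)) (hχ i)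
    rw [subst_X hs, subst_comp_subst_apply hsχ hs, ← hφ, ← coe_substAlgHom hsφ, map_sum] at this
    rw [← this, ← coe_substAlgHom hsφ]
    simp only [map_smul]
  have hsub : ∀ i, subst φ (θ i) = X i := by
    intro i
    have h1 := congrArg (fun f : Fin 3 → MvPowerSeries (Fin 3) ℝ => ∑ j, A i j • f j)
      (funext key)
    have h2 : ∀ g : Fin 3 → MvPowerSeries (Fin 3) ℝ,
        ∑ j, A i j • ∑ l, A⁻¹ j l • g l = g i := by
      intro g
      simp only [Finset.smul_sum, smul_smul]
      rw [Finset.sum_comm]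
      simp only [← Finset.sum_smul, ← Matrix.mul_apply, Matrix.mul_nonsing_inv A hu,
        Matrix.one_apply, ite_smul, one_smul, zero_smul, Finset.sum_ite_eq, Finset.mem_univ,
        if_true]
    simpa only [h2] using h1
  refine ⟨φ, ⟨hφ0, fun hdet0 => ?_⟩, hsub⟩
  have hmul : A * Matrix.of (fun i j => coeff (Finsupp.single j 1) (φ i)) = 1 := by
    ext i j
    have := congrArg (fun f => constantCoeff (pderiv ℝ j f)) (hsub i)
    simp only [pderiv_subst hφ0, map_sum, map_mul, constantCoeff_subst' hφ0,
      ← coeff_single_eq_pderiv] at this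
    rw [Matrix.mul_apply, Matrix.one_apply]
    refine this.trans ?_
    simp only [coeff_X, Finsupp.single_left_inj one_ne_zero, eq_comm]
  have := congrArg Matrix.det hmul
  rw [Matrix.det_mul, hdet0, mul_zero, Matrix.det_one] at this
  exact zero_ne_one this

end Inverse

/-! ### Changes of parameters. -/

section Reparam

theorem constantCoeff_ofParams {n k : ℕ} (ε : MvPowerSeries (Fin k) ℝ) :
    constantCoeff (ofParams ε : MvPowerSeries (Fin n ⊕ Fin k) ℝ) = constantCoeff ε := by
  rw [ofParams_eq, constantCoeff_rename]

theorem pull_ofParams {k : ℕ} {f : VecSeries k} (hf : ∀ i, constantCoeff (f i) = 0)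
    (ε : MvPowerSeries (Fin k) ℝ) : pull f hf (ofParams ε) = ofParams ε := by
  have : (pull f hf).comp (rename (paramEmb 3 k)) = rename (paramEmb 3 k) := by
    refine algHom_ext_of_X ?_ ?_
    · intro i
      rw [AlgHom.comp_apply, constantCoeff_pull, constantCoeff_rename, constantCoeff_X]
    · intro i
      rw [AlgHom.comp_apply, rename_X, paramEmb_apply, pull_param]
  rw [ofParams_eq]
  exact DFunLike.congr_fun this ε

variable {φ : Fin 3 → MvPowerSeries (Fin 3) ℝ} (hφ : ∀ j, constantCoeff (φ j) = 0) {n : ℕ}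

include hφ in
theorem constantCoeff_reparam_elim (s : Fin n ⊕ Fin 3) :
    constantCoeff ((Sum.elim (fun i => X (Sum.inl i)) fun j => ofParams (φ j) :
      Fin n ⊕ Fin 3 → MvPowerSeries (Fin n ⊕ Fin 3) ℝ) s) = 0 := by
  rcases s with i | j
  · exact constantCoeff_X _
  · exact (constantCoeff_ofParams _).trans (hφ j)

/-- The substitution of `φ (ε, μ₁, μ₂)` for the parameters. -/
def reparamHom (n : ℕ) (φ : Fin 3 → MvPowerSeries (Fin 3) ℝ)
    (hφ : ∀ j, constantCoeff (φ j) = 0) :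
    MvPowerSeries (Fin n ⊕ Fin 3) ℝ →ₐ[ℝ] MvPowerSeries (Fin n ⊕ Fin 3) ℝ :=
  substAlgHom (hasSubst_of_zero (constantCoeff_reparam_elim (n := n) hφ))

theorem reparamHom_eq_subst (f : MvPowerSeries (Fin n ⊕ Fin 3) ℝ) :
    reparamHom n φ hφ f = subst (Sum.elim (fun i => X (Sum.inl i)) fun j => ofParams (φ j)) f :=
  substAlgHom_apply _ _

theorem reparam_eq (f : VecSeries 3) : reparam φ f = fun i => reparamHom 3 φ hφ (f i) := by
  ext1 i
  rw [reparamHom_eq_subst]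
  rfl

theorem reparamHom_X_inl (i : Fin n) : reparamHom n φ hφ (X (Sum.inl i)) = X (Sum.inl i) :=
  substAlgHom_X _ _

theorem reparamHom_X_inr (j : Fin 3) : reparamHom n φ hφ (X (Sum.inr j)) = ofParams (φ j) :=
  substAlgHom_X _ _

theorem reparamHom_coord (i : Fin 3) : reparamHom 3 φ hφ (coord i) = coord i :=
  reparamHom_X_inl hφ i

theorem constantCoeff_reparamHom (f : MvPowerSeries (Fin n ⊕ Fin 3) ℝ) :
    constantCoeff (reparamHom n φ hφ f) = constantCoeff f := by
  rw [reparamHom_eq_subst, constantCoeff_subst' (constantCoeff_reparam_elim hφ)]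

theorem pderiv_reparamHom (i : Fin n) (f : MvPowerSeries (Fin n ⊕ Fin 3) ℝ) :
    pderiv ℝ (Sum.inl i) (reparamHom n φ hφ f) =
      reparamHom n φ hφ (pderiv ℝ (Sum.inl i) f) := by
  classical
  simp only [reparamHom_eq_subst]
  rw [pderiv_subst (constantCoeff_reparam_elim hφ), Fintype.sum_sum_type]
  simp [pderiv_X, pderiv_ofParams, Pi.single_apply]

theorem reparamHom_ofParams (ε : MvPowerSeries (Fin 3) ℝ) :
    reparamHom n φ hφ (ofParams ε) = ofParams (subst φ ε) := by
  have : (reparamHom n φ hφ).comp (rename (paramEmb n 3)) =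
      (rename (paramEmb n 3)).comp (substAlgHom (hasSubst_of_zero hφ)) := by
    refine algHom_ext_of_X ?_ ?_
    · intro i
      rw [AlgHom.comp_apply, constantCoeff_reparamHom, constantCoeff_rename, constantCoeff_X]
    · intro i
      rw [AlgHom.comp_apply, AlgHom.comp_apply, rename_X, paramEmb_apply, reparamHom_X_inr,
        substAlgHom_X, ofParams_eq]
  rw [ofParams_eq, ofParams_eq, ← substAlgHom_apply (hasSubst_of_zero hφ)]
  exact DFunLike.congr_fun this ε

theorem reparamHom_ofPlane (p : MvPowerSeries (Fin 2 ⊕ Fin 3) ℝ) :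
    reparamHom 3 φ hφ (ofPlane p) = ofPlane (reparamHom 2 φ hφ p) := by
  have hP : ∀ ε : MvPowerSeries (Fin 3) ℝ,
      rename (planeEmb 3) (ofParams ε : MvPowerSeries (Fin 2 ⊕ Fin 3) ℝ) = ofParams ε := by
    intro ε
    rw [ofParams_eq, ofParams_eq, rename_rename]
    rfl
  have : (reparamHom 3 φ hφ).comp (rename (planeEmb 3)) =
      (rename (planeEmb 3)).comp (reparamHom 2 φ hφ) := by
    refine algHom_ext_of_X ?_ ?_
    · intro s
      rw [AlgHom.comp_apply, constantCoeff_reparamHom, constantCoeff_rename, constantCoeff_X]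
    · rintro (i | j)
      · rw [AlgHom.comp_apply, AlgHom.comp_apply, rename_X, reparamHom_X_inl, rename_X]
        exact reparamHom_X_inl hφ _
      · rw [AlgHom.comp_apply, AlgHom.comp_apply, rename_X, planeEmb_inr, reparamHom_X_inr,
          reparamHom_X_inr, hP]
  rw [ofPlane_eq, ofPlane_eq]
  exact DFunLike.congr_fun this p

theorem reparamHom_unfoldingTerm (ε μ₁ μ₂ : MvPowerSeries (Fin 3) ℝ)
    (p : MvPowerSeries (Fin 2 ⊕ Fin 3) ℝ) :
    reparamHom 3 φ hφ (unfoldingTerm ε μ₁ μ₂ p) =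
      unfoldingTerm (subst φ ε) (subst φ μ₁) (subst φ μ₂) (reparamHom 2 φ hφ p) := by
  simp only [unfoldingTerm, map_add, map_mul, reparamHom_ofParams, reparamHom_coord,
    reparamHom_ofPlane]

theorem centralHom_reparamHom (f : MvPowerSeries (Fin n ⊕ Fin 3) ℝ) :
    centralHom n 3 (reparamHom n φ hφ f) = centralHom n 3 f := by
  have : (centralHom n 3).comp (reparamHom n φ hφ) = centralHom n 3 := by
    refine algHom_ext_of_X ?_ ?_
    · intro s
      rw [AlgHom.comp_apply, constantCoeff_central, constantCoeff_reparamHom, constantCoeff_X]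
    · rintro (i | j)
      · rw [AlgHom.comp_apply, reparamHom_X_inl]
      · rw [AlgHom.comp_apply, reparamHom_X_inr, centralHom_ofParams, hφ, map_zero,
          centralHom_X_inr]
  exact DFunLike.congr_fun this f

theorem atOrigin_reparamHom (f : MvPowerSeries (Fin n ⊕ Fin 3) ℝ) :
    atOrigin n 3 (reparamHom n φ hφ f) =
      substAlgHom (hasSubst_of_zero hφ) (atOrigin n 3 f) := by
  have : (atOrigin n 3).comp (reparamHom n φ hφ) =
      (substAlgHom (hasSubst_of_zero hφ)).comp (atOrigin n 3) := by
    refine algHom_ext_of_X ?_ ?_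
    · intro s
      rw [AlgHom.comp_apply, constantCoeff_atOrigin, constantCoeff_reparamHom, constantCoeff_X]
    · rintro (i | j)
      · rw [AlgHom.comp_apply, AlgHom.comp_apply, reparamHom_X_inl, atOrigin_X_inl, map_zero]
      · rw [AlgHom.comp_apply, AlgHom.comp_apply, reparamHom_X_inr, atOrigin_ofParams,
          atOrigin_X_inr, substAlgHom_X]
  exact DFunLike.congr_fun this f

theorem IsQuadratic.reparam {p : MvPowerSeries (Fin 2 ⊕ Fin 3) ℝ} (hp : IsQuadratic p) :
    IsQuadratic (reparamHom 2 φ hφ p) := by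
  rw [isQuadratic_iff] at hp ⊢
  refine ⟨?_, fun i => ?_⟩
  · rw [atOrigin_reparamHom, hp.1, map_zero]
  · rw [pderiv_reparamHom, atOrigin_reparamHom, hp.2, map_zero]

theorem jac_reparam (f : VecSeries 3) :
    jac (reparam φ f) = (jac f).map (reparamHom 3 φ hφ) := by
  ext1 i j
  rw [reparam_eq hφ, jac, Matrix.of_apply, pderiv_reparamHom]
  rfl

include hφ in
theorem constantCoeff_reparam {f : VecSeries 3} (hf : ∀ i, constantCoeff (f i) = 0) (i : Fin 3) :
    constantCoeff (reparam φ f i) = 0 := by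
  rw [reparam_eq hφ, constantCoeff_reparamHom, hf]

include hφ in
theorem IsCoordinateChange.reparam {ψ : VecSeries 3} (h : IsCoordinateChange ψ) :
    IsCoordinateChange (reparam φ ψ) := by
  refine ⟨⟨constantCoeff_reparam hφ h.1.1, fun i j => ?_⟩, ?_⟩
  · rw [coeff_single_eq_pderiv, reparam_eq hφ, pderiv_reparamHom, constantCoeff_reparamHom,
      ← coeff_single_eq_pderiv, h.1.2]
  · rw [jac_reparam hφ]
    have := (AlgHom.map_det (reparamHom 3 φ hφ) (jac ψ)).symm
    rw [h.2, map_one] at this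
    exact this

theorem reparamHom_lieDeriv (v : VecSeries 3) (g : Series 3) :
    reparamHom 3 φ hφ (lieDeriv v g) = lieDeriv (reparam φ v) (reparamHom 3 φ hφ g) := by
  simp only [lieDeriv_apply, map_sum, map_mul, pderiv_reparamHom, reparam_eq hφ]

theorem reparamHom_pull {f : VecSeries 3} (hf : ∀ i, constantCoeff (f i) = 0)
    (hf' : ∀ i, constantCoeff (reparam φ f i) = 0) (g : Series 3) :
    reparamHom 3 φ hφ (pull f hf g) = pull (reparam φ f) hf' (reparamHom 3 φ hφ g) := by
  have : (reparamHom 3 φ hφ).comp (pull f hf) =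
      (pull (reparam φ f) hf').comp (reparamHom 3 φ hφ) := by
    refine algHom_ext_of_X ?_ ?_
    · intro s
      rw [AlgHom.comp_apply, constantCoeff_reparamHom, constantCoeff_pull, constantCoeff_X]
    · rintro (i | j)
      · change reparamHom 3 φ hφ (pull f hf (coord i)) =
          pull (TripleEigenvalue.reparam φ f) hf' (reparamHom 3 φ hφ (coord i))
        rw [pull_coord, reparamHom_coord, pull_coord, reparam_eq hφ]
      · rw [AlgHom.comp_apply, AlgHom.comp_apply, pull_param, reparamHom_X_inr, pull_ofParams]
  exact DFunLike.congr_fun this g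

theorem FrameNormalizes.reparam {C : Matrix (Fin 3) (Fin 3) ℝ} {T T' : Module.End ℝ (Series 3)}
    (hT : ∀ g, reparamHom 3 φ hφ (T g) = T' (reparamHom 3 φ hφ g)) {ψ : VecSeries 3}
    {q : Series 3} (h : FrameNormalizes C T ψ q) :
    FrameNormalizes C T' (reparam φ ψ) (reparamHom 3 φ hφ q) := by
  obtain ⟨hψ, W, hW, hq⟩ := h
  refine ⟨hψ.reparam hφ, reparamHom 3 φ hφ W, ?_, ?_⟩
  · have hpow : ∀ m : ℕ, reparamHom 3 φ hφ ((T ^ m) W) = (T' ^ m) (reparamHom 3 φ hφ W) := by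
      intro m
      induction m with
      | zero => rfl
      | succ m ih => rw [pow_succ', pow_succ', Module.End.mul_apply, Module.End.mul_apply, hT, ih]
    rw [reparam_eq hφ, hW]
    ext1 i
    simp only [iterFrame, map_sum, map_smul, hpow]
  · rw [← hT, ← hT, ← hT, hq, reparamHom_pull]

end Reparam

/-- The operator of the reparametrized family depends on `φ`, which is only found in the proof.
Hence the quantification over every `S` that is intertwined with `T` by the reparametrization; flows
and maps then supply their own `S`. -/
theorem IsNormalizable.exists_full_unfolding {C : Matrix (Fin 3) (Fin 3) ℝ}
    {T₀ T : Module.End ℝ (Series 3)} (H : IsNormalizable C T₀ T)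
    (hC : ∀ i, C i 0 = if i = 0 then 1 else 0) (hT : ∀ j, T (X (Sum.inr j)) = 0)
    {T' : Module.End ℝ (Series 0)} (hT' : ∀ g, centralHom 3 3 (T g) = T' (centralHom 3 3 g))
    (htrans : ∀ ψ q, FrameNormalizes C T ψ q → IsTransversal q)
    {ψ₀ : VecSeries 0} {p₀ : MvPowerSeries (Fin 2 ⊕ Fin 0) ℝ}
    (h₀ : FrameNormalizes C T' ψ₀ (ofPlane p₀)) :
    ∃ (φ : Fin 3 → MvPowerSeries (Fin 3) ℝ) (hφ : IsParamChange φ) (ψ : VecSeries 3)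
      (p : MvPowerSeries (Fin 2 ⊕ Fin 3) ℝ), IsQuadratic p ∧
      (∀ S : Module.End ℝ (Series 3),
        (∀ g, reparamHom 3 φ hφ.1 (T g) = S (reparamHom 3 φ hφ.1 g)) →
        FrameNormalizes C S ψ (unfoldingTerm (X 0) (X 1) (X 2) p)) ∧
      centralVec ψ = ψ₀ ∧ central p = p₀ := by
  obtain ⟨ψ, q, h, rfl, hq⟩ := H.exists_extension hT' h₀
  obtain ⟨ψ', θ, p, hθ, hp, h', hc, hp'⟩ :=
    h.exists_unfolding_of_isTransversal H hC hT (htrans ψ q h)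
  obtain ⟨φ, hφ, hφθ⟩ := hθ.exists_inverse
  refine ⟨φ, hφ, reparam φ ψ', reparamHom 2 φ hφ.1 p, hp.reparam hφ.1, fun S hS => ?_, ?_, ?_⟩
  · have := h'.reparam hφ.1 hS
    rwa [reparamHom_unfoldingTerm, hφθ, hφθ, hφθ] at this
  · rw [← hc, centralVec_eq, centralVec_eq, reparam_eq hφ.1]
    simp only [centralHom_reparamHom]
  · rw [central_eq, centralHom_reparamHom, ← central_eq]
    exact ofPlane_injective (hp'.trans hq)

end TripleEigenvalue

end

noncomputable section

namespace TripleEigenvalue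

open MvPowerSeries Matrix

/-! ### The normal form families are full unfoldings. -/

section Converse

variable {p : MvPowerSeries (Fin 2 ⊕ Fin 3) ℝ}

/-- The unfolding term with the coefficients `ε`, `μ₁`, `μ₂` as parameters. -/
abbrev versalTerm (p : MvPowerSeries (Fin 2 ⊕ Fin 3) ℝ) : Series 3 :=
  unfoldingTerm (X 0) (X 1) (X 2) p

theorem versalTerm_mem_fil (hp : IsQuadratic p) : versalTerm p ∈ fil (grade 3) 2 := by
  refine mem_fil_grade_two.2 ⟨?_, fun j => ?_⟩
  · rw [← constantCoeff_atOrigin, atOrigin_unfoldingTerm _ _ _ hp, constantCoeff_X]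
  · rw [coeff_single_eq_pderiv, ← constantCoeff_atOrigin]
    match j with
    | 0 => rw [atOrigin_pderiv_zero_unfoldingTerm _ _ _ hp, constantCoeff_X]
    | 1 => rw [atOrigin_pderiv_one_unfoldingTerm _ _ _ hp, constantCoeff_X]
    | 2 => rw [pderiv_two_unfoldingTerm, map_zero, map_zero]

theorem linHom_versalTerm_inl (hp : IsQuadratic p) (i : Fin 3) :
    linHom 3 (versalTerm p) (Sum.inl i) = 0 :=
  (mem_fil_grade_two.1 (versalTerm_mem_fil hp)).2 i

theorem linHom_versalTerm_inr (hp : IsQuadratic p) (j : Fin 3) :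
    linHom 3 (versalTerm p) (Sum.inr j) = if j = 0 then 1 else 0 := by
  rw [linHom_unfoldingTerm_inr _ _ _ hp, coeff_X]
  simp only [Finsupp.single_left_inj one_ne_zero]

theorem linHom_pderiv_zero_versalTerm_inr (hp : IsQuadratic p) (j : Fin 3) :
    linHom 3 (pderiv ℝ (Sum.inl 0) (versalTerm p)) (Sum.inr j) = if j = 1 then 1 else 0 := by
  rw [linHom_pderiv_zero_unfoldingTerm_inr _ _ _ hp, coeff_X]
  simp only [Finsupp.single_left_inj one_ne_zero]

theorem linHom_pderiv_one_versalTerm_inr (hp : IsQuadratic p) (j : Fin 3) :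
    linHom 3 (pderiv ℝ (Sum.inl 1) (versalTerm p)) (Sum.inr j) = if j = 2 then 1 else 0 := by
  rw [linHom_pderiv_one_unfoldingTerm_inr _ _ _ hp, coeff_X]
  simp only [Finsupp.single_left_inj one_ne_zero]

theorem isFlowUnfolding_versalTerm (hp : IsQuadratic p) :
    IsFlowUnfolding (flowFamily (versalTerm p)) := by
  refine ⟨hasLinearPart_iff.2 fun i => ?_, ?_⟩
  · match i with
    | 0 => rw [flowFamily_zero, linearVec_N_zero, sub_self]; exact zero_mem _
    | 1 => rw [flowFamily_one, linearVec_N_one, sub_self]; exact zero_mem _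
    | 2 => rw [flowFamily_two, linearVec_N_two, sub_zero]; exact versalTerm_mem_fil hp
  · rw [trace_jac_flowFamily, pderiv_two_unfoldingTerm]

theorem isMapUnfolding_versalTerm (hp : IsQuadratic p) :
    IsMapUnfolding (mapFamily (versalTerm p)) := by
  refine ⟨hasLinearPart_iff.2 fun i => ?_, ?_⟩
  · match i with
    | 0 => rw [mapFamily_zero, linearVec_J_zero, sub_self]; exact zero_mem _
    | 1 => rw [mapFamily_one, linearVec_J_one, add_sub_cancel_left]; exact versalTerm_mem_fil hp
    | 2 => rw [mapFamily_two, linearVec_J_two, add_sub_cancel_left]; exact versalTerm_mem_fil hp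
  · rw [det_jac_mapFamily, pderiv_two_unfoldingTerm, add_zero]

/-- The differentials are `dy`, `dz`, `dε`, `-dμ₂` and `dμ₁`, the last two up to phase terms. The
parameter directions are tested first, then those of `y` and `z`. -/
theorem isFullFlowUnfolding_versalTerm (hp : IsQuadratic p) :
    IsFullFlowUnfolding (flowFamily (versalTerm p)) := by
  have hM := constantCoeff_jac (isFlowUnfolding_versalTerm hp).1
  refine Fintype.linearIndependent_iff.2 fun c hc => ?_
  simp only [Fintype.sum_sum_type, Fin.sum_univ_three, Fin.sum_univ_two, Sum.elim_inl,
    Sum.elim_inr, Matrix.cons_val_zero, Matrix.cons_val_one, linearCoeffs_eq, linHom_det_of_N hM,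
    linHom_secondTrace_of_N hM, flowFamily_zero, flowFamily_one, flowFamily_two] at hc
  rw [jac_flowFamily] at hc
  have h0 := congrFun hc (Sum.inr 0)
  have h1 := congrFun hc (Sum.inr 1)
  have h2 := congrFun hc (Sum.inr 2)
  have h3 := congrFun hc (Sum.inl 1)
  have h4 := congrFun hc (Sum.inl 2)
  simp [linHom_coord, linHom_versalTerm_inr hp, linHom_pderiv_zero_versalTerm_inr hp,
    linHom_pderiv_one_versalTerm_inr hp] at h0 h1 h2
  simp [linHom_coord, linHom_versalTerm_inl hp, h1, h2] at h3 h4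
  rintro (i | i) <;> fin_cases i <;> assumption

/-- The differentials are `dy`, `dz + dε`, `dε` and, up to phase terms, `dμ₂` for the trace and `dμ₂
- dμ₁` for `σ`. -/
theorem isFullMapUnfolding_versalTerm (hp : IsQuadratic p) :
    IsFullMapUnfolding (mapFamily (versalTerm p)) := by
  have hM := constantCoeff_jac (isMapUnfolding_versalTerm hp).1
  refine Fintype.linearIndependent_iff.2 fun c hc => ?_
  simp only [Fintype.sum_sum_type, Fin.sum_univ_three, Fin.sum_univ_two, Sum.elim_inl,
    Sum.elim_inr, Matrix.cons_val_zero, Matrix.cons_val_one, linearCoeffs_eq,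
    linHom_secondTrace_of_J hM, Pi.sub_apply, mapFamily_zero, mapFamily_one, mapFamily_two,
    Matrix.trace_fin_three] at hc
  rw [jac_mapFamily, pderiv_two_unfoldingTerm] at hc
  have h0 := congrFun hc (Sum.inr 0)
  have h1 := congrFun hc (Sum.inr 1)
  have h2 := congrFun hc (Sum.inr 2)
  have h3 := congrFun hc (Sum.inl 1)
  have h4 := congrFun hc (Sum.inl 2)
  simp [linHom_coord, linHom_one, linHom_versalTerm_inr hp, linHom_pderiv_zero_versalTerm_inr hp,
    linHom_pderiv_one_versalTerm_inr hp] at h0 h1 h2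
  rw [h1] at h2 h3 h4
  simp at h2
  rw [h2] at h3 h4
  simp [linHom_coord, linHom_versalTerm_inl hp] at h3 h4
  rw [h4, zero_add] at h0
  rintro (i | i) <;> fin_cases i <;> assumption

theorem central_versalTerm (p : MvPowerSeries (Fin 2 ⊕ Fin 3) ℝ) :
    centralHom 3 3 (versalTerm p) = ofPlane (central p) :=
  centralHom_unfoldingTerm (constantCoeff_X _) (constantCoeff_X _) (constantCoeff_X _) p

theorem centralHom_coord {k : ℕ} (i : Fin 3) : centralHom 3 k (coord i) = coord i :=
  centralHom_X_inl i

theorem centralVec_flowFamily {k : ℕ} (q : Series k) :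
    centralVec (flowFamily q) = flowFamily (centralHom 3 k q) := by
  rw [centralVec_eq]
  refine funext_fin_three ?_ ?_ ?_
  · rw [flowFamily_zero, flowFamily_zero, centralHom_coord]
  · rw [flowFamily_one, flowFamily_one, centralHom_coord]
  · rw [flowFamily_two, flowFamily_two]

theorem centralVec_mapFamily {k : ℕ} (q : Series k) :
    centralVec (mapFamily q) = mapFamily (centralHom 3 k q) := by
  rw [centralVec_eq]
  refine funext_fin_three ?_ ?_ ?_
  · simp only [mapFamily_zero, map_add, centralHom_coord]
  · simp only [mapFamily_one, map_add, centralHom_coord]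
  · simp only [mapFamily_two, map_add, centralHom_coord]

end Converse

/-! ### Full unfoldings of flows and maps, and the assembly of the theorem. -/

section FullUnfoldings

theorem exists_unfolding_of_full_flow {v : VecSeries 3} (hv : IsFlowUnfolding v)
    (hfull : IsFullFlowUnfolding v) {ψ₀ : VecSeries 0} {p₀ : MvPowerSeries (Fin 2 ⊕ Fin 0) ℝ}
    (h₀ : FlowNormalizes (centralVec v) ψ₀ (ofPlane p₀)) :
    ∃ (φ : Fin 3 → MvPowerSeries (Fin 3) ℝ) (ψ : VecSeries 3)
      (p : MvPowerSeries (Fin 2 ⊕ Fin 3) ℝ), IsParamChange φ ∧ IsQuadratic p ∧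
      FlowNormalizes (reparam φ v) ψ (versalTerm p) ∧ centralVec ψ = ψ₀ ∧ central p = p₀ := by
  have H := isNormalizable_flow hv
  have hT : ∀ j, lieDeriv v (X (Sum.inr j)) = 0 := by
    intro j
    rw [lieDeriv_apply]
    exact Finset.sum_eq_zero fun i _ => by rw [pderiv_X_of_ne Sum.inr_ne_inl, mul_zero]
  obtain ⟨φ, hφ, ψ, p, hp, h, hψ, hp₀⟩ := H.exists_full_unfolding
    (fun i => Matrix.one_apply) hT (centralHom_lieDeriv v)
    (fun ψ q h => isTransversal_of_full_flow hv (h.mem_fil H) hfull (flowNormalizes_iff.2 h))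
    (flowNormalizes_iff.1 h₀)
  exact ⟨φ, ψ, p, hφ, hp, flowNormalizes_iff.2 (h _ (reparamHom_lieDeriv hφ.1 v)), hψ, hp₀⟩

theorem exists_unfolding_of_full_map {f : VecSeries 3} (hf : IsMapUnfolding f)
    (hfull : IsFullMapUnfolding f) {ψ₀ : VecSeries 0} {p₀ : MvPowerSeries (Fin 2 ⊕ Fin 0) ℝ}
    (h₀ : MapNormalizes (centralVec f) ψ₀ (ofPlane p₀)) :
    ∃ (φ : Fin 3 → MvPowerSeries (Fin 3) ℝ) (ψ : VecSeries 3)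
      (p : MvPowerSeries (Fin 2 ⊕ Fin 3) ℝ), IsParamChange φ ∧ IsQuadratic p ∧
      MapNormalizes (reparam φ f) ψ (versalTerm p) ∧ centralVec ψ = ψ₀ ∧ central p = p₀ := by
  have H := isNormalizable_map hf
  have hf0 : ∀ i, constantCoeff (f i) = 0 := hf.1.1
  have hC : ∀ i, J i 0 = if i = 0 then 1 else 0 := by
    intro i
    fin_cases i <;> simp [J, N]
  have hT : ∀ j, diffOp f hf0 (X (Sum.inr j)) = 0 := by
    intro j
    rw [diffOp_apply, pull_param, sub_self]
  obtain ⟨φ, hφ, ψ, p, hp, h, hψ, hp₀⟩ := H.exists_full_unfolding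
    hC hT (centralHom_diffOp hf0)
    (fun ψ q h => isTransversal_of_full_map hf (h.mem_fil H) (H.planar ψ q h) hfull
      ((mapNormalizes_iff hf0).2 h))
    ((mapNormalizes_iff (constantCoeff_centralVec hf0)).1 h₀)
  refine ⟨φ, ψ, p, hφ, hp,
    (mapNormalizes_iff (constantCoeff_reparam hφ.1 hf0)).2 (h _ fun g => ?_), hψ, hp₀⟩
  rw [diffOp_apply, diffOp_apply, map_sub, reparamHom_pull]

end FullUnfoldings

end TripleEigenvalue

end

theorem theorem3 :
    -- Vector fields: every unfolding, with any number of parameters.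
    (∀ (k : ℕ) (v : VecSeries k), IsFlowUnfolding v →
      (∃ (ψ₀ : VecSeries 0) (p₀ : MvPowerSeries (Fin 2 ⊕ Fin 0) ℝ),
        IsQuadratic p₀ ∧ FlowNormalizes (centralVec v) ψ₀ (ofPlane p₀)) ∧
      ∀ (ψ₀ : VecSeries 0) (p₀ : MvPowerSeries (Fin 2 ⊕ Fin 0) ℝ),
        IsQuadratic p₀ → FlowNormalizes (centralVec v) ψ₀ (ofPlane p₀) →
        ∃ (ψ : VecSeries k) (ε μ₁ μ₂ : MvPowerSeries (Fin k) ℝ)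
          (p : MvPowerSeries (Fin 2 ⊕ Fin k) ℝ),
          MvPowerSeries.constantCoeff ε = 0 ∧ MvPowerSeries.constantCoeff μ₁ = 0 ∧
          MvPowerSeries.constantCoeff μ₂ = 0 ∧ IsQuadratic p ∧
          FlowNormalizes v ψ (unfoldingTerm ε μ₁ μ₂ p) ∧
          centralVec ψ = ψ₀ ∧ central p = p₀) ∧
    -- Vector fields: `ε`, `μ₁`, `μ₂` as the parameters of a full three-parameter unfolding.
    (∀ v : VecSeries 3, IsFlowUnfolding v → IsFullFlowUnfolding v →
      ∀ (ψ₀ : VecSeries 0) (p₀ : MvPowerSeries (Fin 2 ⊕ Fin 0) ℝ),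
        IsQuadratic p₀ → FlowNormalizes (centralVec v) ψ₀ (ofPlane p₀) →
        ∃ (φ : Fin 3 → MvPowerSeries (Fin 3) ℝ) (ψ : VecSeries 3)
          (p : MvPowerSeries (Fin 2 ⊕ Fin 3) ℝ),
          IsParamChange φ ∧ IsQuadratic p ∧
          FlowNormalizes (reparam φ v) ψ
            (unfoldingTerm (MvPowerSeries.X 0) (MvPowerSeries.X 1) (MvPowerSeries.X 2) p) ∧
          centralVec ψ = ψ₀ ∧ central p = p₀) ∧
    -- Vector fields: conversely, the families of this form are full unfoldings.
    (∀ p : MvPowerSeries (Fin 2 ⊕ Fin 3) ℝ, IsQuadratic p →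
      IsFlowUnfolding (flowFamily
        (unfoldingTerm (MvPowerSeries.X 0) (MvPowerSeries.X 1) (MvPowerSeries.X 2) p)) ∧
      IsFullFlowUnfolding (flowFamily
        (unfoldingTerm (MvPowerSeries.X 0) (MvPowerSeries.X 1) (MvPowerSeries.X 2) p)) ∧
      centralVec (flowFamily
        (unfoldingTerm (MvPowerSeries.X 0) (MvPowerSeries.X 1) (MvPowerSeries.X 2) p)) =
          flowFamily (ofPlane (central p))) ∧
    -- Maps: every unfolding, with any number of parameters.
    (∀ (k : ℕ) (f : VecSeries k), IsMapUnfolding f →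
      (∃ (ψ₀ : VecSeries 0) (p₀ : MvPowerSeries (Fin 2 ⊕ Fin 0) ℝ),
        IsQuadratic p₀ ∧ MapNormalizes (centralVec f) ψ₀ (ofPlane p₀)) ∧
      ∀ (ψ₀ : VecSeries 0) (p₀ : MvPowerSeries (Fin 2 ⊕ Fin 0) ℝ),
        IsQuadratic p₀ → MapNormalizes (centralVec f) ψ₀ (ofPlane p₀) →
        ∃ (ψ : VecSeries k) (ε μ₁ μ₂ : MvPowerSeries (Fin k) ℝ)
          (p : MvPowerSeries (Fin 2 ⊕ Fin k) ℝ),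
          MvPowerSeries.constantCoeff ε = 0 ∧ MvPowerSeries.constantCoeff μ₁ = 0 ∧
          MvPowerSeries.constantCoeff μ₂ = 0 ∧ IsQuadratic p ∧
          MapNormalizes f ψ (unfoldingTerm ε μ₁ μ₂ p) ∧
          centralVec ψ = ψ₀ ∧ central p = p₀) ∧
    -- Maps: `ε`, `μ₁`, `μ₂` as the parameters of a full three-parameter unfolding.
    (∀ f : VecSeries 3, IsMapUnfolding f → IsFullMapUnfolding f →
      ∀ (ψ₀ : VecSeries 0) (p₀ : MvPowerSeries (Fin 2 ⊕ Fin 0) ℝ),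
        IsQuadratic p₀ → MapNormalizes (centralVec f) ψ₀ (ofPlane p₀) →
        ∃ (φ : Fin 3 → MvPowerSeries (Fin 3) ℝ) (ψ : VecSeries 3)
          (p : MvPowerSeries (Fin 2 ⊕ Fin 3) ℝ),
          IsParamChange φ ∧ IsQuadratic p ∧
          MapNormalizes (reparam φ f) ψ
            (unfoldingTerm (MvPowerSeries.X 0) (MvPowerSeries.X 1) (MvPowerSeries.X 2) p) ∧
          centralVec ψ = ψ₀ ∧ central p = p₀) ∧
    -- Maps: conversely, the families of this form are full unfoldings.
    (∀ p : MvPowerSeries (Fin 2 ⊕ Fin 3) ℝ, IsQuadratic p →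
      IsMapUnfolding (mapFamily
        (unfoldingTerm (MvPowerSeries.X 0) (MvPowerSeries.X 1) (MvPowerSeries.X 2) p)) ∧
      IsFullMapUnfolding (mapFamily
        (unfoldingTerm (MvPowerSeries.X 0) (MvPowerSeries.X 1) (MvPowerSeries.X 2) p)) ∧
      centralVec (mapFamily
        (unfoldingTerm (MvPowerSeries.X 0) (MvPowerSeries.X 1) (MvPowerSeries.X 2) p)) =
          mapFamily (ofPlane (central p))) := by
  refine ⟨fun k v hv => ⟨?_, fun ψ₀ p₀ _ h₀ => ?_⟩,
    fun v hv hfull ψ₀ p₀ _ h₀ => exists_unfolding_of_full_flow hv hfull h₀,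
    fun p hp => ⟨isFlowUnfolding_versalTerm hp, isFullFlowUnfolding_versalTerm hp, ?_⟩,
    fun k f hf => ⟨?_, fun ψ₀ p₀ _ h₀ => ?_⟩,
    fun f hf hfull ψ₀ p₀ _ h₀ => exists_unfolding_of_full_map hf hfull h₀,
    fun p hp => ⟨isMapUnfolding_versalTerm hp, isFullMapUnfolding_versalTerm hp, ?_⟩⟩
  · obtain ⟨ψ₀, p₀, hp₀, h⟩ :=
      (isNormalizable_flow (isFlowUnfolding_central hv)).exists_normal_form
    exact ⟨ψ₀, p₀, hp₀, flowNormalizes_iff.2 h⟩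
  · obtain ⟨ψ, ε, μ₁, μ₂, p, hε, hμ₁, hμ₂, hp, h, hψ, hp₀⟩ :=
      (isNormalizable_flow hv).exists_unfolding (centralHom_lieDeriv v) (flowNormalizes_iff.1 h₀)
    exact ⟨ψ, ε, μ₁, μ₂, p, hε, hμ₁, hμ₂, hp, flowNormalizes_iff.2 h, hψ, hp₀⟩
  · exact (centralVec_flowFamily _).trans (congrArg _ (central_versalTerm p))
  · have hf' := isMapUnfolding_central hf
    obtain ⟨ψ₀, p₀, hp₀, h⟩ := (isNormalizable_map hf').exists_normal_form
    exact ⟨ψ₀, p₀, hp₀, (mapNormalizes_iff hf'.1.1).2 h⟩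
  · obtain ⟨ψ, ε, μ₁, μ₂, p, hε, hμ₁, hμ₂, hp, h, hψ, hp₀⟩ :=
      (isNormalizable_map hf).exists_unfolding (centralHom_diffOp hf.1.1)
        ((mapNormalizes_iff (constantCoeff_centralVec hf.1.1)).1 h₀)
    exact ⟨ψ, ε, μ₁, μ₂, p, hε, hμ₁, hμ₂, hp, (mapNormalizes_iff hf.1.1).2 h, hψ, hp₀⟩
  · exact (centralVec_mapFamily _).trans (congrArg _ (central_versalTerm p))
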